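/- Let $(M,g_{ab})$ be a smooth, oriented and time-oriented 4-dimensional space-time of signature $(-,+,+,+)$, with Levi-Civita derivative $\nabla$ and volume form $\epsilon_{abcd}$. Let $H\subset M$ be a dynamical horizon segment (DHS): a connected 3-dimensional submanifold (possibly with boundary) that is nowhere null and is foliated by marginally trapped surfaces (MTSs) $S$, i.e. embedded spacelike 2-spheres with future directed null normals $k^a,\underline k^a$, $k^a\underline k_a=-1$, whose expansions $\Theta_{(X)}=\tilde q^{ab}\nabla_aX_b$ satisfy $\Theta_{(k)}=0$ and $\Theta_{(\underline k)}\neq0$ everywhere, and on each of which $\sigma^{(k)}_{ab}\sigma_{(k)}^{ab}+R_{ab}k^ak^b$ is not identically zero ($\sigma^{(k)}_{ab}$ is the shear of $k^a$). Let $\varphi^a$ be a Killing field of $g_{ab}$ on an open neighbourhood of $H$ that is rotational: it is tangential to every MTS $S$ of $H$, not identically zero on any of them, and its nontrivial orbits on $H$ are closed with period $2\pi$. On an MTS $S$ let $\tilde q_{ab}$ be the induced metric with derivative operator $\tilde D$ and area element $d^2\tilde V$, let $\tilde\epsilon_{cd}=\epsilon_{abcd}\,\underline k^a k^b$ be the area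 2-form, $R$ the area radius ($4\pi R^2=\oint_S d^2\tilde V$), and $\tilde\omega_a=-\tilde q_a{}^b\,\underline k_c\nabla_b k^c$ the rotational 1-form. Let $\zeta$ be the function on $S$ with $\tilde D_a\zeta=R^{-2}\tilde\epsilon_{ba}\varphi^b$ and $\oint_S\zeta\,d^2\tilde V=0$, and let $Y_\ell(\zeta)=\sqrt{(2\ell+1)/4\pi}\,P_\ell(\zeta)$, with $P_\ell$ the Legendre polynomials. The spin multipoles of $S$ are $$\mathtt S_\ell[S]=\tfrac14\oint_S\big[2\,\tilde\epsilon^{ab}\tilde D_a\tilde\omega_b\big]\,Y_\ell(\zeta)\,d^2\tilde V,\qquad \ell=0,1,2,\dots$$ Let $\mathfrak n=g_{ab}\varphi^a\varphi^b$ be the norm and $\mathfrak t_a=\epsilon_{abcd}(\nabla^b\varphi^c)\varphi^d$ the twist of $\varphi^a$. Then for every MTS $S$ of $H$ and every $\ell\ge0$ the function $\mathfrak n^{-1}\,\mathfrak t^a\partial_aY_\ell(\zeta)$ (defined off the zeros of $\varphi^a$) is integrable on $S$ and $$\mathtt S_\ell[S]=\frac14\oint_S\frac1{\mathfrak n}\,\big(\mathfrak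 t^a\partial_aY_\ell(\zeta)\big)\,d^2\tilde V,$$ where $\mathfrak t^a\partial_aY_\ell:=\tilde q^{ab}\mathfrak t_a\tilde D_bY_\ell$. In particular, if $\mathfrak t_a$ vanishes on an MTS $S$, then $\mathtt S_\ell[S]=0$ for all $\ell$; hence if $\varphi^a$ is hypersurface orthogonal on $H$, i.e. $\varphi_{[a}\nabla_b\varphi_{c]}=0$ at the points of $H$, then all spin multipoles $\mathtt S_\ell[S]$ vanish on every MTS $S$ of $H$. -/

import Mathlib

open Set Filter Topology MeasureTheory Manifold Bundle
open scoped ContDiff EuclideanSpace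

noncomputable section

/-- Model space of a 4-dimensional manifold. -/
abbrev E4 : Type := EuclideanSpace ℝ (Fin 4)

/-- Euclidean 3-space, in which the standard 2-sphere lives. -/
abbrev E3 : Type := EuclideanSpace ℝ (Fin 3)

/-- The standard unit 2-sphere. -/
abbrev S2 : Type := Metric.sphere (0 : E3) 1

/-- Vector fields on a 4-manifold (no regularity built in). -/
abbrev VField (M : Type*) [TopologicalSpace M] [ChartedSpace E4 M] : Type _ :=
  ∀ p : M, TangentSpace (𝓡 4) p

/-- `X` is a smooth vector field on the set `U`. -/
def SmoothFieldOn {M : Type*} [TopologicalSpace M] [ChartedSpace E4 M] [IsManifold (𝓡 4) ∞ M]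
    (X : VField M) (U : Set M) : Prop :=
  ContMDiffOn (𝓡 4) (𝓡 4).tangent ∞ (fun p => (⟨p, X p⟩ : TangentBundle (𝓡 4) M)) U

/-! ### Space-times -/

/-- An oriented and time-oriented smooth Lorentzian structure of signature `-,+,+,+` on a
4-manifold. -/
structure Spacetime (M : Type*) [TopologicalSpace M] [ChartedSpace E4 M]
    [IsManifold (𝓡 4) ∞ M] where
  /-- the metric `g_{ab}` -/
  g : ∀ p : M, TangentSpace (𝓡 4) p →L[ℝ] TangentSpace (𝓡 4) p →L[ℝ] ℝ
  g_smooth : ContMDiff (𝓡 4) ((𝓡 4).prod 𝓘(ℝ, E4 →L[ℝ] E4 →L[ℝ] ℝ)) ∞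
    (fun p => TotalSpace.mk' (E4 →L[ℝ] E4 →L[ℝ] ℝ) p (g p))
  g_symm : ∀ p v w, g p v w = g p w v
  g_signature : ∀ p, ∃ b : Module.Basis (Fin 4) ℝ (TangentSpace (𝓡 4) p), ∀ i j,
    g p (b i) (b j) = if i = j then (if i = 0 then -1 else 1) else 0
  /-- the volume form `ε_{abcd}` of `g`, which fixes the orientation -/
  vol : ∀ p : M, TangentSpace (𝓡 4) p [⋀^Fin 4]→ₗ[ℝ] ℝ
  vol_smooth : ∀ (U : Set M) (X : Fin 4 → VField M), IsOpen U → (∀ i, SmoothFieldOn (X i) U) →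
    ContMDiffOn (𝓡 4) 𝓘(ℝ, ℝ) ∞ (fun p => vol p (fun i => X i p)) U
  vol_sq : ∀ p v, (vol p v) ^ 2 = - (Matrix.of fun i j => g p (v i) (v j)).det
  /-- a future directed timelike vector field, which fixes the time orientation -/
  future : VField M
  future_smooth : SmoothFieldOn future univ
  future_timelike : ∀ p, g p (future p) (future p) < 0

namespace Spacetime

variable {M : Type*} [TopologicalSpace M] [ChartedSpace E4 M] [IsManifold (𝓡 4) ∞ M]

/-- The coordinate vector `∂_i` at `p`, for the preferred chart at `p`. -/
def coordVec (p : M) (i : Fin 4) : TangentSpace (𝓡 4) p := (EuclideanSpace.single i (1 : ℝ) : E4)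

variable (st : Spacetime M)

/-- The inverse metric `g^{ij}` at `p`, in the basis `coordVec p`. -/
def gInv (p : M) : Matrix (Fin 4) (Fin 4) ℝ :=
  (Matrix.of fun i j => st.g p (coordVec p i) (coordVec p j))⁻¹

/-- Raising the index of a covector at `p`. -/
def sharp (p : M) (α : TangentSpace (𝓡 4) p → ℝ) : TangentSpace (𝓡 4) p :=
  ∑ i, ∑ j, (st.gInv p i j * α (coordVec p i)) • coordVec p j

/-- Christoffel symbols of the first kind at `p`, in the preferred chart at `p`:
`Γ(u,v,w) = ½ (∂_u g(v,w) + ∂_v g(u,w) - ∂_w g(u,v))`. Here `FiberBundle.extend E4 v` is the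
vector field with the same (constant) components as `v` in that chart. -/
def christoffel (p : M) (u v w : TangentSpace (𝓡 4) p) : ℝ :=
  let gc (a b : TangentSpace (𝓡 4) p) : M → ℝ := fun q =>
    st.g q (FiberBundle.extend E4 a q) (FiberBundle.extend E4 b q)
  (1 / 2) * (mvfderiv (𝓡 4) (gc v w) p u + mvfderiv (𝓡 4) (gc u w) p v
    - mvfderiv (𝓡 4) (gc u v) p w)

/-- The Levi-Civita derivative `∇_v X` at `p`: in the preferred chart at `p`, the derivative of
the components of `X` plus the Christoffel term. -/
def nabla (X : VField M) (p : M) (v : TangentSpace (𝓡 4) p) : TangentSpace (𝓡 4) p :=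
  let t := trivializationAt E4 (fun q : M => TangentSpace (𝓡 4) q) p
  t.symm p (mvfderiv (𝓡 4) (fun q => (t ⟨q, X q⟩).2) p v)
    + st.sharp p (fun w => st.christoffel p v (X p) w)

/-- The Riemann operator `R(u,v)w = ∇_u ∇_v w - ∇_v ∇_u w - ∇_{[u,v]} w` at `p`. -/
def riemann (p : M) (u v w : TangentSpace (𝓡 4) p) : TangentSpace (𝓡 4) p :=
  let U : VField M := FiberBundle.extend E4 u
  let V : VField M := FiberBundle.extend E4 v
  let W : VField M := FiberBundle.extend E4 w
  st.nabla (fun q => st.nabla W q (V q)) p u - st.nabla (fun q => st.nabla W q (U q)) p v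
    - st.nabla W p (VectorField.mlieBracket (𝓡 4) U V p)

/-- The Ricci tensor: `Ric(v,w)` is the trace of `u ↦ R(u,v)w`. -/
def ricci (p : M) (v w : TangentSpace (𝓡 4) p) : ℝ :=
  ∑ i, ∑ j, st.gInv p i j * st.g p (st.riemann p (coordVec p i) v w) (coordVec p j)

/-- `φ` satisfies Killing's equation `∇_a φ_b + ∇_b φ_a = 0` on `U`. -/
def IsKillingOn (φ : VField M) (U : Set M) : Prop :=
  ∀ p ∈ U, ∀ v w, st.g p (st.nabla φ p v) w + st.g p v (st.nabla φ p w) = 0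

/-- The norm `𝔫 = g_{ab} φ^a φ^b`. -/
def normSq (φ : VField M) (p : M) : ℝ := st.g p (φ p) (φ p)

/-- The twist 1-form `𝔱_a = ε_{abcd} (∇^b φ^c) φ^d`. -/
def twist (φ : VField M) (p : M) (v : TangentSpace (𝓡 4) p) : ℝ :=
  ∑ i, ∑ j, st.gInv p i j * st.vol p ![v, coordVec p j, st.nabla φ p (coordVec p i), φ p]

/-- `φ` is hypersurface orthogonal at `p`: `φ_{[a} ∇_b φ_{c]} = 0` at `p`. -/
def HypersurfaceOrthogonalAt (φ : VField M) (p : M) : Prop :=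
  let F (v w : TangentSpace (𝓡 4) p) : ℝ := st.g p (st.nabla φ p v) w - st.g p (st.nabla φ p w) v
  ∀ u v w, st.g p (φ p) u * F v w + st.g p (φ p) v * F w u + st.g p (φ p) w * F u v = 0

end Spacetime

/-! ### Parametrized 2-spheres

A 2-sphere in `M` is presented by a map `e : S2 → M`. Functions and forms on the sphere are
extended to `E3 ∖ {0}` by pulling them back along `y ↦ y / |y|`; the pullback of a form is
annihilated by the radial direction `y`, and at points of the sphere it restricts to the original
form on the tangent plane `yᗮ`. Components `i, j : Fin 3` below refer to the standard basis of
`E3`. -/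

/-- The radial retraction `y ↦ y / |y|` of `E3 ∖ {0}` onto the unit sphere (junk at `0`). -/
def radial (y : E3) : S2 :=
  if h : y = 0 then ⟨EuclideanSpace.single 0 1, by simp⟩
  else ⟨‖y‖⁻¹ • y, by simp [norm_smul, h]⟩

/-- The standard basis of `E3`. -/
def e3 (i : Fin 3) : E3 := EuclideanSpace.single i 1

section Surface

variable {M : Type*} [TopologicalSpace M] [ChartedSpace E4 M] [IsManifold (𝓡 4) ∞ M]

/-- The point of the surface over `y`. -/
def pt (e : S2 → M) (y : E3) : M := e (radial y)

/-- The differential of the radially extended parametrization; on `yᗮ`, for `y` on the sphere, it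
is the differential of `e`. -/
def push (e : S2 → M) (y : E3) : E3 →L[ℝ] TangentSpace (𝓡 4) (pt e y) :=
  mfderiv 𝓘(ℝ, E3) (𝓡 4) (pt e) y

/-- `e` is an embedding of the 2-sphere with spacelike image. -/
structure IsSpacelikeSphere (st : Spacetime M) (e : S2 → M) : Prop where
  embedding : IsSmoothEmbedding (𝓡 2) (𝓡 4) ∞ e
  spacelike : ∀ (x : S2) (u : E3), inner ℝ (x : E3) u = 0 → u ≠ 0 →
    0 < st.g (pt e x) (push e x u) (push e x u)

/-- Components `q_{ij}` of the (pulled back) induced metric. -/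
def qMetric (st : Spacetime M) (e : S2 → M) (y : E3) : Matrix (Fin 3) (Fin 3) ℝ :=
  Matrix.of fun i j => st.g (pt e y) (push e y (e3 i)) (push e y (e3 j))

/-- The induced metric completed by the unit radial direction: `q_{ij} + y_i y_j`. For `y` on the
sphere the splitting `yᗮ ⊕ ℝ y` is orthogonal for it. -/
def qFull (st : Spacetime M) (e : S2 → M) (y : E3) : Matrix (Fin 3) (Fin 3) ℝ :=
  qMetric st e y + Matrix.of fun i j => y i * y j

/-- The inverse of `qFull`. Contracted with tensors that annihilate the radial direction it is the
inverse induced metric `q^{ij}`. -/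
def qInv (st : Spacetime M) (e : S2 → M) (y : E3) : Matrix (Fin 3) (Fin 3) ℝ :=
  (qFull st e y)⁻¹

/-- Density of the area element of the induced metric relative to the unit round sphere. -/
def areaDensity (st : Spacetime M) (e : S2 → M) (y : E3) : ℝ :=
  Real.sqrt (qFull st e y).det

/-- The surface integral `∮_S f d²V` for the area element of the induced metric
(`volume.toSphere` is the surface measure of the unit round sphere). -/
def surfInt (st : Spacetime M) (e : S2 → M) (f : E3 → ℝ) : ℝ :=
  ∫ x : S2, f x * areaDensity st e x ∂((volume : Measure E3).toSphere)

/-- Integrability of `f` for the area element of the induced metric. -/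
def SurfIntegrable (st : Spacetime M) (e : S2 → M) (f : E3 → ℝ) : Prop :=
  Integrable (fun x : S2 => f x * areaDensity st e x) ((volume : Measure E3).toSphere)

/-- The area radius `R`, given by `4 π R² = ∮_S d²V`. -/
def areaRadius (st : Spacetime M) (e : S2 → M) : ℝ :=
  Real.sqrt (surfInt st e (fun _ => 1) / (4 * Real.pi))

/-- `k`, `kb` are smooth future directed null normals of the surface with `k·kb = -1`. (They are
given as fields on a neighbourhood of the surface; only their values on it matter.) -/
structure IsNullNormalPair (st : Spacetime M) (e : S2 → M) (k kb : VField M) : Prop where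
  smooth : ∃ W : Set M, IsOpen W ∧ range e ⊆ W ∧ SmoothFieldOn k W ∧ SmoothFieldOn kb W
  null : ∀ p ∈ range e, st.g p (k p) (k p) = 0
  null' : ∀ p ∈ range e, st.g p (kb p) (kb p) = 0
  normalized : ∀ p ∈ range e, st.g p (k p) (kb p) = -1
  future : ∀ p ∈ range e, st.g p (k p) (st.future p) < 0
  future' : ∀ p ∈ range e, st.g p (kb p) (st.future p) < 0
  normal : ∀ (x : S2) (u : E3), st.g (pt e x) (k (pt e x)) (push e x u) = 0
  normal' : ∀ (x : S2) (u : E3), st.g (pt e x) (kb (pt e x)) (push e x u) = 0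

/-- Components of the pullback of `∇_a X_b` to the surface. -/
def gradPull (st : Spacetime M) (e : S2 → M) (X : VField M) (y : E3) (i j : Fin 3) : ℝ :=
  st.g (pt e y) (st.nabla X (pt e y) (push e y (e3 i))) (push e y (e3 j))

/-- The expansion `Θ_(X) = q^{ab} ∇_a X_b`. -/
def expansion (st : Spacetime M) (e : S2 → M) (X : VField M) (y : E3) : ℝ :=
  ∑ i, ∑ j, qInv st e y i j * gradPull st e X y i j

/-- Components of the shear `σ_{ab} = (q_a^c q_b^d - ½ q_{ab} q^{cd}) ∇_{(c} X_{d)}`. -/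
def shear (st : Spacetime M) (e : S2 → M) (X : VField M) (y : E3) (i j : Fin 3) : ℝ :=
  (gradPull st e X y i j + gradPull st e X y j i) / 2
    - (1 / 2) * qMetric st e y i j * expansion st e X y

/-- `𝓔 = σ_{ab} σ^{ab} + R_{ab} k^a k^b`. -/
def energyE (st : Spacetime M) (e : S2 → M) (k : VField M) (y : E3) : ℝ :=
  (∑ i, ∑ j, ∑ a, ∑ b, qInv st e y i a * qInv st e y j b * shear st e k y i j * shear st e k y a b)
    + st.ricci (pt e y) (k (pt e y)) (k (pt e y))

/-- `e` presents a marginally trapped surface of spherical topology, with null normals `k`, `kb`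
of which `k` is the one with vanishing expansion. -/
structure IsMTS (st : Spacetime M) (e : S2 → M) (k kb : VField M) : Prop where
  sphere : IsSpacelikeSphere st e
  normals : IsNullNormalPair st e k kb
  marginal : ∀ x : S2, expansion st e k x = 0

/-! ### Dynamical horizon segments -/

/-- A chart of `M` that is flat for the subset `H` and its partition into leaves: `H` is the
coordinate slice `x₃ = 0`, or the half slice `x₃ = 0, x₂ ≥ 0` (boundary leaf), and every leaf is
a countable union of slices `x₃ = 0, x₂ = c`. -/
structure IsFoliatedChart (H : Set M) (leaves : Set (Set M))
    (χ : OpenPartialHomeomorph M E4) : Prop where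
  mem_atlas : χ ∈ IsManifold.maximalAtlas (𝓡 4) ∞ M
  slice : (H ∩ χ.source = {q ∈ χ.source | χ q 3 = 0}) ∨
    (H ∩ χ.source = {q ∈ χ.source | χ q 3 = 0 ∧ 0 ≤ χ q 2})
  leaf : ∀ L ∈ leaves, ∃ C : Set ℝ, C.Countable ∧ L ∩ χ.source = {q ∈ H ∩ χ.source | χ q 2 ∈ C}

/-- The tangent space at `q` of the slice `x₃ = 0` of the chart `χ`. -/
def sliceTangent (χ : OpenPartialHomeomorph M E4) (q : M) : Set (TangentSpace (𝓡 4) q) :=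
  {v | mvfderiv (𝓡 4) (fun z => χ z 3) q v = 0}

/-- `H` is a dynamical horizon segment, foliated by the marginally trapped spheres in `leaves`. -/
structure IsDHS (st : Spacetime M) (H : Set M) (leaves : Set (Set M)) : Prop where
  connected : IsConnected H
  cover : ⋃₀ leaves = H
  disjoint : leaves.PairwiseDisjoint id
  /-- `H` is a 3-dimensional submanifold and `leaves` a smooth foliation of it -/
  foliated : ∀ p ∈ H, ∃ χ : OpenPartialHomeomorph M E4, p ∈ χ.source ∧ IsFoliatedChart H leaves χ
  /-- the metric induced on `H` is nowhere degenerate -/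
  nowhere_null : ∀ χ, IsFoliatedChart H leaves χ → ∀ q ∈ H ∩ χ.source, ∀ v ∈ sliceTangent χ q,
    (∀ w ∈ sliceTangent χ q, st.g q v w = 0) → v = 0
  /-- the leaves are marginally trapped spheres, the other expansion is nowhere zero, and `𝓔` does
  not vanish identically on any of them -/
  leaf_mts : ∀ L ∈ leaves, ∃ (e : S2 → M) (k kb : VField M), range e = L ∧ IsMTS st e k kb ∧
    (∀ x : S2, expansion st e kb x ≠ 0) ∧ ∃ x : S2, energyE st e k x ≠ 0

/-- `φ` generates rotations of every leaf: it is tangential to every leaf, not identically zero on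
any of them, and its nontrivial orbits on `H` are circles with (least) period `2π`. -/
structure IsRotational (H : Set M) (leaves : Set (Set M)) (φ : VField M) : Prop where
  tangential : ∀ e : S2 → M, IsSmoothEmbedding (𝓡 2) (𝓡 4) ∞ e → range e ∈ leaves →
    ∀ x : S2, ∃ u : E3, push e x u = φ (pt e x)
  nontrivial : ∀ L ∈ leaves, ∃ p ∈ L, φ p ≠ 0
  periodic : ∀ p ∈ H, φ p ≠ 0 → ∃ γ : ℝ → M, γ 0 = p ∧ IsMIntegralCurve (I := 𝓡 4) γ φ ∧
    ∀ s t : ℝ, γ s = γ t ↔ ∃ n : ℤ, s - t = n * (2 * Real.pi)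

/-! ### Spin multipoles -/

/-- The Legendre polynomial `P_ℓ` (Rodrigues formula). -/
def legendreP (l : ℕ) : Polynomial ℝ :=
  Polynomial.C (1 / (2 ^ l * (l.factorial : ℝ))) *
    Polynomial.derivative^[l] ((Polynomial.X ^ 2 - 1) ^ l)

/-- The axisymmetric spherical harmonic `Y_ℓ = Y_{ℓ,0}` as a function of `ζ = cos θ`. -/
def sphHarm (l : ℕ) (z : ℝ) : ℝ :=
  Real.sqrt ((2 * l + 1) / (4 * Real.pi)) * (legendreP l).eval z

/-- The oriented area 2-form of the surface, `ε_{cd} = ε_{abcd} kb^a k^b`, evaluated on two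
space-time vectors. With `k = (τ + r)/√2`, `kb = (τ - r)/√2` it is `ε_{abcd} τ^a r^b`. -/
def areaForm (st : Spacetime M) (k kb : VField M) (p : M) (u v : TangentSpace (𝓡 4) p) : ℝ :=
  st.vol p ![kb p, k p, u, v]

/-- The rotational 1-form `ω_a = - q_a^b kb_c ∇_b k^c`. -/
def rotForm (st : Spacetime M) (e : S2 → M) (k kb : VField M) (y u : E3) : ℝ :=
  - st.g (pt e y) (kb (pt e y)) (st.nabla k (pt e y) (push e y u))

/-- The exterior derivative `(dα)(u,v) = ∂_u α(v) - ∂_v α(u)` of a 1-form on `E3 ∖ {0}`. -/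
def extD (α : E3 → E3 → ℝ) (y u v : E3) : ℝ :=
  fderiv ℝ (fun z => α z v) y u - fderiv ℝ (fun z => α z u) y v

/-- The coefficient of a 2-form that annihilates the radial direction, relative to the area form
of the unit round sphere: `β(u,v) = density β y * ⟨y, u × v⟩` for `|y| = 1`. -/
def density (β : E3 → E3 → ℝ) (y : E3) : ℝ :=
  y 0 * β (e3 1) (e3 2) + y 1 * β (e3 2) (e3 0) + y 2 * β (e3 0) (e3 1)

/-- The scalar `ε^{ab} D_a ω_b`, i.e. the ratio of the 2-forms `dω` and `ε`. -/
def curlRot (st : Spacetime M) (e : S2 → M) (k kb : VField M) (y : E3) : ℝ :=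
  density (extD (rotForm st e k kb) y) y /
    density (fun u v => areaForm st k kb (pt e y) (push e y u) (push e y v)) y

/-- The defining properties of the invariant coordinate `ζ`: `D_a ζ = R⁻² ε_{ba} φ^b` and
`∮_S ζ d²V = 0`. They determine `ζ` uniquely. -/
structure IsZeta (st : Spacetime M) (e : S2 → M) (k kb φ : VField M) (ζ : S2 → ℝ) : Prop where
  smooth : ContMDiff (𝓡 2) 𝓘(ℝ, ℝ) ∞ ζ
  deriv : ∀ (x : S2) (u : E3), fderiv ℝ (fun y => ζ (radial y)) x u =
    (areaRadius st e ^ 2)⁻¹ * areaForm st k kb (pt e x) (φ (pt e x)) (push e x u)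
  mean_zero : surfInt st e (fun y => ζ (radial y)) = 0

open Classical in
/-- The invariant coordinate `ζ` of the axisymmetric surface. -/
def zeta (st : Spacetime M) (e : S2 → M) (k kb φ : VField M) : S2 → ℝ :=
  if h : ∃ ζ, IsZeta st e k kb φ ζ then h.choose else 0

/-- The function `Y_ℓ(ζ)` on the surface, radially extended. -/
def harmonicOn (st : Spacetime M) (e : S2 → M) (k kb φ : VField M) (l : ℕ) (y : E3) : ℝ :=
  sphHarm l (zeta st e k kb φ (radial y))

/-- The spin multipole `S_ℓ[S] = ¼ ∮_S [2 ε^{ab} D_a ω_b] Y_ℓ(ζ) d²V`. -/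
def spinMultipole (st : Spacetime M) (e : S2 → M) (k kb φ : VField M) (l : ℕ) : ℝ :=
  (1 / 4) * surfInt st e (fun y => 2 * curlRot st e k kb y * harmonicOn st e k kb φ l y)

/-- `𝔱^a ∂_a f = q^{ab} 𝔱_a D_b f` for a function `f` on the surface. (As `f` lives on the surface
only, it is the projection of `𝔱^a` tangential to the surface that acts.) -/
def twistDeriv (st : Spacetime M) (e : S2 → M) (φ : VField M) (f : E3 → ℝ) (y : E3) : ℝ :=
  ∑ i, ∑ j, qInv st e y i j * st.twist φ (pt e y) (push e y (e3 i)) * fderiv ℝ f y (e3 j)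

/-- The integrand `(1/𝔫) 𝔱^a ∂_a Y_ℓ(ζ)`. -/
def twistIntegrand (st : Spacetime M) (e : S2 → M) (k kb φ : VField M) (l : ℕ) (y : E3) : ℝ :=
  1 / st.normSq φ (pt e y) * twistDeriv st e φ (harmonicOn st e k kb φ l) y

end Surface

end

/-! Write ω for the rotational 1-form, ε for the area 2-form, Y for Y_ℓ(ζ), and F = k^a kb^b ∇_a
φ_b. The proof combines an integration by parts, a pointwise computation of the twist, and a
potential supplied by the horizon.

Integration by parts. For every smooth μ on S, ∮ Y dω = -∮ dY ∧ (ω - dμ). Subtracting dμ is the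
freedom of rescaling k, under which ω changes by a gradient. Since dY = c ε(φ, ·), dY annihilates φ,
so dY ∧ α depends on a 1-form α only through α(φ). It remains to find μ for which (ω - dμ)(φ) is the
quantity measured by the twist.

Twist. Where φ ≠ 0, take an oriented null frame k, kb, a, b with a, b tangent to S and φ = r a.
Killing's equation gives 𝔱(b) = -2 r F, while 𝔫 = r², dY(a) = 0 and dY(b) = c r. Hence 𝔫⁻¹ 𝔱·dY = -2
c F, with no singular factor left, and as a 2-form this is -2 dY ∧ α for any α with α(φ) = -F
(`inv_normSq_mul_twistDeriv`, `twistDeriv_mul_density`).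

Potential. Let h be a local defining function of H, A = dh(k) and B = dh(kb). Neither vanishes
because H is nowhere null. As φ is tangent to H, φ(h) = 0 on H, so d(φ(h)) = ρ dh on vectors at
points of H. Vanishing torsion, the normalization of k, kb and Killing's equation then give φ(A) = A
(ρ + ω(φ) + F) and φ(B) = B (ρ - ω(φ) - F). So μ = ½ log |A/B| satisfies (ω - dμ)(φ) = -F. The ratio
A/B does not depend on h, so μ is defined on the whole leaf (`exists_potential_rotForm`).

Together these prove the formula. Integrability comes along, since up to sign the integrand times
the area density is the continuous density of -2 dY ∧ (ω - dμ), also at the zeros of φ. If φ is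
hypersurface orthogonal then F = 0 wherever φ ≠ 0, and the integrand vanishes.

Stokes' theorem on the sphere (`integral_density_extD_eq_zero`) is reduced to a compactly supported
divergence on Euclidean space, using forms extended homogeneously along rays. -/

set_option linter.unusedSectionVars false

/-! ### Components of fields in a fixed chart -/

section

variable {M : Type*} [TopologicalSpace M] [ChartedSpace E4 M] [IsManifold (𝓡 4) ∞ M]

/-- The components of a tangent vector at `q` in the preferred chart at `p`. -/
noncomputable def chartComp (p q : M) : TangentSpace (𝓡 4) q →L[ℝ] E4 :=
  (trivializationAt E4 (fun q : M => TangentSpace (𝓡 4) q) p).continuousLinearMapAt ℝ q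

/-- The tangent vector at `q` with given components in the preferred chart at `p`. -/
noncomputable def chartVec (p q : M) : E4 →L[ℝ] TangentSpace (𝓡 4) q :=
  (trivializationAt E4 (fun q : M => TangentSpace (𝓡 4) q) p).symmL ℝ q

theorem chartComp_apply {p q : M} (hq : q ∈ (chartAt E4 p).source) (v : TangentSpace (𝓡 4) q) :
    chartComp p q v = (trivializationAt E4 (fun q : M => TangentSpace (𝓡 4) q) p ⟨q, v⟩).2 := by
  simp [chartComp, Trivialization.continuousLinearMapAt_apply, Trivialization.linearMapAt_apply, hq]

theorem chartVec_apply {p q : M} (hq : q ∈ (chartAt E4 p).source) (a : E4) :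
    chartVec p q a = (trivializationAt E4 (fun q : M => TangentSpace (𝓡 4) q) p).symm q a := by
  rw [chartVec, Trivialization.symmL_apply _ (by simpa using hq)]

theorem chartComp_chartVec {p q : M} (hq : q ∈ (chartAt E4 p).source) (a : E4) :
    chartComp p q (chartVec p q a) = a :=
  Trivialization.continuousLinearMapAt_symmL _ (by simpa using hq) a

theorem chartVec_chartComp {p q : M} (hq : q ∈ (chartAt E4 p).source) (v : TangentSpace (𝓡 4) q) :
    chartVec p q (chartComp p q v) = v :=
  Trivialization.symmL_continuousLinearMapAt _ (by simpa using hq) v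

theorem chartComp_eq_mfderiv {p q : M} (hq : q ∈ (chartAt E4 p).source) (v : TangentSpace (𝓡 4) q) :
    chartComp p q v = mvfderiv (𝓡 4) (extChartAt (𝓡 4) p) q v := by
  rw [chartComp, TangentBundle.continuousLinearMapAt_trivializationAt hq]; rfl

theorem chartComp_self (p : M) (v : TangentSpace (𝓡 4) p) : chartComp p p v = v := by
  rw [chartComp_eq_mfderiv (mem_chart_source E4 p), mvfderiv, mfderiv_extChartAt_self]; rfl

theorem chartVec_self (p : M) (a : E4) : chartVec p p a = a := by
  rw [← chartComp_self p (chartVec p p a), chartComp_chartVec (mem_chart_source E4 p)]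

/-- The chart stays the one at `p` while `q` moves in its domain. This is what allows a derivative,
viewed as a function of `q`, to be differentiated again. -/
theorem mvfderiv_eq_fderiv_comp_symm {F : Type*} [NormedAddCommGroup F] [NormedSpace ℝ F]
    {f : M → F} {p q : M} (hq : q ∈ (chartAt E4 p).source)
    (hf : MDifferentiableAt (𝓡 4) 𝓘(ℝ, F) f q) (v : TangentSpace (𝓡 4) q) :
    mvfderiv (𝓡 4) f q v = fderiv ℝ (f ∘ (extChartAt (𝓡 4) p).symm) (extChartAt (𝓡 4) p q)
      (chartComp p q v) := by
  have hq' : q ∈ (extChartAt (𝓡 4) p).source := by simpa using hq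
  have hi := (extChartAt (𝓡 4) p).left_inv hq'
  have hs : MDifferentiableAt 𝓘(ℝ, E4) (𝓡 4) (extChartAt (𝓡 4) p).symm (extChartAt (𝓡 4) p q) := by
    have := mdifferentiableWithinAt_extChartAt_symm (I := 𝓡 4) (x := p)
      ((extChartAt (𝓡 4) p).map_source hq')
    rwa [ModelWithCorners.range_eq_univ, mdifferentiableWithinAt_univ] at this
  have hc : MDifferentiableAt 𝓘(ℝ, E4) 𝓘(ℝ, F) (f ∘ (extChartAt (𝓡 4) p).symm)
      (extChartAt (𝓡 4) p q) :=
    MDifferentiableAt.comp _ (by rwa [hi]) hs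
  have he : MDifferentiableAt (𝓡 4) 𝓘(ℝ, E4) (extChartAt (𝓡 4) p) q :=
    mdifferentiableAt_extChartAt hq
  have key := mfderiv_comp_apply q hc he v
  have hev : (f ∘ (extChartAt (𝓡 4) p).symm) ∘ (extChartAt (𝓡 4) p) =ᶠ[𝓝 q] f := by
    filter_upwards [extChartAt_source_mem_nhds' hq'] with z hz
    exact congrArg f ((extChartAt (𝓡 4) p).left_inv hz)
  rw [hev.mfderiv_eq, mfderiv_eq_fderiv] at key
  rw [chartComp_eq_mfderiv hq]
  exact key

theorem SmoothFieldOn.contMDiffAt {X : VField M} {W : Set M} (hX : SmoothFieldOn X W) (hW : IsOpen W)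
    {q : M} (hq : q ∈ W) :
    ContMDiffAt (𝓡 4) (𝓡 4).tangent ∞ (fun p => (⟨p, X p⟩ : TangentBundle (𝓡 4) M)) q :=
  ContMDiffOn.contMDiffAt hX (hW.mem_nhds hq)

theorem contMDiffAt_chartComp {X : VField M} {p q : M} (hq : q ∈ (chartAt E4 p).source)
    (hX : ContMDiffAt (𝓡 4) (𝓡 4).tangent ∞ (fun p => (⟨p, X p⟩ : TangentBundle (𝓡 4) M)) q) :
    ContMDiffAt (𝓡 4) 𝓘(ℝ, E4) ∞ (fun z => chartComp p z (X z)) q := by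
  have h := (Trivialization.contMDiffAt_section_iff
    (trivializationAt E4 (fun q : M => TangentSpace (𝓡 4) q) p) (by simpa using hq)).1 hX
  refine h.congr_of_eventuallyEq ?_
  filter_upwards [(chartAt E4 p).open_source.mem_nhds hq] with z hz using chartComp_apply hz _

theorem contMDiffAt_chartVec {p q : M} (hq : q ∈ (chartAt E4 p).source) (a : E4) :
    ContMDiffAt (𝓡 4) (𝓡 4).tangent ∞
      (fun z => (⟨z, chartVec p z a⟩ : TangentBundle (𝓡 4) M)) q := by
  refine (Trivialization.contMDiffAt_section_iff
    (trivializationAt E4 (fun q : M => TangentSpace (𝓡 4) q) p) (by simpa using hq)).2 ?_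
  refine (contMDiffAt_const (c := a)).congr_of_eventuallyEq ?_
  filter_upwards [(chartAt E4 p).open_source.mem_nhds hq] with z hz
  rw [← chartComp_apply hz, chartComp_chartVec hz]

theorem smoothFieldOn_chartVec (p : M) (a : E4) :
    SmoothFieldOn (fun z => chartVec p z a) (chartAt E4 p).source :=
  fun _ hq => (contMDiffAt_chartVec hq a).contMDiffWithinAt

theorem Spacetime.contMDiffAt_g (st : Spacetime M) {E H N : Type*} [NormedAddCommGroup E]
    [NormedSpace ℝ E] [TopologicalSpace H] {I : ModelWithCorners ℝ E H} [TopologicalSpace N]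
    [ChartedSpace H N] {b : N → M} {v w : ∀ n, TangentSpace (𝓡 4) (b n)} {n : N}
    (hv : ContMDiffAt I (𝓡 4).tangent ∞ (fun m => (⟨b m, v m⟩ : TangentBundle (𝓡 4) M)) n)
    (hw : ContMDiffAt I (𝓡 4).tangent ∞ (fun m => (⟨b m, w m⟩ : TangentBundle (𝓡 4) M)) n) :
    ContMDiffAt I 𝓘(ℝ, ℝ) ∞ (fun m => st.g (b m) (v m) (w m)) n := by
  have hb : ContMDiffAt I (𝓡 4) ∞ b n := by
    have := (contMDiffAt_proj (TangentSpace (𝓡 4))).comp n hv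
    exact this
  have hg : ContMDiffAt I ((𝓡 4).prod 𝓘(ℝ, E4 →L[ℝ] E4 →L[ℝ] ℝ)) ∞
    (fun m => TotalSpace.mk' (E4 →L[ℝ] E4 →L[ℝ] ℝ)
    (E := fun p => TangentSpace (𝓡 4) p →L[ℝ] TangentSpace (𝓡 4) p →L[ℝ] ℝ) (b m) (st.g (b m))) n :=
    (st.g_smooth (b n)).comp n hb
  have := ContMDiffAt.clm_bundle_apply₂ (E₃ := Bundle.Trivial M ℝ) (F₃ := ℝ) hg hv hw
  exact (Bundle.contMDiffAt_totalSpace.1 this).2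

end

/-! ### The Levi-Civita derivative: metric compatibility and vanishing torsion -/

section

variable {M : Type*} [TopologicalSpace M] [ChartedSpace E4 M] [IsManifold (𝓡 4) ∞ M]
/-- The components of the metric in the preferred chart at `p`, as a function on the chart. -/
noncomputable def Spacetime.gChart (st : Spacetime M) (p : M) (y : E4) : E4 →L[ℝ] E4 →L[ℝ] ℝ :=
  let q := (extChartAt (𝓡 4) p).symm y
  (ContinuousLinearMap.precomp ℝ (chartVec p q)).comp ((st.g q).comp (chartVec p q))

theorem Spacetime.contDiffOn_gChart (st : Spacetime M) (p : M) :
    ContDiffOn ℝ ∞ (st.gChart p) (extChartAt (𝓡 4) p).target := by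
  rw [contDiffOn_clm_apply]
  intro a
  rw [contDiffOn_clm_apply]
  intro b
  have h : ContMDiffOn (𝓡 4) 𝓘(ℝ, ℝ) ∞ (fun q => st.g q (chartVec p q a) (chartVec p q b))
    (chartAt E4 p).source := fun q hq =>
    (st.contMDiffAt_g (contMDiffAt_chartVec hq a) (contMDiffAt_chartVec hq b)).contMDiffWithinAt
  have := h.comp (contMDiffOn_extChartAt_symm (n := ∞) p)
    (fun y hy => by simpa using (extChartAt (𝓡 4) p).map_target hy)
  exact this.contDiffOn

/-- The derivatives of the components of the metric at `p`, in the preferred chart at `p`. -/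
noncomputable def Spacetime.gDeriv (st : Spacetime M) (p : M) (a b c : E4) : ℝ :=
  fderiv ℝ (st.gChart p) (extChartAt (𝓡 4) p p) a b c

theorem Spacetime.gDeriv_add_left (st : Spacetime M) (p : M) (a a' b c : E4) :
    st.gDeriv p (a + a') b c = st.gDeriv p a b c + st.gDeriv p a' b c := by
  rw [gDeriv, ContinuousLinearMap.map_add]; rfl

theorem Spacetime.gDeriv_smul_left (st : Spacetime M) (p : M) (r : ℝ) (a b c : E4) :
    st.gDeriv p (r • a) b c = r * st.gDeriv p a b c := by
  rw [gDeriv, ContinuousLinearMap.map_smul]; rfl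

theorem Spacetime.gDeriv_add_middle (st : Spacetime M) (p : M) (a b b' c : E4) :
    st.gDeriv p a (b + b') c = st.gDeriv p a b c + st.gDeriv p a b' c := by
  rw [gDeriv, ContinuousLinearMap.map_add]; rfl

theorem Spacetime.gDeriv_smul_middle (st : Spacetime M) (p : M) (r : ℝ) (a b c : E4) :
    st.gDeriv p a (r • b) c = r * st.gDeriv p a b c := by
  rw [gDeriv, ContinuousLinearMap.map_smul]; rfl

theorem Spacetime.gDeriv_add_right (st : Spacetime M) (p : M) (a b c c' : E4) :
    st.gDeriv p a b (c + c') = st.gDeriv p a b c + st.gDeriv p a b c' := by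
  rw [gDeriv, ContinuousLinearMap.map_add]; rfl

theorem Spacetime.gDeriv_smul_right (st : Spacetime M) (p : M) (r : ℝ) (a b c : E4) :
    st.gDeriv p a b (r • c) = r * st.gDeriv p a b c := by
  rw [gDeriv, ContinuousLinearMap.map_smul]; rfl

theorem Spacetime.gChart_apply (st : Spacetime M) {p q : M} (hq : q ∈ (chartAt E4 p).source)
    (a b : E4) : st.gChart p (extChartAt (𝓡 4) p q) a b = st.g q (chartVec p q a) (chartVec p q b) := by
  have hi : (extChartAt (𝓡 4) p).symm (extChartAt (𝓡 4) p q) = q :=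
    (extChartAt (𝓡 4) p).left_inv (by simpa using hq)
  change st.g ((extChartAt (𝓡 4) p).symm (extChartAt (𝓡 4) p q)) (chartVec p _ a) (chartVec p _ b) = _
  rw [hi]

/-- The product rule in the chart at `p` for three factors: the metric components and the components
of the two fields. The `gDeriv` term is the one that the Christoffel symbols later absorb. -/
theorem Spacetime.mvfderiv_g (st : Spacetime M) {p : M} {X Y : VField M}
    (hX : ContMDiffAt (𝓡 4) (𝓡 4).tangent ∞ (fun p => (⟨p, X p⟩ : TangentBundle (𝓡 4) M)) p)
    (hY : ContMDiffAt (𝓡 4) (𝓡 4).tangent ∞ (fun p => (⟨p, Y p⟩ : TangentBundle (𝓡 4) M)) p)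
    (v : TangentSpace (𝓡 4) p) :
    mvfderiv (𝓡 4) (fun q => st.g q (X q) (Y q)) p v =
      st.gDeriv p (chartComp p p v) (chartComp p p (X p))
        (chartComp p p (Y p))
       + st.g p (chartVec p p (mvfderiv (𝓡 4) (fun q => chartComp p q (X q)) p v)) (Y p)
       + st.g p (X p) (chartVec p p (mvfderiv (𝓡 4) (fun q => chartComp p q (Y q)) p v)) := by
  set φ := extChartAt (𝓡 4) p
  have hp : p ∈ (chartAt E4 p).source := mem_chart_source E4 p
  have hpφ : p ∈ φ.source := mem_extChartAt_source p
  have hi : φ.symm (φ p) = p := φ.left_inv hpφ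
  have hφt : φ.target ∈ 𝓝 (φ p) := extChartAt_target_mem_nhds p
  have hs : ContMDiffAt 𝓘(ℝ, E4) (𝓡 4) ∞ φ.symm (φ p) :=
    (contMDiffOn_extChartAt_symm p).contMDiffAt hφt
  have hXc := contMDiffAt_chartComp hp hX
  have hYc := contMDiffAt_chartComp hp hY
  have hX' : ContDiffAt ℝ ∞ ((fun q => chartComp p q (X q)) ∘ φ.symm) (φ p) :=
    (ContMDiffAt.comp (φ p) (by rwa [hi]) hs).contDiffAt
  have hY' : ContDiffAt ℝ ∞ ((fun q => chartComp p q (Y q)) ∘ φ.symm) (φ p) :=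
    (ContMDiffAt.comp (φ p) (by rwa [hi]) hs).contDiffAt
  have hG := ((st.contDiffOn_gChart p).contDiffAt hφt).differentiableAt (by simp)
  have hD := ((hG.hasFDerivAt.clm_apply (hX'.differentiableAt (by simp)).hasFDerivAt).clm_apply
    (hY'.differentiableAt (by simp)).hasFDerivAt)
  have hX0 : ((fun q => chartComp p q (X q)) ∘ φ.symm) (φ p) = chartComp p p (X p) := by
    rw [Function.comp_apply, hi]
  have hY0 : ((fun q => chartComp p q (Y q)) ∘ φ.symm) (φ p) = chartComp p p (Y p) := by
    rw [Function.comp_apply, hi]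
  rw [mvfderiv_eq_fderiv_comp_symm hp ((st.contMDiffAt_g hX hY).mdifferentiableAt (by simp)),
    mvfderiv_eq_fderiv_comp_symm hp (hXc.mdifferentiableAt (by simp)),
    mvfderiv_eq_fderiv_comp_symm hp (hYc.mdifferentiableAt (by simp))]
  have hev : (fun q => st.g q (X q) (Y q)) ∘ φ.symm =ᶠ[𝓝 (φ p)]
      fun y => st.gChart p y (((fun q => chartComp p q (X q)) ∘ φ.symm) y)
        (((fun q => chartComp p q (Y q)) ∘ φ.symm) y) := by
    filter_upwards [hφt] with y hy
    have : φ.symm y ∈ (chartAt E4 p).source := by simpa [φ] using φ.map_target hy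
    change _ = st.g _ (chartVec p (φ.symm y) (chartComp p (φ.symm y) (X _)))
      (chartVec p (φ.symm y) (chartComp p (φ.symm y) (Y _)))
    rw [chartVec_chartComp this, chartVec_chartComp this]; rfl
  rw [hev.fderiv_eq, hD.fderiv, hX0, hY0]
  simp only [add_apply, ContinuousLinearMap.comp_apply, ContinuousLinearMap.flip_apply]
  rw [st.gChart_apply hp, st.gChart_apply hp, chartVec_chartComp hp, chartVec_chartComp hp,
    Spacetime.gDeriv]
  ring

theorem contMDiffAt_extend (p : M) (a : TangentSpace (𝓡 4) p) : ContMDiffAt (𝓡 4) (𝓡 4).tangent ∞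
    (fun q => (⟨q, FiberBundle.extend E4 a q⟩ : TangentBundle (𝓡 4) M)) p :=
  FiberBundle.contMDiffAt_extend _ _ a

/-- Extended vectors have constant components in the chart, so only the metric is differentiated. -/
theorem Spacetime.mvfderiv_g_extend (st : Spacetime M) (p : M) (u v w : TangentSpace (𝓡 4) p) :
    mvfderiv (𝓡 4) (fun q => st.g q (FiberBundle.extend E4 v q) (FiberBundle.extend E4 w q)) p u =
    st.gDeriv p (chartComp p p u) (chartComp p p v)
      (chartComp p p w) := by
  have hp : p ∈ (chartAt E4 p).source := mem_chart_source E4 p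
  have hcomp (a : TangentSpace (𝓡 4) p) :
      mvfderiv (𝓡 4) (fun q => chartComp p q (FiberBundle.extend E4 a q)) p u = 0 := by
    have : (fun q => chartComp p q (FiberBundle.extend E4 a q)) =ᶠ[𝓝 p]
        fun _ => chartComp p p a := by
      filter_upwards [(chartAt E4 p).open_source.mem_nhds hp] with q hq
      rw [FiberBundle.extend, ← chartVec_apply hq, chartComp_chartVec hq, chartComp_apply hp]
    rw [mvfderiv_eq_fderiv_comp_symm hp
      ((contMDiffAt_chartComp hp (contMDiffAt_extend p a)).mdifferentiableAt (by simp))]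
    have h2 : (fun q => chartComp p q (FiberBundle.extend E4 a q)) ∘ (extChartAt (𝓡 4) p).symm
        =ᶠ[𝓝 (extChartAt (𝓡 4) p p)] fun _ => chartComp p p a := by
      have ht := continuousAt_extChartAt_symm (I := 𝓡 4) p
      rw [ContinuousAt, extChartAt_to_inv] at ht
      exact ht.eventually this
    rw [h2.fderiv_eq]
    simp
  rw [st.mvfderiv_g (contMDiffAt_extend p v) (contMDiffAt_extend p w), hcomp, hcomp]
  simp only [FiberBundle.extend_apply_self, map_zero, zero_apply, add_zero]

theorem Spacetime.christoffel_eq (st : Spacetime M) (p : M) (u v w : TangentSpace (𝓡 4) p) :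
    st.christoffel p u v w = (1 / 2) *
      (st.gDeriv p (chartComp p p u) (chartComp p p v)
        (chartComp p p w)
      + st.gDeriv p (chartComp p p v) (chartComp p p u)
        (chartComp p p w)
      - st.gDeriv p (chartComp p p w) (chartComp p p u)
        (chartComp p p v)) := by
  simp only [Spacetime.christoffel, st.mvfderiv_g_extend]

theorem Spacetime.christoffel_comm (st : Spacetime M) (p : M) (u v w : TangentSpace (𝓡 4) p) :
    st.christoffel p u v w = st.christoffel p v u w := by
  simp only [Spacetime.christoffel]
  rw [show (fun q => st.g q (FiberBundle.extend E4 u q) (FiberBundle.extend E4 v q)) =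
    fun q => st.g q (FiberBundle.extend E4 v q) (FiberBundle.extend E4 u q) from
    funext fun q => st.g_symm q _ _]
  ring

theorem Spacetime.christoffel_add_christoffel (st : Spacetime M) (p : M)
    (u v w : TangentSpace (𝓡 4) p) :
    st.christoffel p u v w + st.christoffel p u w v =
      st.gDeriv p (chartComp p p u) (chartComp p p v)
        (chartComp p p w) := by
  rw [← st.mvfderiv_g_extend]
  simp only [Spacetime.christoffel]
  rw [show (fun q => st.g q (FiberBundle.extend E4 w q) (FiberBundle.extend E4 v q)) =
    fun q => st.g q (FiberBundle.extend E4 v q) (FiberBundle.extend E4 w q) from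
    funext fun q => st.g_symm q _ _]
  ring

theorem coordVec_eq_chartVec (p : M) (i : Fin 4) :
    Spacetime.coordVec p i = chartVec p p (EuclideanSpace.single i 1) :=
  (chartVec_self p _).symm

theorem sum_smul_coordVec (p : M) (v : TangentSpace (𝓡 4) p) :
    ∑ i, (chartComp p p v) i • Spacetime.coordVec p i = v := by
  simp_rw [coordVec_eq_chartVec, ← map_smul, ← map_sum]
  conv_rhs => rw [← chartVec_chartComp (mem_chart_source E4 p) v]
  congr 1
  ext j
  simp [Pi.single_apply]

theorem Spacetime.eq_zero_of_g_eq_zero (st : Spacetime M) {p : M} {v : TangentSpace (𝓡 4) p}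
    (h : ∀ w, st.g p v w = 0) : v = 0 := by
  obtain ⟨b, hb⟩ := st.g_signature p
  rw [← b.sum_repr v] at h
  have h0 : ∀ j, b.repr v j = 0 := by
    intro j
    have hj := h (b j)
    simp only [map_sum, map_smul, sum_apply, smul_apply, smul_eq_mul, hb] at hj
    simp only [mul_ite, mul_zero, Finset.sum_ite_eq', Finset.mem_univ, if_true] at hj
    by_cases hj0 : j = 0 <;> simpa [hj0] using hj
  rw [← b.sum_repr v]
  simp [h0]

theorem Spacetime.isUnit_det_gram (st : Spacetime M) (p : M) : IsUnit
    (Matrix.of fun i j => st.g p (Spacetime.coordVec p i) (Spacetime.coordVec p j)).det := by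
  rw [isUnit_iff_ne_zero]
  intro h
  obtain ⟨c, hc, h⟩ := Matrix.exists_mulVec_eq_zero_iff.2 h
  refine hc ?_
  have hc' (i : Fin 4) : chartComp p p (chartVec p p (WithLp.toLp 2 c)) i = c i := by
    rw [chartComp_chartVec (mem_chart_source E4 p)]
  have hv : chartVec p p (WithLp.toLp 2 c) = 0 := by
    refine st.eq_zero_of_g_eq_zero fun w => ?_
    rw [st.g_symm, ← sum_smul_coordVec p w, ← sum_smul_coordVec p (chartVec p p _)]
    simp only [map_sum, map_smul, sum_apply, smul_apply, smul_eq_mul, hc']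
    simp only [Finset.mul_sum]
    rw [Finset.sum_comm]
    refine Finset.sum_eq_zero fun i _ => ?_
    have := congrFun h i
    simp only [Matrix.mulVec, dotProduct, Matrix.of_apply, Pi.zero_apply] at this
    rw [← mul_zero (chartComp p p w i), ← this, Finset.mul_sum]
    exact Finset.sum_congr rfl fun j _ => by ring
  ext i
  rw [← hc' i, hv, map_zero]; rfl

theorem Spacetime.g_sharp (st : Spacetime M) (p : M) (α : TangentSpace (𝓡 4) p →ₗ[ℝ] ℝ)
    (w : TangentSpace (𝓡 4) p) : st.g p (st.sharp p α) w = α w := by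
  conv_lhs => rw [← sum_smul_coordVec p w]
  conv_rhs => rw [← sum_smul_coordVec p w]
  simp only [map_sum, map_smul]
  refine Finset.sum_congr rfl fun l _ => ?_
  congr 1
  have h : st.gInv p * (Matrix.of fun i j => st.g p (Spacetime.coordVec p i) (Spacetime.coordVec p j)) = 1 :=
    Matrix.nonsing_inv_mul _ (st.isUnit_det_gram p)
  simp only [Spacetime.sharp, map_sum, map_smul, FunLike.coe_sum, Finset.sum_apply, smul_apply, smul_eq_mul]
  calc _ = ∑ i, (∑ j, st.gInv p i j * st.g p (Spacetime.coordVec p j) (Spacetime.coordVec p l))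
         * α (Spacetime.coordVec p i) := by
        refine Finset.sum_congr rfl fun i _ => ?_
        rw [Finset.sum_mul]
        exact Finset.sum_congr rfl fun j _ => by ring
    _ = ∑ i, (1 : Matrix (Fin 4) (Fin 4) ℝ) i l * α (Spacetime.coordVec p i) := by
        refine Finset.sum_congr rfl fun i _ => ?_
        rw [← h, Matrix.mul_apply]; rfl
    _ = _ := by simp [Matrix.one_apply]

theorem Spacetime.nabla_eq (st : Spacetime M) (X : VField M) (p : M) (v : TangentSpace (𝓡 4) p) :
    st.nabla X p v = chartVec p p (mvfderiv (𝓡 4) (fun q => chartComp p q (X q)) p v)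
      + st.sharp p (fun w => st.christoffel p v (X p) w) := by
  have h : (fun q => (trivializationAt E4 (fun q : M => TangentSpace (𝓡 4) q) p ⟨q, X q⟩).2) =ᶠ[𝓝 p]
      fun q => chartComp p q (X q) := by
    filter_upwards [(chartAt E4 p).open_source.mem_nhds (mem_chart_source E4 p)] with q hq
    exact (chartComp_apply hq _).symm
  rw [Spacetime.nabla, chartVec_apply (mem_chart_source E4 p)]
  congr 2
  exact DFunLike.congr_fun h.mfderiv_eq v

/-- The Christoffel symbols as a linear form in the last argument. -/
noncomputable def Spacetime.christoffelLin (st : Spacetime M) (p : M) (u v : TangentSpace (𝓡 4) p) :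
    TangentSpace (𝓡 4) p →ₗ[ℝ] ℝ where
  toFun w := st.christoffel p u v w
  map_add' a b := by simp only [st.christoffel_eq, map_add, gDeriv_add_left, gDeriv_add_right]; ring
  map_smul' c a := by
    simp only [st.christoffel_eq, map_smul, gDeriv_smul_left, gDeriv_smul_right,
      smul_eq_mul, RingHom.id_apply]; ring

/-- Pairing with the metric undoes the index raising in `nabla`. Identities for `nabla` are checked
in this form and transferred back by nondegeneracy (`eq_of_g_eq`). -/
theorem Spacetime.g_nabla (st : Spacetime M) (X : VField M) (p : M) (v w : TangentSpace (𝓡 4) p) :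
    st.g p (st.nabla X p v) w =
      st.g p (chartVec p p (mvfderiv (𝓡 4) (fun q => chartComp p q (X q)) p v)) w
        + st.christoffel p v (X p) w := by
  rw [st.nabla_eq, map_add, add_apply]
  congr 1
  exact st.g_sharp p (st.christoffelLin p v (X p)) w

theorem Spacetime.eq_of_g_eq (st : Spacetime M) {p : M} {v w : TangentSpace (𝓡 4) p}
    (h : ∀ z, st.g p v z = st.g p w z) : v = w := by
  refine sub_eq_zero.1 (st.eq_zero_of_g_eq_zero fun z => ?_)
  rw [map_sub, sub_apply, h z, sub_self]

theorem Spacetime.nabla_add (st : Spacetime M) (X : VField M) (p : M) (v w : TangentSpace (𝓡 4) p) :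
    st.nabla X p (v + w) = st.nabla X p v + st.nabla X p w := by
  refine st.eq_of_g_eq fun z => ?_
  simp only [map_add, add_apply, st.g_nabla, st.christoffel_eq, gDeriv_add_left,
    gDeriv_add_middle]
  ring

theorem Spacetime.nabla_smul (st : Spacetime M) (X : VField M) (p : M) (c : ℝ)
    (v : TangentSpace (𝓡 4) p) : st.nabla X p (c • v) = c • st.nabla X p v := by
  refine st.eq_of_g_eq fun z => ?_
  simp only [map_smul, smul_apply, st.g_nabla, st.christoffel_eq, smul_eq_mul,
    gDeriv_smul_left, gDeriv_smul_middle]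
  ring

/-- Metric compatibility of the Levi-Civita derivative. -/
theorem Spacetime.mvfderiv_g_eq_nabla (st : Spacetime M) {p : M} {X Y : VField M}
    (hX : ContMDiffAt (𝓡 4) (𝓡 4).tangent ∞ (fun p => (⟨p, X p⟩ : TangentBundle (𝓡 4) M)) p)
    (hY : ContMDiffAt (𝓡 4) (𝓡 4).tangent ∞ (fun p => (⟨p, Y p⟩ : TangentBundle (𝓡 4) M)) p)
    (v : TangentSpace (𝓡 4) p) :
    mvfderiv (𝓡 4) (fun q => st.g q (X q) (Y q)) p v =
      st.g p (st.nabla X p v) (Y p) + st.g p (X p) (st.nabla Y p v) := by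
  rw [st.mvfderiv_g hX hY, st.g_symm p (X p) (st.nabla Y p v), st.g_nabla, st.g_nabla,
    st.g_symm p (X p), ← st.christoffel_add_christoffel]
  ring

theorem Spacetime.nabla_sub_nabla (st : Spacetime M) {p : M} (X Y : VField M) :
    st.nabla Y p (X p) - st.nabla X p (Y p) =
      chartVec p p (mvfderiv (𝓡 4) (fun q => chartComp p q (Y q)) p (X p)
        - mvfderiv (𝓡 4) (fun q => chartComp p q (X q)) p (Y p)) := by
  refine st.eq_of_g_eq fun z => ?_
  rw [map_sub, sub_apply, st.g_nabla, st.g_nabla, map_sub, map_sub, sub_apply,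
    st.christoffel_comm p (X p) (Y p)]
  ring

/-- The Levi-Civita derivative is torsion free. -/
theorem Spacetime.mvfderiv_nabla_sub_nabla (st : Spacetime M) {p : M} {X Y : VField M} {h : M → ℝ}
    {W : Set M} (hW : IsOpen W) (hp : p ∈ W) (hh : ContMDiffOn (𝓡 4) 𝓘(ℝ, ℝ) ∞ h W)
    (hX : ContMDiffAt (𝓡 4) (𝓡 4).tangent ∞ (fun p => (⟨p, X p⟩ : TangentBundle (𝓡 4) M)) p)
    (hY : ContMDiffAt (𝓡 4) (𝓡 4).tangent ∞ (fun p => (⟨p, Y p⟩ : TangentBundle (𝓡 4) M)) p) :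
    mvfderiv (𝓡 4) h p (st.nabla Y p (X p) - st.nabla X p (Y p)) =
      mvfderiv (𝓡 4) (fun q => mvfderiv (𝓡 4) h q (Y q)) p (X p)
      - mvfderiv (𝓡 4) (fun q => mvfderiv (𝓡 4) h q (X q)) p (Y p) := by
  set φ := extChartAt (𝓡 4) p
  have hps : p ∈ (chartAt E4 p).source := mem_chart_source E4 p
  have hpφ : p ∈ φ.source := mem_extChartAt_source p
  have hi : φ.symm (φ p) = p := φ.left_inv hpφ
  have hφt : φ.target ∈ 𝓝 (φ p) := extChartAt_target_mem_nhds p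
  have hs : ContMDiffAt 𝓘(ℝ, E4) (𝓡 4) ∞ φ.symm (φ p) :=
    (contMDiffOn_extChartAt_symm p).contMDiffAt hφt
  have hhp : ContMDiffAt (𝓡 4) 𝓘(ℝ, ℝ) ∞ h p := hh.contMDiffAt (hW.mem_nhds hp)
  have hh' : ContDiffAt ℝ ∞ (h ∘ φ.symm) (φ p) :=
    (ContMDiffAt.comp (φ p) (by rwa [hi]) hs).contDiffAt
  have hdh : DifferentiableAt ℝ (fderiv ℝ (h ∘ φ.symm)) (φ p) :=
    (hh'.fderiv_right (m := 1) (by norm_cast)).differentiableAt (by simp)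
  -- The symmetric Hessian of `h` in the chart cancels between the two iterated derivatives; what
  -- remains is `dh` applied to the commutator of components.
  have hsymm := hh'.isSymmSndFDerivAt (by simpa using ENat.LEInfty.out)
  have key : ∀ Z : VField M, ContMDiffAt (𝓡 4) (𝓡 4).tangent ∞
      (fun p => (⟨p, Z p⟩ : TangentBundle (𝓡 4) M)) p → ∀ v : TangentSpace (𝓡 4) p,
      mvfderiv (𝓡 4) (fun q => mvfderiv (𝓡 4) h q (Z q)) p v =
        fderiv ℝ (fderiv ℝ (h ∘ φ.symm)) (φ p) (chartComp p p v) (chartComp p p (Z p))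
        + fderiv ℝ (h ∘ φ.symm) (φ p) (mvfderiv (𝓡 4) (fun q => chartComp p q (Z q)) p v) := by
    intro Z hZ v
    have hZc := contMDiffAt_chartComp hps hZ
    have hZ' : ContDiffAt ℝ ∞ ((fun q => chartComp p q (Z q)) ∘ φ.symm) (φ p) :=
      (ContMDiffAt.comp (φ p) (by rwa [hi]) hs).contDiffAt
    have hD := hdh.hasFDerivAt.clm_apply (hZ'.differentiableAt (by simp)).hasFDerivAt
    have hev : (fun q => mvfderiv (𝓡 4) h q (Z q)) =ᶠ[𝓝 p] fun q =>
        fderiv ℝ (h ∘ φ.symm) (φ q) (chartComp p q (Z q)) := by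
      filter_upwards [(chartAt E4 p).open_source.mem_nhds hps, hW.mem_nhds hp] with q hq hqW
      exact mvfderiv_eq_fderiv_comp_symm hq
        ((hh.contMDiffAt (hW.mem_nhds hqW)).mdifferentiableAt (by simp)) _
    have hev' : (fun q => mvfderiv (𝓡 4) h q (Z q)) ∘ φ.symm =ᶠ[𝓝 (φ p)] fun y =>
        fderiv ℝ (h ∘ φ.symm) y (((fun q => chartComp p q (Z q)) ∘ φ.symm) y) := by
      have ht := continuousAt_extChartAt_symm (I := 𝓡 4) p
      rw [ContinuousAt, extChartAt_to_inv] at ht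
      filter_upwards [ht.eventually hev, hφt] with y hy hyt
      rw [Function.comp_apply, hy, φ.right_inv hyt]; rfl
    have hdiff : MDifferentiableAt (𝓡 4) 𝓘(ℝ, ℝ) (fun q => mvfderiv (𝓡 4) h q (Z q)) p := by
      refine MDifferentiableAt.congr_of_eventuallyEq ?_ hev
      have h1 : MDifferentiableAt (𝓡 4) 𝓘(ℝ, E4 →L[ℝ] ℝ)
        (fun q => fderiv ℝ (h ∘ φ.symm) (φ q)) p :=
        MDifferentiableAt.comp p hdh.mdifferentiableAt (mdifferentiableAt_extChartAt hps)
      exact h1.clm_apply (hZc.mdifferentiableAt (by simp))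
    rw [mvfderiv_eq_fderiv_comp_symm hps hdiff, hev'.fderiv_eq, hD.fderiv,
      mvfderiv_eq_fderiv_comp_symm hps (hZc.mdifferentiableAt (by simp))]
    simp only [add_apply, ContinuousLinearMap.comp_apply, ContinuousLinearMap.flip_apply,
      Function.comp_apply]
    rw [hi, add_comm]
  rw [key Y hY, key X hX, st.nabla_sub_nabla,
    mvfderiv_eq_fderiv_comp_symm hps (hhp.mdifferentiableAt (by simp)), chartComp_chartVec hps, map_sub]
  have := hsymm (chartComp p p (X p)) (chartComp p p (Y p))
  linarith

end

/-! ### Smoothness of the Levi-Civita derivative -/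

section

variable {M : Type*} [TopologicalSpace M] [ChartedSpace E4 M] [IsManifold (𝓡 4) ∞ M]

theorem contMDiffOn_mvfderiv_apply {f : M → ℝ} {X : VField M} {W : Set M} (hW : IsOpen W)
    (hf : ContMDiffOn (𝓡 4) 𝓘(ℝ, ℝ) ∞ f W) (hX : SmoothFieldOn X W) :
    ContMDiffOn (𝓡 4) 𝓘(ℝ, ℝ) ∞ (fun q => mvfderiv (𝓡 4) f q (X q)) W := by
  intro p hp
  refine ContMDiffAt.contMDiffWithinAt ?_
  set φ := extChartAt (𝓡 4) p
  have hps : p ∈ (chartAt E4 p).source := mem_chart_source E4 p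
  have hi : φ.symm (φ p) = p := φ.left_inv (mem_extChartAt_source p)
  have hφt : φ.target ∈ 𝓝 (φ p) := extChartAt_target_mem_nhds p
  have hs : ContMDiffAt 𝓘(ℝ, E4) (𝓡 4) ∞ φ.symm (φ p) :=
    (contMDiffOn_extChartAt_symm p).contMDiffAt hφt
  have hfp : ContMDiffAt (𝓡 4) 𝓘(ℝ, ℝ) ∞ f p := hf.contMDiffAt (hW.mem_nhds hp)
  have hf' : ContDiffAt ℝ ∞ (f ∘ φ.symm) (φ p) :=
    (ContMDiffAt.comp (φ p) (by rwa [hi]) hs).contDiffAt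
  have hdf : ContDiffAt ℝ ∞ (fderiv ℝ (f ∘ φ.symm)) (φ p) :=
    hf'.fderiv_right (m := ∞) (by simp)
  have h1 : ContMDiffAt (𝓡 4) 𝓘(ℝ, E4 →L[ℝ] ℝ) ∞ (fun q => fderiv ℝ (f ∘ φ.symm) (φ q)) p :=
    hdf.contMDiffAt.comp p contMDiffAt_extChartAt
  have h2 := h1.clm_apply (contMDiffAt_chartComp hps (hX.contMDiffAt hW hp))
  refine h2.congr_of_eventuallyEq ?_
  filter_upwards [(chartAt E4 p).open_source.mem_nhds hps, hW.mem_nhds hp] with q hq hqW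
  exact mvfderiv_eq_fderiv_comp_symm hq
    ((hf.contMDiffAt (hW.mem_nhds hqW)).mdifferentiableAt (by simp)) _

/-- The `i`-th coordinate of the preferred chart at `p`. -/
noncomputable def chartCoord (p : M) (i : Fin 4) (q : M) : ℝ := extChartAt (𝓡 4) p q i

theorem contMDiffOn_chartCoord (p : M) (i : Fin 4) :
    ContMDiffOn (𝓡 4) 𝓘(ℝ, ℝ) ∞ (chartCoord p i) (chartAt E4 p).source := by
  have h : ContMDiffOn (𝓡 4) 𝓘(ℝ, E4) ∞ (extChartAt (𝓡 4) p) (chartAt E4 p).source :=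
    contMDiffOn_extChartAt
  exact (EuclideanSpace.proj i : E4 →L[ℝ] ℝ).contDiff.contMDiff.comp_contMDiffOn h

theorem mvfderiv_chartCoord {p q : M} (hq : q ∈ (chartAt E4 p).source) (i : Fin 4)
    (v : TangentSpace (𝓡 4) q) : mvfderiv (𝓡 4) (chartCoord p i) q v = chartComp p q v i := by
  rw [chartComp_eq_mfderiv hq]
  have := mfderiv_comp_apply q (g := (EuclideanSpace.proj i : E4 →L[ℝ] ℝ))
    (I' := 𝓘(ℝ, E4)) (I'' := 𝓘(ℝ, ℝ))
    (EuclideanSpace.proj i : E4 →L[ℝ] ℝ).differentiableAt.mdifferentiableAt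
    (mdifferentiableAt_extChartAt (I := 𝓡 4) hq) v
  rw [mfderiv_eq_fderiv, ContinuousLinearMap.fderiv] at this
  exact this

theorem sum_smul_chartVec {p q : M} (hq : q ∈ (chartAt E4 p).source) (v : TangentSpace (𝓡 4) q) :
    v = ∑ i, chartComp p q v i • chartVec p q (EuclideanSpace.single i 1) := by
  simp_rw [← map_smul, ← map_sum]
  conv_lhs => rw [← chartVec_chartComp hq v]
  congr 1
  ext j
  simp [Pi.single_apply]

theorem contMDiffOn_chartComp_apply {X : VField M} {W : Set M} (hW : IsOpen W)
    (hX : SmoothFieldOn X W) (p : M) (hWp : W ⊆ (chartAt E4 p).source) (i : Fin 4) :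
    ContMDiffOn (𝓡 4) 𝓘(ℝ, ℝ) ∞ (fun q => chartComp p q (X q) i) W := fun q hq =>
  ((EuclideanSpace.proj i : E4 →L[ℝ] ℝ).contDiff.contMDiff.contMDiffAt.comp q
    (contMDiffAt_chartComp (hWp hq) (hX.contMDiffAt hW hq))).contMDiffWithinAt

theorem SmoothFieldOn.mono {X : VField M} {W V : Set M} (hX : SmoothFieldOn X W) (h : V ⊆ W) :
    SmoothFieldOn X V := ContMDiffOn.mono hX h

theorem Spacetime.contMDiffOn_g (st : Spacetime M) {X Y : VField M} {W : Set M} (hW : IsOpen W)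
    (hX : SmoothFieldOn X W) (hY : SmoothFieldOn Y W) :
    ContMDiffOn (𝓡 4) 𝓘(ℝ, ℝ) ∞ (fun q => st.g q (X q) (Y q)) W := fun _ hq =>
  (st.contMDiffAt_g (hX.contMDiffAt hW hq) (hY.contMDiffAt hW hq)).contMDiffWithinAt

/-- `nabla` at `q` is defined through the preferred chart at `q`, which may jump with `q`, so its
smoothness cannot be read off. Applying the chart-free identity `mvfderiv_nabla_sub_nabla` to the
coordinates of the fixed chart at `p` expresses the commutator by smooth functions near `p`. -/
theorem Spacetime.contMDiffAt_g_torsion (st : Spacetime M) {X Y Z : VField M} {W : Set M}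
    (hW : IsOpen W) (hX : SmoothFieldOn X W) (hY : SmoothFieldOn Y W) (hZ : SmoothFieldOn Z W)
    {p : M} (hp : p ∈ W) : ContMDiffAt (𝓡 4) 𝓘(ℝ, ℝ) ∞
      (fun q => st.g q (st.nabla Y q (X q) - st.nabla X q (Y q)) (Z q)) p := by
  have hps : p ∈ (chartAt E4 p).source := mem_chart_source E4 p
  set V := W ∩ (chartAt E4 p).source
  have hV : IsOpen V := hW.inter (chartAt E4 p).open_source
  have hVn : V ∈ 𝓝 p := hV.mem_nhds ⟨hp, hps⟩
  replace hX := hX.mono (V := V) inter_subset_left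
  replace hY := hY.mono (V := V) inter_subset_left
  replace hZ := hZ.mono (V := V) inter_subset_left
  have hXi := fun i => contMDiffOn_chartComp_apply hV hX p inter_subset_right i
  have hYi := fun i => contMDiffOn_chartComp_apply hV hY p inter_subset_right i
  have hsm : ContMDiffOn (𝓡 4) 𝓘(ℝ, ℝ) ∞ (fun q => ∑ i,
    (mvfderiv (𝓡 4) (fun z => chartComp p z (Y z) i) q (X q)
      - mvfderiv (𝓡 4) (fun z => chartComp p z (X z) i) q (Y q))
      * st.g q (chartVec p q (EuclideanSpace.single i 1)) (Z q)) V := by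
    refine contMDiffOn_finsetSum fun i _ => ?_
    refine ContMDiffOn.mul (((contMDiffOn_mvfderiv_apply hV (hYi i) hX)).sub
      (contMDiffOn_mvfderiv_apply hV (hXi i) hY)) ?_
    exact st.contMDiffOn_g hV ((smoothFieldOn_chartVec p _).mono inter_subset_right) hZ
  refine (hsm.contMDiffAt hVn).congr_of_eventuallyEq ?_
  filter_upwards [hVn] with q hq
  have hcong : ∀ (A : VField M) (i : Fin 4),
    (fun z => mvfderiv (𝓡 4) (chartCoord p i) z (A z)) =ᶠ[𝓝 q] fun z => chartComp p z (A z) i := by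
    intro A i
    filter_upwards [(chartAt E4 p).open_source.mem_nhds hq.2] with z hz
      using mvfderiv_chartCoord hz i _
  have hcong' : ∀ (A : VField M) (i : Fin 4) (v : TangentSpace (𝓡 4) q),
    mvfderiv (𝓡 4) (fun z => mvfderiv (𝓡 4) (chartCoord p i) z (A z)) q v =
    mvfderiv (𝓡 4) (fun z => chartComp p z (A z) i) q v := fun A i v =>
    DFunLike.congr_fun (hcong A i).mfderiv_eq v
  rw [sum_smul_chartVec hq.2 (st.nabla Y q (X q) - st.nabla X q (Y q))]
  simp only [map_sum, map_smul, sum_apply, smul_apply, smul_eq_mul]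
  refine Finset.sum_congr rfl fun i _ => ?_
  rw [← mvfderiv_chartCoord hq.2, st.mvfderiv_nabla_sub_nabla (chartAt E4 p).open_source hq.2
    (contMDiffOn_chartCoord p i) (hX.contMDiffAt hV hq) (hY.contMDiffAt hV hq), hcong', hcong']

/-- Metric compatibility, cyclically permuted and solved for one term; the differences of
derivatives play the role of Lie brackets. The right side is smooth by the previous lemma, which
makes the left side smooth. -/
theorem Spacetime.koszul (st : Spacetime M) {p : M} {X Y Z : VField M}
    (hX : ContMDiffAt (𝓡 4) (𝓡 4).tangent ∞ (fun p => (⟨p, X p⟩ : TangentBundle (𝓡 4) M)) p)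
    (hY : ContMDiffAt (𝓡 4) (𝓡 4).tangent ∞ (fun p => (⟨p, Y p⟩ : TangentBundle (𝓡 4) M)) p)
    (hZ : ContMDiffAt (𝓡 4) (𝓡 4).tangent ∞ (fun p => (⟨p, Z p⟩ : TangentBundle (𝓡 4) M)) p) :
    st.g p (st.nabla Y p (X p)) (Z p) = (1 / 2) *
     (mvfderiv (𝓡 4) (fun q => st.g q (Y q) (Z q)) p (X p)
      + mvfderiv (𝓡 4) (fun q => st.g q (X q) (Z q)) p (Y p)
      - mvfderiv (𝓡 4) (fun q => st.g q (X q) (Y q)) p (Z p)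
      + st.g p (st.nabla Y p (X p) - st.nabla X p (Y p)) (Z p)
      - st.g p (st.nabla Z p (X p) - st.nabla X p (Z p)) (Y p)
      - st.g p (st.nabla Z p (Y p) - st.nabla Y p (Z p)) (X p)) := by
  rw [st.mvfderiv_g_eq_nabla hY hZ, st.mvfderiv_g_eq_nabla hX hZ, st.mvfderiv_g_eq_nabla hX hY]
  simp only [map_sub, sub_apply]
  rw [st.g_symm p (Y p), st.g_symm p (X p), st.g_symm p (X p)]
  ring

theorem Spacetime.contMDiffOn_g_nabla (st : Spacetime M) {X Y Z : VField M} {W : Set M}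
    (hW : IsOpen W) (hX : SmoothFieldOn X W) (hY : SmoothFieldOn Y W) (hZ : SmoothFieldOn Z W) :
    ContMDiffOn (𝓡 4) 𝓘(ℝ, ℝ) ∞ (fun q => st.g q (st.nabla Y q (X q)) (Z q)) W := by
  have hT : ∀ {A B C : VField M}, SmoothFieldOn A W → SmoothFieldOn B W → SmoothFieldOn C W →
    ContMDiffOn (𝓡 4) 𝓘(ℝ, ℝ) ∞
      (fun q => st.g q (st.nabla B q (A q) - st.nabla A q (B q)) (C q)) W := fun hA hB hC q hq =>
    (st.contMDiffAt_g_torsion hW hA hB hC hq).contMDiffWithinAt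
  refine ContMDiffOn.congr ?_ fun q hq =>
    st.koszul (hX.contMDiffAt hW hq) (hY.contMDiffAt hW hq) (hZ.contMDiffAt hW hq)
  refine contMDiffOn_const.mul (((((?_ : ContMDiffOn _ _ _ _ _).add ?_).sub ?_).add
    (hT hX hY hZ)).sub (hT hX hZ hY) |>.sub (hT hY hZ hX))
  · exact contMDiffOn_mvfderiv_apply hW (st.contMDiffOn_g hW hY hZ) hX
  · exact contMDiffOn_mvfderiv_apply hW (st.contMDiffOn_g hW hX hZ) hY
  · exact contMDiffOn_mvfderiv_apply hW (st.contMDiffOn_g hW hX hY) hZ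

end

/-! ### Radial extension of the parametrized sphere -/

section

variable {M : Type*} [TopologicalSpace M] [ChartedSpace E4 M] [IsManifold (𝓡 4) ∞ M]

theorem radial_coe (x : S2) : radial (x : E3) = x := by
  have hx : ‖(x : E3)‖ = 1 := by simp
  have h0 : (x : E3) ≠ 0 := by intro h; rw [h] at hx; simp at hx
  ext1
  simp [radial, h0, hx]

theorem radial_smul {c : ℝ} (hc : 0 < c) (y : E3) : radial (c • y) = radial y := by
  by_cases hy : y = 0
  · simp [hy]
  · ext1
    simp only [radial, hy, smul_eq_zero, hc.ne', or_self, dite_false, norm_smul, Real.norm_eq_abs,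
      abs_of_pos hc, smul_smul, mul_inv]
    congr 1
    field_simp

theorem coe_radial {y : E3} (hy : y ≠ 0) : (radial y : E3) = ‖y‖⁻¹ • y := by
  simp [radial, hy]

theorem contMDiffAt_radial {y : E3} (hy : y ≠ 0) :
    ContMDiffAt 𝓘(ℝ, E3) (𝓡 2) ∞ radial y := by
  have hpos : 0 < ‖y‖ := norm_pos_iff.2 hy
  -- `ContMDiff.codRestrict_sphere` needs a map that is smooth on all of `E3`. The map `z ↦ y + χ z
  -- • (z - y)` is the identity near `y` and stays within distance `‖y‖ / 2` of `y`, so it can be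
  -- normalized everywhere.
  let χ : ContDiffBump y := ⟨‖y‖ / 4, ‖y‖ / 2, by linarith, by linarith⟩
  have hne : ∀ z, y + χ z • (z - y) ≠ 0 := by
    intro z hz
    have h1 : ‖χ z • (z - y)‖ = ‖y‖ := by
      rw [eq_neg_of_add_eq_zero_right hz, norm_neg]
    have h2 : ‖χ z • (z - y)‖ < ‖y‖ := by
      rw [norm_smul, Real.norm_eq_abs, abs_of_nonneg χ.nonneg]
      by_cases hz' : z ∈ Metric.ball y (‖y‖ / 2)
      · rw [Metric.mem_ball, dist_eq_norm] at hz'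
        calc χ z * ‖z - y‖ ≤ 1 * ‖z - y‖ := by gcongr; exact χ.le_one
          _ < ‖y‖ := by linarith
      · rw [χ.zero_of_le_dist (by simpa using hz'), zero_mul]
        exact hpos
    linarith
  have hsm : ContDiff ℝ ∞ fun z : E3 => y + χ z • (z - y) :=
    contDiff_const.add (χ.contDiff.smul (contDiff_id.sub contDiff_const))
  have hF : ContMDiff 𝓘(ℝ, E3) 𝓘(ℝ, E3) ∞
      fun z : E3 => ‖y + χ z • (z - y)‖⁻¹ • (y + χ z • (z - y)) :=
    (((hsm.norm ℝ hne).inv fun z => by simpa using hne z).smul hsm).contMDiff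
  have := hF.codRestrict_sphere (n := 2) fun z => by
    rw [mem_sphere_zero_iff_norm, norm_smul, norm_inv, norm_norm,
      inv_mul_cancel₀ (norm_ne_zero_iff.2 (hne z))]
  refine this.contMDiffAt.congr_of_eventuallyEq ?_
  filter_upwards [χ.eventuallyEq_one, isOpen_ne.mem_nhds hy] with z hz hz0
  ext1
  rw [coe_radial hz0]
  simp only [Set.val_codRestrict_apply]
  rw [hz]
  simp

theorem pt_coe (e : S2 → M) (x : S2) : pt e (x : E3) = e x := by rw [pt, radial_coe]

theorem pt_smul (e : S2 → M) {c : ℝ} (hc : 0 < c) (y : E3) : pt e (c • y) = pt e y := by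
  rw [pt, radial_smul hc, pt]

theorem sphere_ne_zero (x : S2) : (x : E3) ≠ 0 := ne_zero_of_mem_unit_sphere x

variable {e : S2 → M}

theorem contMDiffAt_pt (he : ContMDiff (𝓡 2) (𝓡 4) ∞ e) {y : E3} (hy : y ≠ 0) :
    ContMDiffAt 𝓘(ℝ, E3) (𝓡 4) ∞ (pt e) y :=
  (he (radial y)).comp y (contMDiffAt_radial hy)

theorem mdifferentiableAt_pt (he : ContMDiff (𝓡 2) (𝓡 4) ∞ e) {y : E3} (hy : y ≠ 0) :
    MDifferentiableAt 𝓘(ℝ, E3) (𝓡 4) (pt e) y :=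
  (contMDiffAt_pt he hy).mdifferentiableAt (by simp)

/-- This is the tangent map of `pt e` composed with the constant section `u` over the open set of
nonzero vectors. -/
theorem contMDiffAt_push (he : ContMDiff (𝓡 2) (𝓡 4) ∞ e) {y : E3} (hy : y ≠ 0) (u : E3) :
    ContMDiffAt 𝓘(ℝ, E3) (𝓡 4).tangent ∞
      (fun z => (⟨pt e z, push e z u⟩ : TangentBundle (𝓡 4) M)) y := by
  have hopen : IsOpen {z : E3 | z ≠ 0} := isOpen_ne
  have h1 : ContMDiffOn 𝓘(ℝ, E3) (𝓡 4) ∞ (pt e) {z : E3 | z ≠ 0} := fun z hz =>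
    (contMDiffAt_pt he hz).contMDiffWithinAt
  have h2 := h1.contMDiffOn_tangentMapWithin (m := ∞) (by simp) hopen.uniqueMDiffOn
  have h3 : ContMDiffOn 𝓘(ℝ, E3) 𝓘(ℝ, E3).tangent ∞
      (fun z => (⟨z, u⟩ : TangentBundle 𝓘(ℝ, E3) E3)) {z : E3 | z ≠ 0} := by
    intro z _
    refine ContMDiffAt.contMDiffWithinAt ?_
    exact contMDiffAt_vectorSpace_iff_contDiffAt.2 contDiffAt_const
  have h4 := (h2.comp h3 fun z hz => hz).contMDiffAt (hopen.mem_nhds hy)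
  refine h4.congr_of_eventuallyEq ?_
  filter_upwards [hopen.mem_nhds hy] with z hz
  simp only [Function.comp, tangentMapWithin, push]
  rw [mfderivWithin_of_isOpen hopen hz]
  rfl

theorem fderiv_comp_pt (he : ContMDiff (𝓡 2) (𝓡 4) ∞ e) {y : E3} (hy : y ≠ 0) {f : M → ℝ}
    (hf : MDifferentiableAt (𝓡 4) 𝓘(ℝ, ℝ) f (pt e y)) (u : E3) :
    fderiv ℝ (fun z => f (pt e z)) y u = mvfderiv (𝓡 4) f (pt e y) (push e y u) := by
  have := mfderiv_comp_apply y hf (mdifferentiableAt_pt he hy) u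
  rw [mfderiv_eq_fderiv] at this
  exact this

/-- `pt e` is constant along rays. -/
theorem push_self (he : ContMDiff (𝓡 2) (𝓡 4) ∞ e) {y : E3} (hy : y ≠ 0) :
    push e y y = 0 := by
  have hg : DifferentiableAt ℝ (fun t : ℝ => t • y) 1 := by fun_prop
  have h := mfderiv_comp_apply_of_eq (1 : ℝ) (mdifferentiableAt_pt he hy)
    hg.mdifferentiableAt (one_smul ℝ y) (1 : ℝ)
  have hc : pt e ∘ (fun t : ℝ => t • y) =ᶠ[𝓝 1] fun _ => pt e y := by
    filter_upwards [lt_mem_nhds one_pos] with t ht using pt_smul e ht y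
  have hd : mfderiv 𝓘(ℝ, ℝ) 𝓘(ℝ, E3) (fun t : ℝ => t • y) 1 (1 : ℝ) = y := by
    rw [mfderiv_eq_fderiv]
    have h5 : HasFDerivAt (fun t : ℝ => t • y) ((ContinuousLinearMap.id ℝ ℝ).smulRight y) 1 :=
      (hasFDerivAt_id (𝕜 := ℝ) (1 : ℝ)).smul_const y
    rw [h5.fderiv]
    exact one_smul ℝ y
  rw [hc.mfderiv_eq] at h
  erw [hd] at h
  exact h.symm.trans (by rw [mfderiv_const]; rfl)

end

/-! ### Alternating forms; regularity and homogeneity of the pulled-back forms -/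

section

section Alternating

variable {V : Type*} [AddCommGroup V] [Module ℝ V] (f : V [⋀^Fin 4]→ₗ[ℝ] ℝ) (a b c d : V)

theorem alternating_swap_two_three : f ![a, b, d, c] = -f ![a, b, c, d] := by
  rw [← f.map_swap ![a, b, c, d] (i := 2) (j := 3) (by decide)]
  congr 1
  ext i
  fin_cases i <;> rfl

theorem alternating_swap_one_two : f ![a, c, b, d] = -f ![a, b, c, d] := by
  rw [← f.map_swap ![a, b, c, d] (i := 1) (j := 2) (by decide)]
  congr 1
  ext i
  fin_cases i <;> rfl

theorem alternating_swap_zero_one : f ![b, a, c, d] = -f ![a, b, c, d] := by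
  rw [← f.map_swap ![a, b, c, d] (i := 0) (j := 1) (by decide)]
  congr 1
  ext i
  fin_cases i <;> rfl

theorem alternating_eq_zero_two_three : f ![a, b, c, c] = 0 :=
  f.map_eq_zero_of_eq ![a, b, c, c] (i := 2) (j := 3) rfl (by decide)

theorem update_vecCons_three (x y : V) :
    Function.update ![a, b, c, x] 3 y = ![a, b, c, y] := by
  ext i; fin_cases i <;> rfl

/-- An alternating form as a linear form in its last argument. -/
noncomputable def alternatingLast : V →ₗ[ℝ] ℝ where
  toFun d := f ![a, b, c, d]
  map_add' x y := by
    have h := f.map_update_add ![a, b, c, 0] 3 x y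
    simpa only [update_vecCons_three] using h
  map_smul' r x := by
    have h := f.map_update_smul ![a, b, c, 0] 3 r x
    simpa only [update_vecCons_three, RingHom.id_apply] using h

theorem alternatingLast_apply (d' : V) : alternatingLast f a b c d' = f ![a, b, c, d'] := rfl

theorem alternating_sum_three {ι : Type*} (s : Finset ι) (r : ι → ℝ) (v : ι → V) :
    f ![a, b, c, ∑ i ∈ s, r i • v i] = ∑ i ∈ s, r i * f ![a, b, c, v i] := by
  simp only [← alternatingLast_apply, map_sum, map_smul, smul_eq_mul]

theorem alternating_sum_two {ι : Type*} (s : Finset ι) (r : ι → ℝ) (v : ι → V) :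
    f ![a, b, ∑ i ∈ s, r i • v i, d] = ∑ i ∈ s, r i * f ![a, b, v i, d] := by
  rw [alternating_swap_two_three, alternating_sum_three, ← Finset.sum_neg_distrib]
  exact Finset.sum_congr rfl fun i _ => by rw [alternating_swap_two_three f a b d (v i)]; ring

theorem alternating_sum_one {ι : Type*} (s : Finset ι) (r : ι → ℝ) (v : ι → V) :
    f ![a, ∑ i ∈ s, r i • v i, c, d] = ∑ i ∈ s, r i * f ![a, v i, c, d] := by
  rw [alternating_swap_one_two, alternating_sum_two, ← Finset.sum_neg_distrib]
  exact Finset.sum_congr rfl fun i _ => by rw [alternating_swap_one_two f a c (v i) d]; ring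

theorem alternating_add_three (d' : V) : f ![a, b, c, d + d'] = f ![a, b, c, d] + f ![a, b, c, d'] :=
  map_add (alternatingLast f a b c) d d'

theorem alternating_smul_three (r : ℝ) : f ![a, b, c, r • d] = r * f ![a, b, c, d] :=
  map_smul (alternatingLast f a b c) r d

theorem alternating_add_two (c' : V) : f ![a, b, c + c', d] = f ![a, b, c, d] + f ![a, b, c', d] := by
  rw [alternating_swap_two_three, alternating_add_three, alternating_swap_two_three f a b c d,
    alternating_swap_two_three f a b c' d]
  ring

theorem alternating_smul_two (r : ℝ) : f ![a, b, r • c, d] = r * f ![a, b, c, d] := by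
  rw [alternating_swap_two_three, alternating_smul_three, alternating_swap_two_three f a b c d]
  ring

end Alternating

variable {M : Type*} [TopologicalSpace M] [ChartedSpace E4 M] [IsManifold (𝓡 4) ∞ M]

/-- The Levi-Civita derivative of a field as a linear map. -/
noncomputable def Spacetime.nablaLin (st : Spacetime M) (X : VField M) (p : M) :
    TangentSpace (𝓡 4) p →ₗ[ℝ] TangentSpace (𝓡 4) p where
  toFun v := st.nabla X p v
  map_add' := st.nabla_add X p
  map_smul' := st.nabla_smul X p

theorem Spacetime.nablaLin_apply (st : Spacetime M) (X : VField M) (p : M)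
    (v : TangentSpace (𝓡 4) p) : st.nablaLin X p v = st.nabla X p v := rfl

theorem Spacetime.nabla_sum (st : Spacetime M) (X : VField M) (p : M) {ι : Type*} (s : Finset ι)
    (r : ι → ℝ) (v : ι → TangentSpace (𝓡 4) p) :
    st.nabla X p (∑ i ∈ s, r i • v i) = ∑ i ∈ s, r i • st.nabla X p (v i) := by
  simp only [← st.nablaLin_apply, map_sum, map_smul]

variable {e : S2 → M} (st : Spacetime M)

theorem eventually_pt_mem (he : ContMDiff (𝓡 2) (𝓡 4) ∞ e) {y : E3} (hy : y ≠ 0) {W : Set M}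
    (hW : IsOpen W) (hyW : pt e y ∈ W) : ∀ᶠ z in 𝓝 y, pt e z ∈ W :=
  (contMDiffAt_pt he hy).continuousAt.eventually (hW.mem_nhds hyW)

theorem contDiffAt_chartComp_push (he : ContMDiff (𝓡 2) (𝓡 4) ∞ e) {y : E3} (hy : y ≠ 0) (u : E3)
    (i : Fin 4) : ContDiffAt ℝ ∞ (fun z => chartComp (pt e y) (pt e z) (push e z u) i) y := by
  have h := (Bundle.contMDiffAt_totalSpace.1 (contMDiffAt_push he hy u)).2
  have h2 := ((EuclideanSpace.proj i : E4 →L[ℝ] ℝ).contDiff.contMDiff.contMDiffAt.comp y h)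
  refine h2.contDiffAt.congr_of_eventuallyEq ?_
  filter_upwards [eventually_pt_mem he hy (chartAt E4 (pt e y)).open_source
    (mem_chart_source E4 (pt e y))] with z hz
  rw [chartComp_apply hz]
  rfl

theorem contDiffAt_comp_pt (he : ContMDiff (𝓡 2) (𝓡 4) ∞ e) {y : E3} (hy : y ≠ 0) {f : M → ℝ}
    (hf : ContMDiffAt (𝓡 4) 𝓘(ℝ, ℝ) ∞ f (pt e y)) : ContDiffAt ℝ ∞ (fun z => f (pt e z)) y :=
  (hf.comp y (contMDiffAt_pt he hy)).contDiffAt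

/-- Linearity of `nabla` in its direction reduces this to the coordinate fields of the chart at `pt
e y`, where `contMDiffOn_g_nabla` applies. -/
theorem contDiffAt_rotForm (he : ContMDiff (𝓡 2) (𝓡 4) ∞ e) {k kb : VField M} {W : Set M}
    (hW : IsOpen W) (heW : range e ⊆ W) (hk : SmoothFieldOn k W) (hkb : SmoothFieldOn kb W)
    {y : E3} (hy : y ≠ 0) (u : E3) : ContDiffAt ℝ ∞ (fun z => rotForm st e k kb z u) y := by
  set p := pt e y
  set V := W ∩ (chartAt E4 p).source
  have hV : IsOpen V := hW.inter (chartAt E4 p).open_source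
  have hpV : p ∈ V := ⟨heW (mem_range_self _), mem_chart_source E4 p⟩
  have hsm : ContDiffAt ℝ ∞ (fun z => -∑ i, chartComp p (pt e z) (push e z u) i *
      (fun q => st.g q (st.nabla k q (chartVec p q (EuclideanSpace.single i 1))) (kb q)) (pt e z))
      y := by
    refine ContDiffAt.neg (ContDiffAt.sum fun i _ => ?_)
    refine (contDiffAt_chartComp_push he hy u i).mul (contDiffAt_comp_pt he hy
      (f := fun q => st.g q (st.nabla k q (chartVec p q (EuclideanSpace.single i 1))) (kb q)) ?_)
    exact (st.contMDiffOn_g_nabla hV ((smoothFieldOn_chartVec p _).mono inter_subset_right)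
      (hk.mono inter_subset_left) (hkb.mono inter_subset_left)).contMDiffAt (hV.mem_nhds hpV)
  refine hsm.congr_of_eventuallyEq ?_
  filter_upwards [eventually_pt_mem he hy hV hpV] with z hz
  rw [rotForm, st.g_symm]
  conv_lhs => rw [sum_smul_chartVec hz.2 (push e z u)]
  rw [st.nabla_sum, map_sum, sum_apply]
  simp only [map_smul, smul_apply, smul_eq_mul]

theorem contDiffAt_areaForm (he : ContMDiff (𝓡 2) (𝓡 4) ∞ e) {k kb : VField M} {W : Set M}
    (hW : IsOpen W) (heW : range e ⊆ W) (hk : SmoothFieldOn k W) (hkb : SmoothFieldOn kb W)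
    {y : E3} (hy : y ≠ 0) (u v : E3) :
    ContDiffAt ℝ ∞ (fun z => areaForm st k kb (pt e z) (push e z u) (push e z v)) y := by
  set p := pt e y
  set V := W ∩ (chartAt E4 p).source
  have hV : IsOpen V := hW.inter (chartAt E4 p).open_source
  have hpV : p ∈ V := ⟨heW (mem_range_self _), mem_chart_source E4 p⟩
  have hsm : ContDiffAt ℝ ∞ (fun z => ∑ i, chartComp p (pt e z) (push e z u) i *
      ∑ j, chartComp p (pt e z) (push e z v) j *
      (fun q => st.vol q ![kb q, k q, chartVec p q (EuclideanSpace.single i 1),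
        chartVec p q (EuclideanSpace.single j 1)]) (pt e z)) y := by
    refine ContDiffAt.sum fun i _ => ?_
    refine (contDiffAt_chartComp_push he hy u i).mul (ContDiffAt.sum fun j _ => ?_)
    refine (contDiffAt_chartComp_push he hy v j).mul (contDiffAt_comp_pt he hy
      (f := fun q => st.vol q ![kb q, k q, chartVec p q (EuclideanSpace.single i 1),
        chartVec p q (EuclideanSpace.single j 1)]) ?_)
    have := st.vol_smooth V ![kb, k, fun q => chartVec p q (EuclideanSpace.single i 1),
      fun q => chartVec p q (EuclideanSpace.single j 1)] hV (by
        intro l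
        fin_cases l
        · exact hkb.mono inter_subset_left
        · exact hk.mono inter_subset_left
        · exact (smoothFieldOn_chartVec p _).mono inter_subset_right
        · exact (smoothFieldOn_chartVec p _).mono inter_subset_right)
    refine (this.contMDiffAt (hV.mem_nhds hpV)).congr_of_eventuallyEq
      (Eventually.of_forall fun q => ?_)
    refine congrArg (st.vol q) ?_
    ext l
    fin_cases l <;> rfl
  refine hsm.congr_of_eventuallyEq ?_
  filter_upwards [eventually_pt_mem he hy hV hpV] with z hz
  rw [areaForm]
  conv_lhs => rw [sum_smul_chartVec hz.2 (push e z u), sum_smul_chartVec hz.2 (push e z v)]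
  rw [alternating_sum_two]
  simp only [alternating_sum_three]

/-- The two pushed vectors live in tangent spaces at points that are equal but not definitionally
so. Quantifying over `F` states their equality without a cast. -/
theorem push_smul_point (he : ContMDiff (𝓡 2) (𝓡 4) ∞ e) {y : E3} (hy : y ≠ 0) {c : ℝ}
    (hc : 0 < c) (F : ∀ q : M, (TangentSpace (𝓡 4) q) → ℝ) (u : E3) :
    F (pt e (c • y)) (push e (c • y) (c • u)) = F (pt e y) (push e y u) := by
  have hfun : pt e ∘ (fun z : E3 => c • z) = pt e := funext fun z => pt_smul e hc z
  have hcy : c • y ≠ 0 := smul_ne_zero hc.ne' hy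
  have hd : DifferentiableAt ℝ (fun z : E3 => c • z) y := by fun_prop
  have h := mfderiv_comp_apply y (mdifferentiableAt_pt he hcy) hd.mdifferentiableAt u
  have h2 : mfderiv 𝓘(ℝ, E3) 𝓘(ℝ, E3) (fun z : E3 => c • z) y u = c • u := by
    rw [mfderiv_eq_fderiv]
    have : HasFDerivAt (fun z : E3 => c • z) (c • ContinuousLinearMap.id ℝ E3) y :=
      (hasFDerivAt_id y).const_smul c
    rw [this.fderiv]; rfl
  have key : F ((pt e ∘ fun z : E3 => c • z) y)
      (mfderiv 𝓘(ℝ, E3) (𝓡 4) (pt e ∘ fun z : E3 => c • z) y u) = F (pt e y) (push e y u) := by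
    rw [hfun]; rfl
  rw [← key, h]
  erw [h2]
  rfl

/-- A form pulled back along a map of degree 0 is invariant under dilations, so its constant-basis
components have degree -1. -/
theorem rotForm_smul_point (he : ContMDiff (𝓡 2) (𝓡 4) ∞ e) (k kb : VField M) {y : E3} (hy : y ≠ 0)
    {c : ℝ} (hc : 0 < c) (u : E3) :
    rotForm st e k kb (c • y) u = c⁻¹ * rotForm st e k kb y u := by
  have h := push_smul_point he hy hc (fun q v => -st.g q (kb q) (st.nabla k q v)) u
  simp only [map_smul, st.nabla_smul, smul_eq_mul] at h
  rw [rotForm, rotForm, ← h]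
  field_simp

end

/-! ### Stokes' theorem on the round sphere -/

section

theorem integral_fderiv_eq_zero {f : E3 → ℝ} (hf : ContDiff ℝ 1 f) (hc : HasCompactSupport f)
    (v : E3) : ∫ y, fderiv ℝ f y v = 0 := by
  have hd : Continuous fun y => fderiv ℝ f y v :=
    (hf.continuous_fderiv (by simp)).clm_apply continuous_const
  have hdc : HasCompactSupport fun y => fderiv ℝ f y v :=
    (hc.fderiv (𝕜 := ℝ)).comp_left (g := fun L : E3 →L[ℝ] ℝ => L v) (by simp)
  have := integral_mul_fderiv_eq_neg_fderiv_mul_of_integrable (μ := (volume : Measure E3))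
    (f := fun _ => (1 : ℝ)) (g := f) (v := v) (by simp)
    (by simpa using hd.integrable_of_hasCompactSupport hdc)
    (by simpa using hf.continuous.integrable_of_hasCompactSupport hc) (fun _ _ => by fun_prop)
    (fun y _ => (hf.differentiable (by simp)) y)
  simpa using this

theorem integrable_fderiv_apply {f : E3 → ℝ} (hf : ContDiff ℝ 1 f) (hc : HasCompactSupport f)
    (v : E3) : Integrable fun y => fderiv ℝ f y v := by
  have hd : Continuous fun y => fderiv ℝ f y v :=
    (hf.continuous_fderiv (by simp)).clm_apply continuous_const
  have hdc : HasCompactSupport fun y => fderiv ℝ f y v :=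
    (hc.fderiv (𝕜 := ℝ)).comp_left (g := fun L : E3 →L[ℝ] ℝ => L v) (by simp)
  exact hd.integrable_of_hasCompactSupport hdc

/-- Polar coordinates for products of an angular and a radial function. -/
theorem integral_radial_mul_norm (f : S2 → ℝ) (w : ℝ → ℝ) :
    ∫ y : E3, f (radial y) * w ‖y‖ = (∫ x, f x ∂(volume : Measure E3).toSphere) *
      ∫ r : Ioi (0 : ℝ), w r ∂Measure.volumeIoiPow 2 := by
  have h1 : ∫ y : E3, f (radial y) * w ‖y‖ = ∫ y in ({0}ᶜ : Set E3), f (radial y) * w ‖y‖ := by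
    rw [Measure.restrict_eq_self_of_ae_mem (s := ({0}ᶜ : Set E3)) (compl_mem_ae_iff.2 (measure_singleton 0))]
  have h3 : Module.finrank ℝ E3 - 1 = 2 := by simp
  have hmp := Measure.measurePreserving_homeomorphUnitSphereProd (volume : Measure E3)
  rw [h3] at hmp
  rw [h1, ← integral_subtype_comap (measurableSet_singleton 0).compl, ← integral_prod_mul,
    ← hmp.integral_comp (Homeomorph.measurableEmbedding _)]
  refine integral_congr_ae (Eventually.of_forall fun y => ?_)
  have hy : (y : E3) ≠ 0 := y.2
  have hr : (homeomorphUnitSphereProd E3 y).1 = radial y := by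
    ext1
    rw [coe_radial hy, homeomorphUnitSphereProd_apply_fst_coe]
  simp only [hr, homeomorphUnitSphereProd_apply_snd_coe]

/-- A bump function on `ℝ` supported in `(1, 3)`. -/
noncomputable def annulusBump : ContDiffBump (2 : ℝ) := ⟨1 / 2, 1, by norm_num, by norm_num⟩

/-- A smooth radial weight on `E3`, supported in an annulus. -/
noncomputable def annulusWeight (y : E3) : ℝ := annulusBump (‖y‖ ^ 2)

theorem annulusWeight_eq_zero {y : E3} (hy : ‖y‖ ^ 2 ≤ 1) : annulusWeight y = 0 :=
  annulusBump.zero_of_le_dist (by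
    rw [Real.dist_eq, abs_of_nonpos (by linarith)]
    change (1 : ℝ) ≤ _
    linarith)

theorem contDiff_annulusWeight : ContDiff ℝ ∞ annulusWeight :=
  annulusBump.contDiff.comp (contDiff_norm_sq ℝ)

theorem hasCompactSupport_annulusWeight : HasCompactSupport annulusWeight := by
  refine HasCompactSupport.of_support_subset_isCompact (isCompact_closedBall (0 : E3) 2) fun y hy => ?_
  rw [mem_closedBall_zero_iff]
  by_contra h
  push Not at h
  refine hy (annulusBump.zero_of_le_dist ?_)
  have : (4 : ℝ) < ‖y‖ ^ 2 := by nlinarith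
  rw [Real.dist_eq, abs_of_nonneg (by linarith)]
  change (1 : ℝ) ≤ _
  linarith

theorem annulusWeight_eventually_zero : annulusWeight =ᶠ[𝓝 0] 0 := by
  filter_upwards [Metric.ball_mem_nhds (0 : E3) one_pos] with y hy
  rw [mem_ball_zero_iff] at hy
  exact annulusWeight_eq_zero (by nlinarith [norm_nonneg y])

theorem fderiv_annulusWeight (y : E3) (i : Fin 3) :
    fderiv ℝ annulusWeight y (e3 i) = 2 * deriv annulusBump (‖y‖ ^ 2) * y i := by
  have h1 : HasDerivAt annulusBump (deriv annulusBump (‖y‖ ^ 2)) (‖y‖ ^ 2) :=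
    ((annulusBump.contDiff (n := 1)).differentiable (by simp) _).hasDerivAt
  have h2 := h1.comp_hasFDerivAt y (hasStrictFDerivAt_norm_sq y).hasFDerivAt
  have h3 : annulusWeight = annulusBump ∘ fun y : E3 => ‖y‖ ^ 2 := rfl
  rw [h3, h2.fderiv]
  simp [e3, EuclideanSpace.inner_single_right]
  ring

/-- Polar coordinates with angular factor 1 show that this number times the area of the sphere is
the integral of a nonnegative, not identically zero function. The `max` avoids the singularity of
`r⁻¹` at 0 and equals `r` where the bump is nonzero. -/
theorem integral_volumeIoiPow_annulus_ne_zero :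
    ∫ r : Ioi (0 : ℝ), annulusBump ((r : ℝ) ^ 2) * (max (r : ℝ) 1)⁻¹ ∂Measure.volumeIoiPow 2 ≠ 0 := by
  have h := integral_radial_mul_norm (fun _ => 1) fun r => annulusBump (r ^ 2) * (max r 1)⁻¹
  have hpos : 0 < ∫ y : E3, annulusWeight y * (max ‖y‖ 1)⁻¹ := by
    have hcont : Continuous fun y : E3 => annulusWeight y * (max ‖y‖ 1)⁻¹ :=
      contDiff_annulusWeight.continuous.mul
        ((continuous_norm.max continuous_const).inv₀ fun y => by positivity)
    refine hcont.integral_pos_of_hasCompactSupport_nonneg_nonzero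
      hasCompactSupport_annulusWeight.mul_right
      (fun y => mul_nonneg annulusBump.nonneg (by positivity))
      (x := EuclideanSpace.single 0 (Real.sqrt 2)) ?_
    refine mul_ne_zero (ne_of_gt (annulusBump.pos_of_mem_ball ?_)) (by positivity)
    simp [annulusBump]
  simp only [one_mul] at h
  intro h0
  rw [h0, mul_zero] at h
  exact hpos.ne' h

section Stokes

variable {α : E3 → E3 → ℝ}

theorem fderiv_smul_point {a : E3 → ℝ} (ha : ∀ y ≠ 0, ContDiffAt ℝ 1 a y)
    (hom : ∀ y ≠ 0, ∀ c : ℝ, 0 < c → a (c • y) = c⁻¹ * a y) {y : E3} (hy : y ≠ 0) {c : ℝ}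
    (hc : 0 < c) (u : E3) : fderiv ℝ a (c • y) u = c⁻¹ * c⁻¹ * fderiv ℝ a y u := by
  have h1 : HasFDerivAt (fun z => a (c • z)) ((fderiv ℝ a (c • y)).comp
      (c • ContinuousLinearMap.id ℝ E3)) y :=
    ((ha _ (smul_ne_zero hc.ne' hy)).differentiableAt (by simp)).hasFDerivAt.comp y
      ((hasFDerivAt_id y).const_smul c)
  have h2 : HasFDerivAt (fun z => a (c • z)) (c⁻¹ • fderiv ℝ a y) y := by
    refine (((ha y hy).differentiableAt (by simp)).hasFDerivAt.const_mul c⁻¹).congr_of_eventuallyEq ?_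
    filter_upwards [isOpen_ne.mem_nhds hy] with z hz using hom z hz c hc
  have h3 := DFunLike.congr_fun (h1.unique h2) u
  simp only [ContinuousLinearMap.comp_apply, smul_apply, ContinuousLinearMap.id_apply, map_smul,
    smul_eq_mul] at h3
  field_simp at h3 ⊢
  linarith

/-- Differentiation lowers the degree from -1 to -2, and the factor `y` in `density` raises it to
-1. -/
theorem density_extD_smul_point (hα : ∀ i, ∀ y ≠ 0, ContDiffAt ℝ 1 (fun z => α z (e3 i)) y)
    (hom : ∀ i, ∀ y ≠ 0, ∀ c : ℝ, 0 < c → α (c • y) (e3 i) = c⁻¹ * α y (e3 i)) {y : E3}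
    (hy : y ≠ 0) {c : ℝ} (hc : 0 < c) :
    density (extD α (c • y)) (c • y) = c⁻¹ * density (extD α y) y := by
  simp only [density, extD, fderiv_smul_point (hα _) (hom _) hy hc, PiLp.smul_apply, smul_eq_mul]
  field_simp

theorem contDiff_annulusWeight_mul {f : E3 → ℝ} (hf : ∀ y ≠ 0, ContDiffAt ℝ 1 f y) :
    ContDiff ℝ 1 fun y => annulusWeight y * f y := by
  rw [contDiff_iff_contDiffAt]
  intro y
  by_cases hy : y = 0
  · subst hy
    refine (contDiffAt_const (c := (0 : ℝ))).congr_of_eventuallyEq ?_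
    filter_upwards [annulusWeight_eventually_zero] with z hz
    rw [hz]; simp
  · exact (contDiff_annulusWeight.contDiffAt.of_le (by norm_cast)).mul (hf y hy)

theorem contDiff_coord (i : Fin 3) : ContDiff ℝ ∞ fun y : E3 => y i :=
  (EuclideanSpace.proj i : E3 →L[ℝ] ℝ).contDiff

theorem fderiv_annulus_term {a b : E3 → ℝ} {y : E3} (ha : DifferentiableAt ℝ a y)
    (hb : DifferentiableAt ℝ b y) {i j l : Fin 3} (hij : i ≠ j) (hil : i ≠ l) :
    fderiv ℝ (fun z => annulusWeight z * (z j * a z - z l * b z)) y (e3 i) =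
      2 * deriv annulusBump (‖y‖ ^ 2) * y i * (y j * a y - y l * b y) +
      annulusWeight y * (y j * fderiv ℝ a y (e3 i) - y l * fderiv ℝ b y (e3 i)) := by
  have hp (m : Fin 3) : HasFDerivAt (fun z : E3 => z m) (EuclideanSpace.proj m : E3 →L[ℝ] ℝ) y :=
    (EuclideanSpace.proj m : E3 →L[ℝ] ℝ).hasFDerivAt
  have hw : HasFDerivAt annulusWeight (fderiv ℝ annulusWeight y) y :=
    (contDiff_annulusWeight.differentiable (by simp) y).hasFDerivAt
  have h := hw.mul (((hp j).mul ha.hasFDerivAt).sub ((hp l).mul hb.hasFDerivAt))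
  have h' : HasFDerivAt (fun z => annulusWeight z * (z j * a z - z l * b z)) _ y := h
  rw [h'.fderiv]
  simp only [add_apply, sub_apply, smul_apply, smul_eq_mul, fderiv_annulusWeight, Pi.sub_apply,
    Pi.mul_apply]
  have hj : (EuclideanSpace.proj j : E3 →L[ℝ] ℝ) (e3 i) = 0 := by simp [e3, hij.symm]
  have hl : (EuclideanSpace.proj l : E3 →L[ℝ] ℝ) (e3 i) = 0 := by simp [e3, hil.symm]
  rw [hj, hl]
  ring

/-- Stokes' theorem on the round sphere, for 1-forms on `E3 ∖ {0}` that are homogeneous of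
degree `-1` in each component. -/
theorem integral_density_extD_eq_zero
    (hα : ∀ i, ∀ y ≠ 0, ContDiffAt ℝ 1 (fun z => α z (e3 i)) y)
    (hom : ∀ i, ∀ y ≠ 0, ∀ c : ℝ, 0 < c → α (c • y) (e3 i) = c⁻¹ * α y (e3 i)) :
    ∫ x : S2, density (extD α x) x ∂(volume : Measure E3).toSphere = 0 := by
  have hG : ∀ (j l m n : Fin 3), ∀ y ≠ 0,
      ContDiffAt ℝ 1 (fun z : E3 => z j * α z (e3 m) - z l * α z (e3 n)) y := fun j l m n y hy =>
    (((contDiff_coord j).contDiffAt.of_le (by norm_cast)).mul (hα m y hy)).sub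
      (((contDiff_coord l).contDiffAt.of_le (by norm_cast)).mul (hα n y hy))
  let G (j l m n : Fin 3) (z : E3) : ℝ := annulusWeight z * (z j * α z (e3 m) - z l * α z (e3 n))
  have hGc : ∀ j l m n, ContDiff ℝ 1 (G j l m n) := fun j l m n =>
    contDiff_annulusWeight_mul (hG j l m n)
  have hGs : ∀ j l m n, HasCompactSupport (G j l m n) := fun j l m n =>
    hasCompactSupport_annulusWeight.mul_right
  -- With `w = annulusWeight`, the integrand is the divergence of `w • (α × y)`: div(α × y) = y ·
  -- curl α because `y` is curl free, and the gradient of `w` is radial, hence orthogonal to `α ×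
  -- y`. Each `G` is one component of this field.
  have hdiv : ∫ y : E3, annulusWeight y * density (extD α y) y = 0 := by
    have h1 : ∀ y : E3, annulusWeight y * density (extD α y) y =
        fderiv ℝ (G 0 2 2 0) y (e3 1) + fderiv ℝ (G 1 0 0 1) y (e3 2)
          + fderiv ℝ (G 2 1 1 2) y (e3 0) := by
      intro y
      by_cases hy : y = 0
      · subst hy
        have hz : ∀ j l m n, fderiv ℝ (G j l m n) 0 = 0 := by
          intro j l m n
          have : G j l m n =ᶠ[𝓝 0] fun _ => 0 := by
            filter_upwards [annulusWeight_eventually_zero] with z hz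
            simp [G, hz]
          rw [this.fderiv_eq]
          simp
        rw [hz, hz, hz, annulusWeight_eq_zero (by simp)]
        simp
      · have hd : ∀ i, DifferentiableAt ℝ (fun z => α z (e3 i)) y := fun i =>
          (hα i y hy).differentiableAt (by simp)
        simp only [G]
        rw [fderiv_annulus_term (hd 2) (hd 0) (by decide) (by decide),
          fderiv_annulus_term (hd 0) (hd 1) (by decide) (by decide),
          fderiv_annulus_term (hd 1) (hd 2) (by decide) (by decide)]
        simp only [density, extD]
        ring
    simp only [h1]
    have hi : ∀ j l m n i, Integrable fun y => fderiv ℝ (G j l m n) y (e3 i) := fun j l m n i =>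
      integrable_fderiv_apply (hGc j l m n) (hGs j l m n) _
    have hz : ∀ j l m n i, ∫ y, fderiv ℝ (G j l m n) y (e3 i) = 0 := fun j l m n i =>
      integral_fderiv_eq_zero (hGc j l m n) (hGs j l m n) _
    rw [integral_add (by exact (hi _ _ _ _ _).add (hi _ _ _ _ _)) (hi _ _ _ _ _),
      integral_add (hi _ _ _ _ _) (hi _ _ _ _ _), hz, hz, hz]
    simp
  -- The radial factor `r⁻¹` compensates the degree -1 of the density, so the volume integral splits
  -- into the wanted sphere integral times a nonzero constant.
  have hpol := integral_radial_mul_norm (fun x : S2 => density (extD α x) x)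
    fun r => annulusBump (r ^ 2) * (max r 1)⁻¹
  have heq : ∀ y : E3, density (extD α (radial y)) (radial y) *
      (annulusBump (‖y‖ ^ 2) * (max ‖y‖ 1)⁻¹) = annulusWeight y * density (extD α y) y := by
    intro y
    change _ * (annulusWeight y * _) = _
    by_cases hw : ‖y‖ ^ 2 ≤ 1
    · rw [annulusWeight_eq_zero hw]; simp
    · push Not at hw
      have h1 : 1 ≤ ‖y‖ := by nlinarith [norm_nonneg y]
      have hy : y ≠ 0 := by
        intro h; rw [h] at h1; simp at h1; linarith
      rw [coe_radial hy, density_extD_smul_point hα hom hy (inv_pos.2 (norm_pos_iff.2 hy)),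
        max_eq_left h1]
      field_simp
  simp only [heq] at hpol
  rw [hdiv] at hpol
  exact (mul_eq_zero.1 hpol.symm).resolve_right integral_volumeIoiPow_annulus_ne_zero

end Stokes

end

/-! ### Null frames and the twist -/

section

variable {M : Type*} [TopologicalSpace M] [ChartedSpace E4 M] [IsManifold (𝓡 4) ∞ M]

/-- `k, kb, a, b` is an oriented null frame at `p`. -/
structure IsNullFrame (st : Spacetime M) (p : M) (k kb a b : TangentSpace (𝓡 4) p) : Prop where
  kk : st.g p k k = 0
  kbkb : st.g p kb kb = 0
  kkb : st.g p k kb = -1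
  ka : st.g p k a = 0
  k_b : st.g p k b = 0
  kba : st.g p kb a = 0
  kbb : st.g p kb b = 0
  aa : st.g p a a = 1
  bb : st.g p b b = 1
  ab : st.g p a b = 0
  vol : st.vol p ![kb, k, a, b] = 1

/-- The Gram determinant of such a frame is -1. Only the square of the volume is determined; the
orientation has to be arranged by a sign. -/
theorem Spacetime.vol_sq_eq_one (st : Spacetime M) {p : M} {k kb a b : TangentSpace (𝓡 4) p}
    (kk : st.g p k k = 0) (kbkb : st.g p kb kb = 0) (kkb : st.g p k kb = -1)
    (ka : st.g p k a = 0) (hkb : st.g p k b = 0) (kba : st.g p kb a = 0) (kbb : st.g p kb b = 0)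
    (aa : st.g p a a = 1) (bb : st.g p b b = 1) (ab : st.g p a b = 0) :
    st.vol p ![kb, k, a, b] ^ 2 = 1 := by
  rw [st.vol_sq]
  have : (Matrix.of fun i j => st.g p (![kb, k, a, b] i) (![kb, k, a, b] j)) =
      !![0, -1, 0, 0; -1, 0, 0, 0; 0, 0, 1, 0; 0, 0, 0, 1] := by
    ext i j
    fin_cases i <;> fin_cases j <;>
      simp [kk, kbkb, kkb, ka, hkb, kba, kbb, aa, bb, ab, st.g_symm p a k, st.g_symm p b k,
        st.g_symm p a kb, st.g_symm p b kb, st.g_symm p b a, st.g_symm p kb k]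
  rw [this]
  simp [Matrix.det_succ_row_zero, Fin.sum_univ_succ, Fin.succAbove]

namespace IsNullFrame

variable {st : Spacetime M} {p : M} {k kb a b : TangentSpace (𝓡 4) p}

/-- A nonzero volume makes the frame a basis, and the metric is nondegenerate. -/
theorem eq_zero (h : IsNullFrame st p k kb a b) {d : TangentSpace (𝓡 4) p}
    (h1 : st.g p d kb = 0) (h2 : st.g p d k = 0) (h3 : st.g p d a = 0) (h4 : st.g p d b = 0) :
    d = 0 := by
  have hli : LinearIndependent ℝ ![kb, k, a, b] := by
    by_contra hn
    have := (st.vol p).map_linearDependent _ hn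
    rw [h.vol] at this
    exact one_ne_zero this
  have hfr : Module.finrank ℝ (TangentSpace (𝓡 4) p) = 4 :=
    (finrank_euclideanSpace_fin : Module.finrank ℝ E4 = 4)
  have hspan : Submodule.span ℝ (range ![kb, k, a, b]) = ⊤ :=
    hli.span_eq_top_of_card_eq_finrank (by rw [hfr]; simp)
  refine st.eq_zero_of_g_eq_zero fun w => ?_
  have hw : w ∈ Submodule.span ℝ (range ![kb, k, a, b]) := by rw [hspan]; trivial
  have hle : Submodule.span ℝ (range ![kb, k, a, b]) ≤ LinearMap.ker (st.g p d).toLinearMap := by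
    rw [Submodule.span_le]
    rintro _ ⟨i, rfl⟩
    fin_cases i
    exacts [h1, h2, h3, h4]
  exact hle hw

theorem expand (h : IsNullFrame st p k kb a b) (v : TangentSpace (𝓡 4) p) :
    v = (-st.g p kb v) • k + (-st.g p k v) • kb + st.g p a v • a + st.g p b v • b := by
  refine sub_eq_zero.1 (h.eq_zero ?_ ?_ ?_ ?_) <;>
  simp only [map_sub, map_add, map_smul, sub_apply, add_apply, smul_apply, smul_eq_mul, h.kk,
    h.kbkb, h.kkb, h.ka, h.k_b, h.kba, h.kbb, h.aa, h.bb, h.ab, st.g_symm p a k, st.g_symm p b k,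
    st.g_symm p a kb, st.g_symm p b kb, st.g_symm p b a, st.g_symm p kb k, st.g_symm p v] <;>
  ring

/-- In the expansion of `∂_i` over the frame, contracting `g^{ij}` with `g(w, ∂_i)` raises the index
of `g(w, ·)` and returns `w`. -/
theorem trace (h : IsNullFrame st p k kb a b)
    (B : TangentSpace (𝓡 4) p →ₗ[ℝ] TangentSpace (𝓡 4) p →ₗ[ℝ] ℝ) :
    ∑ i, ∑ j, st.gInv p i j * B (Spacetime.coordVec p j) (Spacetime.coordVec p i) =
      -B kb k - B k kb + B a a + B b b := by
  have hs : ∀ w z, ∑ i, ∑ j, st.gInv p i j * (st.g p w (Spacetime.coordVec p i) *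
      B (Spacetime.coordVec p j) z) = B w z := by
    intro w z
    have hw : st.sharp p (fun v => st.g p w v) = w := by
      refine st.eq_of_g_eq fun v => ?_
      exact st.g_sharp p (st.g p w).toLinearMap v
    conv_rhs => rw [← hw]
    simp only [Spacetime.sharp, map_sum, map_smul, LinearMap.sum_apply, LinearMap.smul_apply,
      smul_eq_mul, mul_assoc]
  rw [← hs kb k, ← hs k kb, ← hs a a, ← hs b b, ← Finset.sum_neg_distrib,
    ← Finset.sum_sub_distrib, ← Finset.sum_add_distrib, ← Finset.sum_add_distrib]
  refine Finset.sum_congr rfl fun i _ => ?_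
  rw [← Finset.sum_neg_distrib, ← Finset.sum_sub_distrib, ← Finset.sum_add_distrib,
    ← Finset.sum_add_distrib]
  refine Finset.sum_congr rfl fun j _ => ?_
  conv_lhs => rw [h.expand (Spacetime.coordVec p i)]
  simp only [map_add, map_smul, smul_eq_mul]
  ring

/-- The frame trace has four terms. The `a` term repeats `φ = r • a` in the volume form and the `b`
term repeats `b`. In the two null terms the volume form picks out one null component of `∇φ`, and
Killing's equation makes their contributions equal. -/
theorem twist_eq (h : IsNullFrame st p k kb a b) {φ : VField M}
    (hK : ∀ v w, st.g p (st.nabla φ p v) w + st.g p v (st.nabla φ p w) = 0) {r : ℝ}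
    (hr : φ p = r • a) : st.twist φ p b = -2 * r * st.g p (st.nabla φ p k) kb := by
  let B : TangentSpace (𝓡 4) p →ₗ[ℝ] TangentSpace (𝓡 4) p →ₗ[ℝ] ℝ :=
    LinearMap.mk₂ ℝ (fun x y => st.vol p ![b, x, st.nabla φ p y, φ p])
      (fun x x' y => by
        rw [alternating_swap_one_two, alternating_add_two, alternating_swap_one_two _ b _ x,
          alternating_swap_one_two _ b _ x']; ring)
      (fun c x y => by
        rw [alternating_swap_one_two, alternating_smul_two, alternating_swap_one_two _ b _ x,
          smul_eq_mul]; ring)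
      (fun x y y' => by rw [st.nabla_add, alternating_add_two])
      (fun c x y => by rw [st.nabla_smul, alternating_smul_two, smul_eq_mul])
  have ht : st.twist φ p b = -B kb k - B k kb + B a a + B b b := h.trace B
  have hB : ∀ x y, B x y = st.vol p ![b, x, st.nabla φ p y, φ p] := fun _ _ => rfl
  have hrep : ∀ x y z, x = y ∨ y = z ∨ x = z → st.vol p ![b, x, y, z] = 0 := by
    rintro x y z (rfl | rfl | rfl)
    · exact (st.vol p).map_eq_zero_of_eq _ (i := 1) (j := 2) rfl (by decide)
    · exact (st.vol p).map_eq_zero_of_eq _ (i := 2) (j := 3) rfl (by decide)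
    · exact (st.vol p).map_eq_zero_of_eq _ (i := 1) (j := 3) rfl (by decide)
  have hrepb : ∀ x y, st.vol p ![b, x, b, y] = 0 := fun x y =>
    (st.vol p).map_eq_zero_of_eq _ (i := 0) (j := 2) rfl (by decide)
  have hBbb : B b b = 0 :=
    (st.vol p).map_eq_zero_of_eq _ (i := 0) (j := 1) rfl (by decide)
  have hBaa : B a a = 0 := by
    rw [hB, hr, alternating_smul_three, hrep _ _ _ (Or.inr (Or.inr rfl)), mul_zero]
  have hv1 : st.vol p ![b, kb, k, a] = -1 := by
    rw [alternating_swap_zero_one, alternating_swap_one_two, alternating_swap_two_three, h.vol]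
    ring
  have hv2 : st.vol p ![b, k, kb, a] = 1 := by
    rw [alternating_swap_one_two, hv1]; ring
  have hBkbk : B kb k = r * st.g p (st.nabla φ p k) kb := by
    have hL : ∀ w, st.vol p ![b, kb, w, a] = st.g p kb w := by
      intro w
      conv_lhs => rw [h.expand w]
      simp only [alternating_add_two, alternating_smul_two, hrepb, hv1, hrep kb kb a (Or.inl rfl),
        hrep kb a a (Or.inr (Or.inl rfl))]
      ring
    rw [hB, hr, alternating_smul_three, hL, st.g_symm]
  have hBkkb : B k kb = r * st.g p (st.nabla φ p k) kb := by
    have hL : ∀ w, st.vol p ![b, k, w, a] = -st.g p k w := by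
      intro w
      conv_lhs => rw [h.expand w]
      simp only [alternating_add_two, alternating_smul_two, hrepb, hv2, hrep k k a (Or.inl rfl),
        hrep k a a (Or.inr (Or.inl rfl))]
      ring
    rw [hB, hr, alternating_smul_three, hL, eq_neg_of_add_eq_zero_left (hK k kb)]
  rw [ht, hBbb, hBaa, hBkbk, hBkkb]
  ring

end IsNullFrame

end

/-! ### Frames on the sphere adapted to a tangent vector -/

section

theorem exists_ne_zero_orthogonal (x w : E3) :
    ∃ v : E3, v ≠ 0 ∧ inner ℝ x v = 0 ∧ inner ℝ w v = 0 := by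
  let L : E3 →ₗ[ℝ] (Fin 2 → ℝ) := LinearMap.pi ![(innerSL ℝ x).toLinearMap, (innerSL ℝ w).toLinearMap]
  have h : LinearMap.ker L ≠ ⊥ := LinearMap.ker_ne_bot_of_finrank_lt (by simp)
  obtain ⟨v, hv, hv0⟩ := (Submodule.ne_bot_iff _).1 h
  have hv' : L v = 0 := hv
  exact ⟨v, hv0, congrFun hv' 0, congrFun hv' 1⟩

theorem inner_sphere_self (x : S2) : inner ℝ (x : E3) (x : E3) = 1 := by
  rw [real_inner_self_eq_norm_sq]; simp

variable {M : Type*} [TopologicalSpace M] [ChartedSpace E4 M] [IsManifold (𝓡 4) ∞ M]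
  {st : Spacetime M} {e : S2 → M} {k kb φ : VField M}

/-- Gram–Schmidt for the induced metric on the tangent plane of the sphere, starting from `w`. The
sign of the second vector is chosen to make the volume +1. -/
theorem exists_sphereFrame_of_ne_zero (hS : IsSpacelikeSphere st e)
    (hN : IsNullNormalPair st e k kb) (x : S2) {w : E3} (hxw : inner ℝ (x : E3) w = 0) (hw : w ≠ 0) :
    ∃ (u₁ u₂ : E3) (r : ℝ), inner ℝ (x : E3) u₁ = 0 ∧ inner ℝ (x : E3) u₂ = 0 ∧
      IsNullFrame st (pt e x) (k (pt e x)) (kb (pt e x)) (push e x u₁) (push e x u₂) ∧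
      w = r • u₁ := by
  have hp : pt e (x : E3) ∈ range e := mem_range_self _
  have hn := hS.spacelike x w hxw hw
  set n := st.g (pt e x) (push e x w) (push e x w)
  have hsq : Real.sqrt n * Real.sqrt n = n := Real.mul_self_sqrt hn.le
  have hs0 : Real.sqrt n ≠ 0 := (Real.sqrt_pos.2 hn).ne'
  set u₁ : E3 := (Real.sqrt n)⁻¹ • w
  have hx1 : inner ℝ (x : E3) u₁ = 0 := by simp only [u₁, inner_smul_right, hxw, mul_zero]
  have h11 : st.g (pt e x) (push e x u₁) (push e x u₁) = 1 := by
    simp only [u₁, map_smul, smul_apply, smul_eq_mul]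
    change _ * (_ * n) = 1
    rw [← mul_assoc, ← mul_inv, hsq, inv_mul_cancel₀ hn.ne']
  obtain ⟨w', hw'0, hxw', hww'⟩ := exists_ne_zero_orthogonal x w
  set c := st.g (pt e x) (push e x u₁) (push e x w')
  set w₂ : E3 := w' - c • u₁
  have hx2 : inner ℝ (x : E3) w₂ = 0 := by
    simp only [w₂, inner_sub_right, inner_smul_right, hxw', hx1, mul_zero, sub_zero]
  have hw₂ : w₂ ≠ 0 := by
    intro h
    have h1 : w' = (c * (Real.sqrt n)⁻¹) • w := by
      rw [mul_smul]; exact sub_eq_zero.1 h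
    rw [h1, inner_smul_right, mul_eq_zero, real_inner_self_eq_norm_sq] at hww'
    rcases hww' with h2 | h2
    · rw [h2, zero_smul] at h1; exact hw'0 h1
    · exact hw (by simpa using h2)
  have hm := hS.spacelike x w₂ hx2 hw₂
  set m := st.g (pt e x) (push e x w₂) (push e x w₂)
  have hsqm : Real.sqrt m * Real.sqrt m = m := Real.mul_self_sqrt hm.le
  have h12 : st.g (pt e x) (push e x u₁) (push e x w₂) = 0 := by
    simp only [w₂, map_sub, map_smul, smul_eq_mul, h11]
    change c - c * 1 = 0
    ring
  have key : ∀ s : ℝ, s * s = 1 →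
      st.vol (pt e x) ![kb (pt e x), k (pt e x), push e x u₁, push e x ((s * (Real.sqrt m)⁻¹) • w₂)]
        = 1 →
      IsNullFrame st (pt e x) (k (pt e x)) (kb (pt e x)) (push e x u₁)
        (push e x ((s * (Real.sqrt m)⁻¹) • w₂)) := fun s hs hv =>
    { kk := hN.null _ hp
      kbkb := hN.null' _ hp
      kkb := hN.normalized _ hp
      ka := hN.normal x _
      k_b := hN.normal x _
      kba := hN.normal' x _
      kbb := hN.normal' x _
      aa := h11
      bb := by
        simp only [map_smul, smul_apply, smul_eq_mul]
        change _ * (_ * m) = 1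
        have h1 : (Real.sqrt m)⁻¹ * (Real.sqrt m)⁻¹ * m = 1 := by
          rw [← mul_inv, hsqm, inv_mul_cancel₀ hm.ne']
        linear_combination (Real.sqrt m)⁻¹ * (Real.sqrt m)⁻¹ * m * hs + h1
      ab := by rw [(push e (x : E3)).map_smul _ w₂, (st.g _ _).map_smul, h12, smul_zero]
      vol := hv }
  have hv := st.vol_sq_eq_one (p := pt e x) (k := k (pt e x)) (kb := kb (pt e x))
    (a := push e x u₁) (b := push e x ((Real.sqrt m)⁻¹ • w₂)) (hN.null _ hp) (hN.null' _ hp)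
    (hN.normalized _ hp) (hN.normal x _) (hN.normal x _) (hN.normal' x _) (hN.normal' x _) h11
    (by
      simp only [map_smul, smul_apply, smul_eq_mul]
      change _ * (_ * m) = 1
      rw [← mul_assoc, ← mul_inv, hsqm, inv_mul_cancel₀ hm.ne'])
    (by rw [(push e (x : E3)).map_smul _ w₂, (st.g _ _).map_smul, h12, smul_zero])
  have hwu : w = Real.sqrt n • u₁ := by rw [smul_smul, mul_inv_cancel₀ hs0, one_smul]
  rcases mul_self_eq_one_iff.1 ((sq _).symm.trans hv) with hv | hv
  · refine ⟨u₁, ((1 : ℝ) * (Real.sqrt m)⁻¹) • w₂, Real.sqrt n, hx1, ?_, key 1 (by ring) ?_, hwu⟩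
    · rw [inner_smul_right, hx2, mul_zero]
    · rw [one_mul, hv]
  · refine ⟨u₁, ((-1 : ℝ) * (Real.sqrt m)⁻¹) • w₂, Real.sqrt n, hx1, ?_, key (-1) (by ring) ?_, hwu⟩
    · rw [inner_smul_right, hx2, mul_zero]
    · rw [mul_smul, (push e (x : E3)).map_smul (-1 : ℝ), alternating_smul_three, hv]; ring

theorem exists_sphereFrame (hS : IsSpacelikeSphere st e) (hN : IsNullNormalPair st e k kb) (x : S2)
    (hφ : ∃ u, push e x u = φ (pt e x)) :
    ∃ (u₁ u₂ : E3) (r : ℝ), inner ℝ (x : E3) u₁ = 0 ∧ inner ℝ (x : E3) u₂ = 0 ∧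
      IsNullFrame st (pt e x) (k (pt e x)) (kb (pt e x)) (push e x u₁) (push e x u₂) ∧
      φ (pt e x) = r • push e x u₁ := by
  have he := hS.embedding.contMDiff
  obtain ⟨u, hu⟩ := hφ
  -- The radial part of `u` is invisible to `push`; removing it puts the preimage of `φ` into the
  -- tangent plane.
  set w : E3 := u - inner ℝ (x : E3) u • (x : E3)
  have hpw : push e x w = φ (pt e x) := by
    rw [map_sub, map_smul, push_self he (sphere_ne_zero x), smul_zero, sub_zero, hu]
  have hxw : inner ℝ (x : E3) w = 0 := by
    rw [inner_sub_right, inner_smul_right, inner_sphere_self]; ring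
  -- At a zero of `φ` any adapted frame serves, with `r = 0`.
  by_cases hw : w = 0
  · obtain ⟨v, hv0, hxv, -⟩ := exists_ne_zero_orthogonal x x
    obtain ⟨u₁, u₂, r, h1, h2, h3, -⟩ := exists_sphereFrame_of_ne_zero hS hN x hxv hv0
    exact ⟨u₁, u₂, 0, h1, h2, h3, by rw [← hpw, hw, map_zero, zero_smul]⟩
  · obtain ⟨u₁, u₂, r, h1, h2, h3, h4⟩ := exists_sphereFrame_of_ne_zero hS hN x hxw hw
    exact ⟨u₁, u₂, r, h1, h2, h3, by rw [← hpw, ← map_smul, ← h4]⟩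

theorem sum_smul_e3 (u : E3) : u = ∑ i, u i • e3 i := by
  ext j
  simp [e3, Pi.single_apply]

/-- The matrix with columns `u, v, w`. -/
def colMatrix (u v w : E3) : Matrix (Fin 3) (Fin 3) ℝ := Matrix.of fun i j => ![u, v, w] j i

theorem colMatrix_det (u v w : E3) : (colMatrix u v w).det =
    u 0 * v 1 * w 2 - u 0 * v 2 * w 1 - u 1 * v 0 * w 2 + u 1 * v 2 * w 0 + u 2 * v 0 * w 1
      - u 2 * v 1 * w 0 := by
  rw [Matrix.det_fin_three]
  simp [colMatrix]
  ring

theorem transpose_colMatrix_mul (Q : Matrix (Fin 3) (Fin 3) ℝ) (u : Fin 3 → E3) (i j : Fin 3) :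
    ((colMatrix (u 0) (u 1) (u 2)).transpose * Q * colMatrix (u 0) (u 1) (u 2)) i j =
      ∑ a, ∑ b, u i a * u j b * Q a b := by
  have hcol : ∀ l m, colMatrix (u 0) (u 1) (u 2) l m = u m l := by
    intro l m
    fin_cases m <;> rfl
  simp only [Matrix.mul_apply, Matrix.transpose_apply, hcol, Finset.sum_mul]
  rw [Finset.sum_comm]
  exact Finset.sum_congr rfl fun a _ => Finset.sum_congr rfl fun b _ => by ring

theorem qFull_apply_apply (u v y : E3) :
    ∑ a, ∑ b, u a * v b * qFull st e y a b =
      st.g (pt e y) (push e y u) (push e y v) + inner ℝ y u * inner ℝ y v := by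
  conv_rhs => rw [sum_smul_e3 u, sum_smul_e3 v]
  simp only [map_sum, map_smul, sum_apply, smul_apply, smul_eq_mul, inner_sum, inner_smul_right]
  have he3 : ∀ i, inner ℝ y (e3 i) = y i := fun i => by
    simp [e3, EuclideanSpace.inner_single_right]
  simp only [he3]
  simp only [Finset.mul_sum (a := v _)]
  rw [Finset.sum_mul_sum, Finset.sum_comm (f := fun b a => v b * _), ← Finset.sum_add_distrib]
  refine Finset.sum_congr rfl fun a _ => ?_
  rw [← Finset.sum_add_distrib]
  refine Finset.sum_congr rfl fun b _ => ?_
  simp only [qFull, qMetric, Matrix.add_apply, Matrix.of_apply]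
  ring

/-- The radial vector is a null direction of the pulled-back metric and a unit vector for the added
term, while `u₁, u₂` are annihilated by the added term. So `u₁, u₂, x` is orthonormal for `qFull`.
-/
theorem colMatrix_conj_qFull (he : ContMDiff (𝓡 2) (𝓡 4) ∞ e) (x : S2) {u₁ u₂ : E3}
    (hx1 : inner ℝ (x : E3) u₁ = 0) (hx2 : inner ℝ (x : E3) u₂ = 0)
    (h11 : st.g (pt e x) (push e x u₁) (push e x u₁) = 1)
    (h22 : st.g (pt e x) (push e x u₂) (push e x u₂) = 1)
    (h12 : st.g (pt e x) (push e x u₁) (push e x u₂) = 0) :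
    (colMatrix u₁ u₂ x).transpose * qFull st e x * colMatrix u₁ u₂ x = 1 := by
  have hpx := push_self he (sphere_ne_zero x)
  ext i j
  have h := transpose_colMatrix_mul (qFull st e x) ![u₁, u₂, (x : E3)] i j
  simp only [Matrix.cons_val_zero, Matrix.cons_val_one, Matrix.cons_val] at h
  rw [h, qFull_apply_apply]
  have h21 : st.g (pt e x) (push e x u₂) (push e x u₁) = 0 := by rw [st.g_symm, h12]
  fin_cases i <;> fin_cases j <;>
    simp [h11, h22, h12, h21, hx1, hx2, hpx]

end

/-! ### 2-forms as densities and the pointwise twist identity -/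

section

theorem inner_eq_sum_three (x u : E3) : inner ℝ x u = x 0 * u 0 + x 1 * u 1 + x 2 * u 2 := by
  rw [PiLp.inner_apply, Fin.sum_univ_three]
  simp [mul_comm]

/-- A 2-form on `E3` evaluated on two vectors orthogonal to a unit vector `x`. -/
theorem apply_eq_density_mul_det {x u v : E3} (hx : inner ℝ x x = 1)
    (hu : inner ℝ x u = 0) (hv : inner ℝ x v = 0) (B : E3 → E3 → ℝ)
    (hB : B u v = ∑ i, ∑ j, u i * v j * B (e3 i) (e3 j)) (halt : ∀ i j, B (e3 i) (e3 j) = -B (e3 j) (e3 i)) :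
    B u v = density B x * (colMatrix u v x).det := by
  rw [inner_eq_sum_three] at hx hu hv
  have h00 : B (e3 0) (e3 0) = 0 := by linarith [halt 0 0]
  have h11 : B (e3 1) (e3 1) = 0 := by linarith [halt 1 1]
  have h22 : B (e3 2) (e3 2) = 0 := by linarith [halt 2 2]
  rw [hB, colMatrix_det, density]
  simp only [Fin.sum_univ_three, h00, h11, h22, halt 1 0, halt 2 1, halt 0 2]
  set a := B (e3 0) (e3 1)
  set b := B (e3 1) (e3 2)
  set c := B (e3 2) (e3 0)
  -- Both `u` and `v` are orthogonal to the unit vector `x`, so `u × v` equals the determinant times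
  -- `x`; `h0`, `h1`, `h2` are its three components.
  have h0 : u 1 * v 2 - u 2 * v 1 = (u 0 * v 1 * x 2 - u 0 * v 2 * x 1 - u 1 * v 0 * x 2
      + u 1 * v 2 * x 0 + u 2 * v 0 * x 1 - u 2 * v 1 * x 0) * x 0 := by
    linear_combination (-(u 1 * v 2 - u 2 * v 1)) * hx + (v 2 * x 1 - v 1 * x 2) * hu
      + (u 1 * x 2 - u 2 * x 1) * hv
  have h1 : u 2 * v 0 - u 0 * v 2 = (u 0 * v 1 * x 2 - u 0 * v 2 * x 1 - u 1 * v 0 * x 2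
      + u 1 * v 2 * x 0 + u 2 * v 0 * x 1 - u 2 * v 1 * x 0) * x 1 := by
    linear_combination (-(u 2 * v 0 - u 0 * v 2)) * hx + (v 0 * x 2 - v 2 * x 0) * hu
      + (u 2 * x 0 - u 0 * x 2) * hv
  have h2 : u 0 * v 1 - u 1 * v 0 = (u 0 * v 1 * x 2 - u 0 * v 2 * x 1 - u 1 * v 0 * x 2
      + u 1 * v 2 * x 0 + u 2 * v 0 * x 1 - u 2 * v 1 * x 0) * x 2 := by
    linear_combination (-(u 0 * v 1 - u 1 * v 0)) * hx + (v 1 * x 0 - v 0 * x 1) * hu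
      + (u 0 * x 1 - u 1 * x 0) * hv
  linear_combination b * h0 + c * h1 + a * h2

theorem wedge_apply_eq_density_mul_det {x u v : E3} (hx : inner ℝ x x = 1)
    (hu : inner ℝ x u = 0) (hv : inner ℝ x v = 0) (α β : E3 →ₗ[ℝ] ℝ) :
    α u * β v - α v * β u =
      density (fun u v => α u * β v - α v * β u) x * (colMatrix u v x).det := by
  refine apply_eq_density_mul_det hx hu hv (fun u v => α u * β v - α v * β u) ?_
    (fun i j => by ring)
  have hα : ∀ w : E3, α w = w 0 * α (e3 0) + w 1 * α (e3 1) + w 2 * α (e3 2) := fun w => by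
    conv_lhs => rw [sum_smul_e3 w]
    simp [Fin.sum_univ_three]
  have hβ : ∀ w : E3, β w = w 0 * β (e3 0) + w 1 * β (e3 1) + w 2 * β (e3 2) := fun w => by
    conv_lhs => rw [sum_smul_e3 w]
    simp [Fin.sum_univ_three]
  simp only [Fin.sum_univ_three]
  rw [hα u, hα v, hβ u, hβ v]
  ring

variable {M : Type*} [TopologicalSpace M] [ChartedSpace E4 M] [IsManifold (𝓡 4) ∞ M]
  {st : Spacetime M} {e : S2 → M} {k kb φ : VField M}

theorem areaForm_push_eq_density_mul_det {x u v : E3} (hx : inner ℝ x x = 1)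
    (hu : inner ℝ x u = 0) (hv : inner ℝ x v = 0) (y : E3) :
    areaForm st k kb (pt e y) (push e y u) (push e y v) =
      density (fun u v => areaForm st k kb (pt e y) (push e y u) (push e y v)) x *
        (colMatrix u v x).det := by
  refine apply_eq_density_mul_det hx hu hv
    (fun u v => areaForm st k kb (pt e y) (push e y u) (push e y v)) ?_
    (fun i j => alternating_swap_two_three _ _ _ _ _)
  conv_lhs => rw [sum_smul_e3 u, sum_smul_e3 v]
  simp only [map_sum, map_smul, areaForm]
  rw [alternating_sum_two]
  refine Finset.sum_congr rfl fun i _ => ?_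
  rw [alternating_sum_three, Finset.mul_sum]
  exact Finset.sum_congr rfl fun j _ => by ring

theorem twist_sum (st : Spacetime M) (φ : VField M) (p : M) {ι : Type*} (s : Finset ι) (r : ι → ℝ)
    (v : ι → TangentSpace (𝓡 4) p) :
    st.twist φ p (∑ i ∈ s, r i • v i) = ∑ i ∈ s, r i * st.twist φ p (v i) := by
  have h0 : ∀ b c d, st.vol p ![∑ i ∈ s, r i • v i, b, c, d] =
      ∑ i ∈ s, r i * st.vol p ![v i, b, c, d] := fun b c d => by
    rw [alternating_swap_zero_one, alternating_sum_one, ← Finset.sum_neg_distrib]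
    exact Finset.sum_congr rfl fun i _ => by rw [alternating_swap_zero_one _ b (v i)]; ring
  simp only [Spacetime.twist, h0, Finset.mul_sum]
  rw [Finset.sum_comm, Finset.sum_congr rfl fun a _ => Finset.sum_comm, Finset.sum_comm]
  refine Finset.sum_congr rfl fun i _ => ?_
  rw [Finset.sum_comm]
  exact Finset.sum_congr rfl fun a _ => Finset.sum_congr rfl fun b _ => by ring

theorem twist_push (st : Spacetime M) (φ : VField M) (e : S2 → M) (y u : E3) :
    st.twist φ (pt e y) (push e y u) = ∑ i, u i * st.twist φ (pt e y) (push e y (e3 i)) := by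
  conv_lhs => rw [sum_smul_e3 u]
  simp only [map_sum, map_smul]
  exact twist_sum st φ _ _ _ _

section Frame

variable (he : ContMDiff (𝓡 2) (𝓡 4) ∞ e) (x : S2) {u₁ u₂ : E3}
  (hx1 : inner ℝ (x : E3) u₁ = 0) (hx2 : inner ℝ (x : E3) u₂ = 0)
  (hF : IsNullFrame st (pt e x) (k (pt e x)) (kb (pt e x)) (push e x u₁) (push e x u₂))
include he hx1 hx2 hF

theorem colMatrix_conj_qFull_of_frame :
    (colMatrix u₁ u₂ x).transpose * qFull st e x * colMatrix u₁ u₂ x = 1 :=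
  colMatrix_conj_qFull he x hx1 hx2 hF.aa hF.bb hF.ab

theorem qInv_eq_of_frame :
    qInv st e x = colMatrix u₁ u₂ x * (colMatrix u₁ u₂ x).transpose := by
  have h := colMatrix_conj_qFull_of_frame he x hx1 hx2 hF
  refine Matrix.inv_eq_right_inv ?_
  rw [Matrix.mul_assoc] at h
  rw [← Matrix.mul_assoc]
  exact mul_eq_one_comm.1 h

theorem density_areaForm_mul_det :
    density (fun u v => areaForm st k kb (pt e x) (push e x u) (push e x v)) x *
      (colMatrix u₁ u₂ x).det = 1 := by
  rw [← areaForm_push_eq_density_mul_det (inner_sphere_self x) hx1 hx2 x]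
  exact hF.vol

/-- For the frame matrix `P`, orthonormality gives `det qFull = (det P)⁻²`, and unit area of the
frame gives `D = (det P)⁻¹` for the density `D`. -/
theorem areaDensity_eq_abs_density : areaDensity st e x =
    |density (fun u v => areaForm st k kb (pt e x) (push e x u) (push e x v)) x| := by
  have h := congrArg Matrix.det (colMatrix_conj_qFull_of_frame he x hx1 hx2 hF)
  have h' := density_areaForm_mul_det he x hx1 hx2 hF
  rw [Matrix.det_mul, Matrix.det_mul, Matrix.det_transpose, Matrix.det_one] at h
  rw [areaDensity, ← Real.sqrt_sq_eq_abs]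
  congr 1
  set D := density (fun u v => areaForm st k kb (pt e x) (push e x u) (push e x v)) x
  set P := (colMatrix u₁ u₂ x).det
  linear_combination D ^ 2 * h - (qFull st e x).det * (D * P + 1) * h'

/-- `qInv` is the sum of the squares of `u₁`, `u₂` and `x`, and `f` has no derivative along `u₁` or
`x`. -/
theorem twistDeriv_eq_of_frame {f : E3 → ℝ} (hf : fderiv ℝ f x u₁ = 0) (hfx : fderiv ℝ f x x = 0) :
    twistDeriv st e φ f x = st.twist φ (pt e x) (push e x u₂) * fderiv ℝ f x u₂ := by
  have hfu : ∀ u : E3, fderiv ℝ f x u = ∑ i, u i * fderiv ℝ f x (e3 i) := fun u => by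
    conv_lhs => rw [sum_smul_e3 u]
    simp only [map_sum, map_smul, smul_eq_mul]
  rw [hfu] at hf hfx
  rw [twistDeriv, qInv_eq_of_frame he x hx1 hx2 hF, twist_push, hfu u₂]
  simp only [Matrix.mul_apply, Matrix.transpose_apply, colMatrix, Matrix.of_apply,
    Fin.sum_univ_three, Matrix.cons_val_zero, Matrix.cons_val_one, Matrix.cons_val] at hf hfx ⊢
  set t := fun i => st.twist φ (pt e x) (push e x (e3 i))
  change (_ * t 0 * _ + _ * t 0 * _ + _ * t 0 * _) + (_ * t 1 * _ + _ * t 1 * _ + _ * t 1 * _) +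
    (_ * t 2 * _ + _ * t 2 * _ + _ * t 2 * _) = (_ * t 0 + _ * t 1 + _ * t 2) * _
  linear_combination (u₁ 0 * t 0 + u₁ 1 * t 1 + u₁ 2 * t 2) * hf +
    ((x : E3) 0 * t 0 + (x : E3) 1 * t 1 + (x : E3) 2 * t 2) * hfx

end Frame

theorem density_areaForm_ne_zero (hS : IsSpacelikeSphere st e) (hN : IsNullNormalPair st e k kb)
    (x : S2) : density (fun u v => areaForm st k kb (pt e x) (push e x u) (push e x v)) x ≠ 0 := by
  obtain ⟨v, hv0, hxv, -⟩ := exists_ne_zero_orthogonal x x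
  obtain ⟨u₁, u₂, r, h1, h2, h3, -⟩ := exists_sphereFrame_of_ne_zero hS hN x hxv hv0
  exact left_ne_zero_of_mul_eq_one
    (density_areaForm_mul_det hS.embedding.contMDiff x h1 h2 h3)

theorem areaDensity_eq_abs (hS : IsSpacelikeSphere st e) (hN : IsNullNormalPair st e k kb)
    (x : S2) : areaDensity st e x =
      |density (fun u v => areaForm st k kb (pt e x) (push e x u) (push e x v)) x| := by
  obtain ⟨v, hv0, hxv, -⟩ := exists_ne_zero_orthogonal x x
  obtain ⟨u₁, u₂, r, h1, h2, h3, -⟩ := exists_sphereFrame_of_ne_zero hS hN x hxv hv0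
  exact areaDensity_eq_abs_density hS.embedding.contMDiff x h1 h2 h3

/-- Away from the zeros of `φ`, the function `𝔫⁻¹ 𝔱^a ∂_a f` equals `-2 c F(k, kb)` with
`F = ∇φ`, for a function `f` with `D_a f = c ε_{ba} φ^b`. -/
theorem inv_normSq_mul_twistDeriv (hS : IsSpacelikeSphere st e) (hN : IsNullNormalPair st e k kb)
    (x : S2) {f : E3 → ℝ} {c : ℝ}
    (hK : ∀ v w, st.g (pt e x) (st.nabla φ (pt e x) v) w
      + st.g (pt e x) v (st.nabla φ (pt e x) w) = 0)
    (hφ : ∃ u, push e x u = φ (pt e x))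
    (hf : ∀ u, fderiv ℝ f x u = c * areaForm st k kb (pt e x) (φ (pt e x)) (push e x u))
    (h0 : φ (pt e x) ≠ 0) :
    1 / st.normSq φ (pt e x) * twistDeriv st e φ f x =
      -2 * c * st.g (pt e x) (st.nabla φ (pt e x) (k (pt e x))) (kb (pt e x)) := by
  have he := hS.embedding.contMDiff
  obtain ⟨u₁, u₂, r, hx1, hx2, hF, hr⟩ := exists_sphereFrame hS hN x hφ
  have hr0 : r ≠ 0 := by rintro rfl; exact h0 (by rw [hr, zero_smul])
  have hε : ∀ u, areaForm st k kb (pt e x) (φ (pt e x)) u =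
      r * st.vol (pt e x) ![kb (pt e x), k (pt e x), push e x u₁, u] := fun u => by
    rw [areaForm, hr, alternating_smul_two]
  have h1 : fderiv ℝ f x u₁ = 0 := by
    rw [hf, hε, alternating_eq_zero_two_three, mul_zero, mul_zero]
  have h2 : fderiv ℝ f x u₂ = c * r := by rw [hf, hε, hF.vol, mul_one]
  have hx : fderiv ℝ f x x = 0 := by
    rw [hf, push_self he (sphere_ne_zero x), hε]
    have := alternating_smul_three (st.vol (pt e x)) (kb (pt e x)) (k (pt e x)) (push e x u₁) 0 0
    rw [zero_smul, zero_mul] at this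
    rw [this, mul_zero, mul_zero]
  have hn : st.normSq φ (pt e x) = r ^ 2 := by
    rw [Spacetime.normSq, hr, map_smul, map_smul, smul_apply, hF.aa]
    simp only [smul_eq_mul]
    ring
  rw [twistDeriv_eq_of_frame he x hx1 hx2 hF h1 hx, h2, hF.twist_eq hK hr, hn]
  field_simp

/-- `(𝔫⁻¹ 𝔱^a ∂_a f) ε = -2 df ∧ α` on the surface, for a function `f` with
`D_a f = c ε_{ba} φ^b` and a 1-form `α` with `α(φ) = -F(k, kb)`. -/
theorem twistDeriv_mul_density (hS : IsSpacelikeSphere st e) (hN : IsNullNormalPair st e k kb)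
    (x : S2) {f : E3 → ℝ} {c : ℝ}
    (hK : ∀ v w, st.g (pt e x) (st.nabla φ (pt e x) v) w
      + st.g (pt e x) v (st.nabla φ (pt e x) w) = 0)
    (hφ : ∃ u, push e x u = φ (pt e x))
    (hf : ∀ u, fderiv ℝ f x u = c * areaForm st k kb (pt e x) (φ (pt e x)) (push e x u))
    (α : E3 →ₗ[ℝ] ℝ) (hα : ∀ u, push e x u = φ (pt e x) →
      α u = -st.g (pt e x) (st.nabla φ (pt e x) (k (pt e x))) (kb (pt e x))) :
    1 / st.normSq φ (pt e x) * twistDeriv st e φ f x *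
      density (fun u v => areaForm st k kb (pt e x) (push e x u) (push e x v)) x =
      -2 * density (fun u v => fderiv ℝ f x u * α v - fderiv ℝ f x v * α u) x := by
  have he := hS.embedding.contMDiff
  have hφ' := hφ
  obtain ⟨u₁, u₂, r, hx1, hx2, hF, hr⟩ := exists_sphereFrame hS hN x hφ
  have hε : ∀ u, areaForm st k kb (pt e x) (φ (pt e x)) u =
      r * st.vol (pt e x) ![kb (pt e x), k (pt e x), push e x u₁, u] := fun u => by
    rw [areaForm, hr, alternating_smul_two]
  have h1 : fderiv ℝ f x u₁ = 0 := by
    rw [hf, hε, alternating_eq_zero_two_three, mul_zero, mul_zero]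
  have h2 : fderiv ℝ f x u₂ = c * r := by rw [hf, hε, hF.vol, mul_one]
  have hD := density_areaForm_mul_det he x hx1 hx2 hF
  have hw := wedge_apply_eq_density_mul_det (inner_sphere_self x) hx1 hx2
    (fderiv ℝ f x).toLinearMap α
  simp only [ContinuousLinearMap.coe_coe] at hw
  rw [h1, h2] at hw
  have hαr : r * α u₁ = -st.g (pt e x) (st.nabla φ (pt e x) (k (pt e x))) (kb (pt e x)) := by
    rw [← smul_eq_mul, ← map_smul]
    exact hα _ (by rw [(push e (x : E3)).map_smul, hr])
  set D := density (fun u v => areaForm st k kb (pt e x) (push e x u) (push e x v)) x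
  set P := (colMatrix u₁ u₂ x).det
  set W := density (fun u v => fderiv ℝ f x u * α v - fderiv ℝ f x v * α u) x
  -- `hw` evaluates the wedge on the frame and `hD` says that the frame has unit area, which
  -- eliminates the determinant `P`.
  have hWD : W = -c * (r * α u₁) * D := by linear_combination -W * hD - D * hw
  -- At a zero of `φ` the left side is 0 because `1 / 0 = 0`. The right side is 0 as well: linearity
  -- of `α` at the preimage 0 of `φ` forces F = 0.
  by_cases h0 : φ (pt e x) = 0
  · have : st.normSq φ (pt e x) = 0 := by rw [Spacetime.normSq, h0, map_zero]
    have h3 := hα 0 (by rw [map_zero, h0])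
    rw [map_zero] at h3
    rw [hWD, hαr, ← h3, this]
    ring
  · rw [inv_normSq_mul_twistDeriv hS hN x hK hφ' hf h0, hWD, hαr]
    ring

end

/-! ### Foliated charts and tangent vectors of the horizon -/

section

variable {M : Type*} [TopologicalSpace M] [ChartedSpace E4 M] [IsManifold (𝓡 4) ∞ M]

section Charts

variable {χ : OpenPartialHomeomorph M E4} (hχ : χ ∈ IsManifold.maximalAtlas (𝓡 4) ∞ M) {q : M}
  (hq : q ∈ χ.source)
include hχ hq

theorem mvfderiv_eq_fderiv_maximalAtlas {F : Type*} [NormedAddCommGroup F] [NormedSpace ℝ F]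
    {f : M → F} (hf : MDifferentiableAt (𝓡 4) 𝓘(ℝ, F) f q) (v : TangentSpace (𝓡 4) q) :
    DifferentiableAt ℝ (f ∘ χ.symm) (χ q) ∧
    mvfderiv (𝓡 4) f q v = fderiv ℝ (f ∘ χ.symm) (χ q) (mvfderiv (𝓡 4) χ q v) := by
  have hi := χ.left_inv hq
  have hs : MDifferentiableAt 𝓘(ℝ, E4) (𝓡 4) χ.symm (χ q) :=
    (contMDiffAt_symm_of_mem_maximalAtlas hχ (χ.map_source hq)).mdifferentiableAt (by simp)
  have hc : MDifferentiableAt 𝓘(ℝ, E4) 𝓘(ℝ, F) (f ∘ χ.symm) (χ q) :=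
    MDifferentiableAt.comp _ (by rwa [hi]) hs
  have he : MDifferentiableAt (𝓡 4) 𝓘(ℝ, E4) χ q :=
    (contMDiffAt_of_mem_maximalAtlas hχ hq).mdifferentiableAt (by simp)
  have key := mfderiv_comp_apply q hc he v
  have hev : (f ∘ χ.symm) ∘ χ =ᶠ[𝓝 q] f := by
    filter_upwards [χ.open_source.mem_nhds hq] with z hz
    exact congrArg f (χ.left_inv hz)
  rw [hev.mfderiv_eq, mfderiv_eq_fderiv] at key
  exact ⟨hc.differentiableAt, key⟩

theorem contMDiffAt_maximalAtlas_coord (i : Fin 4) :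
    ContMDiffAt (𝓡 4) 𝓘(ℝ, ℝ) ∞ (fun z => χ z i) q :=
  (EuclideanSpace.proj i : E4 →L[ℝ] ℝ).contDiff.contMDiff.contMDiffAt.comp q
    (contMDiffAt_of_mem_maximalAtlas hχ hq)

theorem mvfderiv_maximalAtlas_coord (i : Fin 4) (v : TangentSpace (𝓡 4) q) :
    mvfderiv (𝓡 4) (fun z => χ z i) q v = mvfderiv (𝓡 4) χ q v i := by
  have h := mfderiv_comp_apply q
    ((EuclideanSpace.proj i : E4 →L[ℝ] ℝ).differentiableAt.mdifferentiableAt (x := χ q))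
    ((contMDiffAt_of_mem_maximalAtlas hχ hq).mdifferentiableAt (by simp)) v
  rw [mfderiv_eq_fderiv, ContinuousLinearMap.fderiv] at h
  exact h

/-- The differential of a chart is injective between spaces of equal dimension, hence onto. -/
theorem exists_mvfderiv_maximalAtlas_coord_ne_zero (i : Fin 4) :
    ∃ v : TangentSpace (𝓡 4) q, mvfderiv (𝓡 4) (fun z => χ z i) q v ≠ 0 := by
  have hqs := mem_chart_source E4 q
  have hinj : ∀ v : TangentSpace (𝓡 4) q, mvfderiv (𝓡 4) χ q v = 0 → v = 0 := by
    intro v hv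
    have h := (mvfderiv_eq_fderiv_maximalAtlas hχ hq
      (f := extChartAt (𝓡 4) q) (mdifferentiableAt_extChartAt hqs) v).2
    rw [hv, map_zero, ← chartComp_eq_mfderiv hqs] at h
    rw [← chartVec_chartComp hqs v, h, map_zero]
  have hinj' : Function.Injective
      ((mvfderiv (𝓡 4) χ q).comp (chartVec q q)).toLinearMap := by
    rw [injective_iff_map_eq_zero]
    intro a ha
    rw [← chartComp_chartVec hqs a, hinj (chartVec q q a) ha, map_zero]
  obtain ⟨a, ha⟩ := LinearMap.injective_iff_surjective.1 hinj' (EuclideanSpace.single i 1)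
  refine ⟨chartVec q q a, ?_⟩
  rw [mvfderiv_maximalAtlas_coord hχ hq]
  have : mvfderiv (𝓡 4) χ q (chartVec q q a) = EuclideanSpace.single i 1 := ha
  rw [this]
  simp

end Charts

/-- A differentiable function of one variable that vanishes on an interval `[0, δ)` has zero
derivative at `0`. -/
theorem deriv_eq_zero_of_eventually_ge {f : ℝ → ℝ} {d : ℝ} (hf : HasDerivAt f d 0)
    (h0 : ∀ᶠ t in 𝓝[≥] (0 : ℝ), f t = 0) : d = 0 := by
  have h1 : HasDerivWithinAt f d (Ici 0) 0 := hf.hasDerivWithinAt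
  have h2 : HasDerivWithinAt f 0 (Ici 0) 0 :=
    (hasDerivWithinAt_const (0 : ℝ) (Ici 0) (0 : ℝ)).congr_of_eventuallyEq h0
      (h0.self_of_nhdsWithin (mem_Ici.2 le_rfl))
  exact (uniqueDiffWithinAt_Ici 0).eq_deriv _ h1 h2

variable {H : Set M} {leaves : Set (Set M)} {χ : OpenPartialHomeomorph M E4}

namespace IsFoliatedChart

variable (hχ : IsFoliatedChart H leaves χ)
include hχ

theorem coord_eq_zero {q : M} (hqH : q ∈ H) (hq : q ∈ χ.source) : χ q 3 = 0 := by
  have hm : q ∈ H ∩ χ.source := ⟨hqH, hq⟩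
  rcases hχ.slice with h | h <;> rw [h] at hm
  exacts [hm.2, hm.2.1]

/-- At a boundary leaf `H` is only a half slice, so a point is sure to stay in `H` only when its
coordinate `x₂` does not decrease. -/
theorem mem_of_coord {q z : M} (hqH : q ∈ H) (hq : q ∈ χ.source) (hz : z ∈ χ.source)
    (h3 : χ z 3 = 0) (h2 : χ q 2 ≤ χ z 2) : z ∈ H := by
  have hm : q ∈ H ∩ χ.source := ⟨hqH, hq⟩
  rcases hχ.slice with h | h
  · exact ((h ▸ (⟨hz, h3⟩ : z ∈ {q ∈ χ.source | χ q 3 = 0})) : z ∈ H ∩ χ.source).1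
  · rw [h] at hm
    exact ((h ▸ (⟨hz, h3, hm.2.2.trans h2⟩ : z ∈ {q ∈ χ.source | χ q 3 = 0 ∧ 0 ≤ χ q 2})) :
      z ∈ H ∩ χ.source).1

/-- The differential of a function that vanishes on `H` annihilates the tangent space of `H`. -/
theorem mvfderiv_eq_zero_of_vanishes {q : M} (hqH : q ∈ H) (hq : q ∈ χ.source) {f : M → ℝ}
    (hf : MDifferentiableAt (𝓡 4) 𝓘(ℝ, ℝ) f q) (hf0 : ∀ᶠ z in 𝓝 q, z ∈ H → f z = 0)
    {v : TangentSpace (𝓡 4) q} (hv : mvfderiv (𝓡 4) (fun z => χ z 3) q v = 0) :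
    mvfderiv (𝓡 4) f q v = 0 := by
  obtain ⟨hd, heq⟩ := mvfderiv_eq_fderiv_maximalAtlas hχ.mem_atlas hq hf v
  rw [mvfderiv_maximalAtlas_coord hχ.mem_atlas hq] at hv
  rw [heq]
  set w : E4 := mvfderiv (𝓡 4) χ q v
  -- The chart segment in direction `w` remains in `H` for small `t ≥ 0`, so the one-sided
  -- derivative along it decides.
  have key : ∀ w : E4, w 3 = 0 → 0 ≤ w 2 → fderiv ℝ (f ∘ χ.symm) (χ q) w = 0 := by
    intro w h3 h2
    have hline : HasDerivAt (fun t : ℝ => χ q + t • w) w 0 := by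
      simpa using ((hasDerivAt_id (0 : ℝ)).smul_const w).const_add (χ q)
    have hd' : HasFDerivAt (f ∘ χ.symm) (fderiv ℝ (f ∘ χ.symm) (χ q)) (χ q + (0 : ℝ) • w) := by
      rw [zero_smul, add_zero]; exact hd.hasFDerivAt
    refine deriv_eq_zero_of_eventually_ge (hd'.comp_hasDerivAt 0 hline) ?_
    have hcont : Tendsto (fun t : ℝ => χ q + t • w) (𝓝 0) (𝓝 (χ q)) := by
      simpa using hline.continuousAt.tendsto
    have e1 := hcont.eventually (χ.open_target.mem_nhds (χ.map_source hq))
    have e2 : ∀ᶠ t : ℝ in 𝓝 0, χ.symm (χ q + t • w) ∈ H → f (χ.symm (χ q + t • w)) = 0 := by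
      have hs : Tendsto χ.symm (𝓝 (χ q)) (𝓝 q) := by
        have := (χ.symm.continuousAt (χ.map_source hq)).tendsto
        rwa [χ.left_inv hq] at this
      exact (hs.comp hcont).eventually hf0
    filter_upwards [mem_nhdsWithin_of_mem_nhds e1, mem_nhdsWithin_of_mem_nhds e2,
      self_mem_nhdsWithin] with t ht1 ht2 ht
    refine ht2 (hχ.mem_of_coord hqH hq (χ.map_target ht1) ?_ ?_)
    · rw [χ.right_inv ht1]
      simp [hχ.coord_eq_zero hqH hq, h3]
    · rw [χ.right_inv ht1]
      simpa using mul_nonneg ht h2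
  -- A direction pointing out of a boundary leaf is handled through its negative.
  rcases le_total 0 (w 2) with h2 | h2
  · exact key w hv h2
  · have := key (-w) (by simpa using hv) (by simpa using h2)
    rwa [map_neg, neg_eq_zero] at this

theorem mvfderiv_push_eq_zero {e : S2 → M} (he : ContMDiff (𝓡 2) (𝓡 4) ∞ e) (heH : range e ⊆ H)
    {y : E3} (hy : y ≠ 0) (hq : pt e y ∈ χ.source) (u : E3) :
    mvfderiv (𝓡 4) (fun z => χ z 3) (pt e y) (push e y u) = 0 := by
  rw [← fderiv_comp_pt he hy
    ((contMDiffAt_maximalAtlas_coord hχ.mem_atlas hq 3).mdifferentiableAt (by simp))]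
  have : (fun z => χ (pt e z) 3) =ᶠ[𝓝 y] fun _ => 0 := by
    filter_upwards [eventually_pt_mem he hy χ.open_source hq] with z hz
    exact hχ.coord_eq_zero (heH (mem_range_self _)) hz
  rw [this.fderiv_eq]
  simp

end IsFoliatedChart

end

/-! ### The conormal of the horizon and the potential of the rotational form -/

section

variable {M : Type*} [TopologicalSpace M] [ChartedSpace E4 M] [IsManifold (𝓡 4) ∞ M]
  {st : Spacetime M} {e : S2 → M} {k kb φ : VField M} {H U : Set M} {leaves : Set (Set M)}
  {χ : OpenPartialHomeomorph M E4}

theorem exists_nullFrame (hS : IsSpacelikeSphere st e) (hN : IsNullNormalPair st e k kb) (x : S2) :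
    ∃ u₁ u₂ : E3,
      IsNullFrame st (pt e x) (k (pt e x)) (kb (pt e x)) (push e x u₁) (push e x u₂) := by
  obtain ⟨v, hv0, hxv, -⟩ := exists_ne_zero_orthogonal x x
  obtain ⟨u₁, u₂, r, -, -, h3, -⟩ := exists_sphereFrame_of_ne_zero hS hN x hxv hv0
  exact ⟨u₁, u₂, h3⟩

section FoliatedChart

variable (hS : IsSpacelikeSphere st e) (hN : IsNullNormalPair st e k kb)
  (hχ : IsFoliatedChart H leaves χ) (heH : range e ⊆ H)
include hS hN hχ heH

/-- The conormal `dχ³` of `H` in terms of its components along the null normals. -/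
theorem mvfderiv_coord_expand (x : S2) (hq : pt e x ∈ χ.source) (v : TangentSpace (𝓡 4) (pt e x)) :
    mvfderiv (𝓡 4) (fun z => χ z 3) (pt e x) v =
      -st.g (pt e x) (kb (pt e x)) v * mvfderiv (𝓡 4) (fun z => χ z 3) (pt e x) (k (pt e x))
      - st.g (pt e x) (k (pt e x)) v * mvfderiv (𝓡 4) (fun z => χ z 3) (pt e x) (kb (pt e x)) := by
  obtain ⟨u₁, u₂, hF⟩ := exists_nullFrame hS hN x
  have h0 := fun u => hχ.mvfderiv_push_eq_zero hS.embedding.contMDiff heH (sphere_ne_zero x) hq u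
  conv_lhs => rw [hF.expand v]
  simp only [map_add, map_smul, h0, smul_eq_mul]
  ring

/-- If `dχ³(k) = 0`, then `k` is tangent to `H` and `dχ³` is a nonzero multiple of `g(k, ·)`. So `k`
is orthogonal to the tangent space of `H`, which nondegeneracy of the induced metric forbids. The
same argument applies to `kb`. -/
theorem mvfderiv_coord_ne_zero (hH : IsDHS st H leaves) (x : S2) (hq : pt e x ∈ χ.source) :
    mvfderiv (𝓡 4) (fun z => χ z 3) (pt e x) (k (pt e x)) ≠ 0 ∧
      mvfderiv (𝓡 4) (fun z => χ z 3) (pt e x) (kb (pt e x)) ≠ 0 := by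
  have hp : pt e (x : E3) ∈ range e := mem_range_self _
  have hexp := mvfderiv_coord_expand hS hN hχ heH x hq
  obtain ⟨v, hv⟩ := exists_mvfderiv_maximalAtlas_coord_ne_zero hχ.mem_atlas hq 3
  have hnn := hH.nowhere_null χ hχ (pt e x) ⟨heH hp, hq⟩
  have hkkb := hN.normalized _ hp
  constructor
  · intro hk
    have hkb : mvfderiv (𝓡 4) (fun z => χ z 3) (pt e x) (kb (pt e x)) ≠ 0 := by
      intro h
      rw [hexp, hk, h] at hv
      simp at hv
    have h0 : k (pt e x) = 0 := by
      refine hnn _ hk fun w hw => ?_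
      have hw' : mvfderiv (𝓡 4) (fun z => χ z 3) (pt e x) w = 0 := hw
      rw [hexp, hk] at hw'
      simpa [hkb] using hw'
    rw [h0] at hkkb
    simp at hkkb
  · intro hkb
    have hk : mvfderiv (𝓡 4) (fun z => χ z 3) (pt e x) (k (pt e x)) ≠ 0 := by
      intro h
      rw [hexp, hkb, h] at hv
      simp at hv
    have h0 : kb (pt e x) = 0 := by
      refine hnn _ hkb fun w hw => ?_
      have hw' : mvfderiv (𝓡 4) (fun z => χ z 3) (pt e x) w = 0 := hw
      rw [hexp, hkb] at hw'
      simpa [hk] using hw'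
    rw [h0] at hkkb
    simp at hkkb

/-- The ratio of the components of the conormal of `H` does not depend on the foliated chart. -/
theorem mvfderiv_coord_div_eq (hH : IsDHS st H leaves) {χ' : OpenPartialHomeomorph M E4}
    (hχ' : IsFoliatedChart H leaves χ') (x : S2) (hq : pt e x ∈ χ.source)
    (hq' : pt e x ∈ χ'.source) :
    mvfderiv (𝓡 4) (fun z => χ z 3) (pt e x) (k (pt e x)) /
      mvfderiv (𝓡 4) (fun z => χ z 3) (pt e x) (kb (pt e x)) =
    mvfderiv (𝓡 4) (fun z => χ' z 3) (pt e x) (k (pt e x)) /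
      mvfderiv (𝓡 4) (fun z => χ' z 3) (pt e x) (kb (pt e x)) := by
  have hp : pt e (x : E3) ∈ range e := mem_range_self _
  obtain ⟨-, hB⟩ := mvfderiv_coord_ne_zero hS hN hχ heH hH x hq
  obtain ⟨-, hB'⟩ := mvfderiv_coord_ne_zero hS hN hχ' heH hH x hq'
  set A := mvfderiv (𝓡 4) (fun z => χ z 3) (pt e x) (k (pt e x)) with hA
  set B := mvfderiv (𝓡 4) (fun z => χ z 3) (pt e x) (kb (pt e x)) with hBdef
  -- The vector `k - (A / B) • kb` is tangent to `H`, along which the defining function of the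
  -- second chart is constant.
  have h := hχ.mvfderiv_eq_zero_of_vanishes (heH hp) hq (f := fun z => χ' z 3)
    ((contMDiffAt_maximalAtlas_coord hχ'.mem_atlas hq' 3).mdifferentiableAt (by simp))
    (by filter_upwards [χ'.open_source.mem_nhds hq'] with z hz hzH
        exact hχ'.coord_eq_zero hzH hz)
    (v := k (pt e x) - (A / B) • kb (pt e x))
    (by rw [map_sub, map_smul, ← hA, ← hBdef, smul_eq_mul]; field_simp; ring)
  rw [map_sub, map_smul, smul_eq_mul, sub_eq_zero] at h
  rw [h]
  field_simp

end FoliatedChart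

theorem IsDHS.subset_of_mem (hH : IsDHS st H leaves) {L : Set M} (hL : L ∈ leaves) : L ⊆ H := by
  rw [← hH.cover]
  exact subset_sUnion_of_mem hL

/-- A rotational field is tangential to `H`. -/
theorem IsRotational.mvfderiv_coord_eq_zero (hrot : IsRotational H leaves φ)
    (hH : IsDHS st H leaves) (hχ : IsFoliatedChart H leaves χ) {q : M} (hqH : q ∈ H)
    (hq : q ∈ χ.source) : mvfderiv (𝓡 4) (fun z => χ z 3) q (φ q) = 0 := by
  obtain ⟨L, hL, hqL⟩ : q ∈ ⋃₀ leaves := by rwa [hH.cover]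
  obtain ⟨e, k, kb, rfl, hmts, -⟩ := hH.leaf_mts L hL
  obtain ⟨x, rfl⟩ := hqL
  have hx : pt e (x : E3) = e x := pt_coe e x
  obtain ⟨u, hu⟩ := hrot.tangential e hmts.sphere.embedding hL x
  have h := hχ.mvfderiv_push_eq_zero hmts.sphere.embedding.contMDiff (hH.subset_of_mem hL)
    (sphere_ne_zero x) (by rwa [hx]) u
  rw [hu] at h
  rwa [hx] at h

/-- Metric compatibility applied to a product that is constant along the surface. -/
theorem g_nabla_push_self_eq_zero (he : ContMDiff (𝓡 2) (𝓡 4) ∞ e) {X Y : VField M} {W : Set M}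
    (hW : IsOpen W) (heW : range e ⊆ W) (hX : SmoothFieldOn X W) (hY : SmoothFieldOn Y W) {c : ℝ}
    (hc : ∀ p ∈ range e, st.g p (X p) (Y p) = c) {y : E3} (hy : y ≠ 0) (u : E3) :
    st.g (pt e y) (st.nabla X (pt e y) (push e y u)) (Y (pt e y)) +
      st.g (pt e y) (X (pt e y)) (st.nabla Y (pt e y) (push e y u)) = 0 := by
  have hp : pt e y ∈ W := heW (mem_range_self _)
  rw [← st.mvfderiv_g_eq_nabla (hX.contMDiffAt hW hp) (hY.contMDiffAt hW hp),
    ← fderiv_comp_pt he hy (f := fun q => st.g q (X q) (Y q))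
      ((st.contMDiffAt_g (hX.contMDiffAt hW hp) (hY.contMDiffAt hW hp)).mdifferentiableAt (by simp))]
  have : (fun z => st.g (pt e z) (X (pt e z)) (Y (pt e z))) = fun _ => c :=
    funext fun z => hc _ (mem_range_self _)
  rw [this]
  simp

/-- The derivatives of the null components of the conormal `dχ³` along `φ`. -/
theorem exists_mvfderiv_mvfderiv_coord (hH : IsDHS st H leaves) (hU : IsOpen U) (hHU : H ⊆ U)
    (hφ : SmoothFieldOn φ U) (hK : st.IsKillingOn φ U) (hrot : IsRotational H leaves φ)
    (hS : IsSpacelikeSphere st e) (hN : IsNullNormalPair st e k kb) (heH : range e ⊆ H)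
    (hχ : IsFoliatedChart H leaves χ) (x : S2) (hq : pt e x ∈ χ.source) {u : E3}
    (hu : push e x u = φ (pt e x)) : ∃ ρ : ℝ,
    mvfderiv (𝓡 4) (fun q => mvfderiv (𝓡 4) (fun z => χ z 3) q (k q)) (pt e x) (φ (pt e x)) =
      mvfderiv (𝓡 4) (fun z => χ z 3) (pt e x) (k (pt e x)) * (ρ + (rotForm st e k kb x u +
        st.g (pt e x) (st.nabla φ (pt e x) (k (pt e x))) (kb (pt e x)))) ∧
    mvfderiv (𝓡 4) (fun q => mvfderiv (𝓡 4) (fun z => χ z 3) q (kb q)) (pt e x) (φ (pt e x)) =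
      mvfderiv (𝓡 4) (fun z => χ z 3) (pt e x) (kb (pt e x)) * (ρ - (rotForm st e k kb x u +
        st.g (pt e x) (st.nabla φ (pt e x) (k (pt e x))) (kb (pt e x)))) := by
  have he := hS.embedding.contMDiff
  have hp : pt e (x : E3) ∈ range e := mem_range_self _
  obtain ⟨W, hW, heW, hk, hkb⟩ := hN.smooth
  have hexp := mvfderiv_coord_expand hS hN hχ heH x hq
  obtain ⟨hA, hB⟩ := mvfderiv_coord_ne_zero hS hN hχ heH hH x hq
  have hh : ContMDiffOn (𝓡 4) 𝓘(ℝ, ℝ) ∞ (fun z => χ z 3) χ.source := fun z hz =>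
    (contMDiffAt_maximalAtlas_coord hχ.mem_atlas hz 3).contMDiffWithinAt
  have hk' := hk.contMDiffAt hW (heW hp)
  have hkb' := hkb.contMDiffAt hW (heW hp)
  have hφ' := hφ.contMDiffAt hU (hHU (heH hp))
  have t1 := st.mvfderiv_nabla_sub_nabla χ.open_source hq hh hk' hφ'
  have t2 := st.mvfderiv_nabla_sub_nabla χ.open_source hq hh hkb' hφ'
  have hV : IsOpen (U ∩ χ.source) := hU.inter χ.open_source
  have hφh : MDifferentiableAt (𝓡 4) 𝓘(ℝ, ℝ)
      (fun q => mvfderiv (𝓡 4) (fun z => χ z 3) q (φ q)) (pt e x) :=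
    ((contMDiffOn_mvfderiv_apply hV (hh.mono inter_subset_right)
      (hφ.mono inter_subset_left)).contMDiffAt
        (hV.mem_nhds ⟨hHU (heH hp), hq⟩)).mdifferentiableAt (by simp)
  -- `φ` is tangent to `H`, so `φ(χ³)` vanishes on `H` and has zero derivative in directions tangent
  -- to `H`.
  have hvan := fun v => hχ.mvfderiv_eq_zero_of_vanishes (heH hp) hq hφh
    (by filter_upwards [χ.open_source.mem_nhds hq] with z hz hzH
        exact hrot.mvfderiv_coord_eq_zero hH hχ hzH hz) (v := v)
  have kk := g_nabla_push_self_eq_zero (st := st) he hW heW hk hk hN.null (sphere_ne_zero x) u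
  have kbkb := g_nabla_push_self_eq_zero (st := st) he hW heW hkb hkb hN.null'
    (sphere_ne_zero x) u
  have kkb := g_nabla_push_self_eq_zero (st := st) he hW heW hk hkb hN.normalized
    (sphere_ne_zero x) u
  have K1 := hK _ (hHU (heH hp)) (k (pt e x)) (k (pt e x))
  have K2 := hK _ (hHU (heH hp)) (kb (pt e x)) (kb (pt e x))
  have K3 := hK _ (hHU (heH hp)) (k (pt e x)) (kb (pt e x))
  rw [rotForm]
  rw [hu] at kk kbkb kkb ⊢
  set p := pt e (x : E3)
  rw [map_sub, hexp (st.nabla φ p (k p)), hexp (st.nabla k p (φ p))] at t1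
  rw [map_sub, hexp (st.nabla φ p (kb p)), hexp (st.nabla kb p (φ p))] at t2
  rw [st.g_symm p (st.nabla φ p _)] at K1 K2 K3
  rw [st.g_symm p (st.nabla k p _)] at kk kkb
  rw [st.g_symm p (st.nabla kb p _)] at kbkb
  -- This combination of null normals is tangent to `H`; hence the derivatives of `φ(χ³)` along `k`
  -- and `kb` are in the ratio `A : B`, and the common factor is `ρ = R / A`.
  have hρ := hvan (kb p - (mvfderiv (𝓡 4) (fun z => χ z 3) p (kb p) /
    mvfderiv (𝓡 4) (fun z => χ z 3) p (k p)) • k p)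
    (by rw [map_sub, map_smul, smul_eq_mul]; field_simp; ring)
  rw [map_sub, map_smul, smul_eq_mul] at hρ
  rw [st.g_symm p (st.nabla φ p (k p)) (kb p)]
  set A := mvfderiv (𝓡 4) (fun z => χ z 3) p (k p)
  set B := mvfderiv (𝓡 4) (fun z => χ z 3) p (kb p)
  set R := mvfderiv (𝓡 4) (fun q => mvfderiv (𝓡 4) (fun z => χ z 3) q (φ q)) p (k p)
  set R' := mvfderiv (𝓡 4) (fun q => mvfderiv (𝓡 4) (fun z => χ z 3) q (φ q)) p (kb p)
  have hRR : R = A * (R / A) := by field_simp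
  have hRB : R' = B * (R / A) := by rw [sub_eq_zero.1 hρ]; ring
  -- Commuting the derivatives along `φ` and each normal leaves `dχ³` of `∇φ` and of `∇k` or `∇kb`.
  -- The terms along the wrong normal drop by nullness and Killing's equation. For `kb`, both
  -- remaining terms change sign, by `k·kb = -1` and by antisymmetry of `∇φ`.
  refine ⟨R / A, ?_, ?_⟩
  · linear_combination t1 + hRR + B / 2 * K1 - B / 2 * kk
  · linear_combination t2 + hRB + A / 2 * K2 - A / 2 * kbkb - B * kkb + B * K3

/-- On a leaf the rotational 1-form differs by an exact form from one whose value on `φ` is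
`-k^a kb^b ∇_a φ_b`. -/
theorem exists_potential_rotForm (hH : IsDHS st H leaves) (hU : IsOpen U) (hHU : H ⊆ U)
    (hφ : SmoothFieldOn φ U) (hK : st.IsKillingOn φ U) (hrot : IsRotational H leaves φ)
    (hS : IsSpacelikeSphere st e) (hN : IsNullNormalPair st e k kb) (heH : range e ⊆ H) :
    ∃ μ : M → ℝ, (∀ y : E3, y ≠ 0 → ContDiffAt ℝ ∞ (fun z => μ (pt e z)) y) ∧
      ∀ (x : S2) (u : E3), push e x u = φ (pt e x) →
        rotForm st e k kb x u - fderiv ℝ (fun z => μ (pt e z)) x u =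
          -st.g (pt e x) (st.nabla φ (pt e x) (k (pt e x))) (kb (pt e x)) := by
  have he := hS.embedding.contMDiff
  obtain ⟨W, hW, heW, hk, hkb⟩ := hN.smooth
  have hex : ∀ p : M, ∃ χ : OpenPartialHomeomorph M E4, p ∈ H →
      p ∈ χ.source ∧ IsFoliatedChart H leaves χ := fun p => by
    by_cases hp : p ∈ H
    · exact (hH.foliated p hp).imp fun χ h _ => h
    · exact ⟨chartAt E4 p, fun h => absurd h hp⟩
  choose X hX using hex
  have hXs := fun p hp => (hX p hp).1
  have hXf := fun p hp => (hX p hp).2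
  let a : OpenPartialHomeomorph M E4 → M → ℝ := fun χ q => mvfderiv (𝓡 4) (fun z => χ z 3) q (k q)
  let b : OpenPartialHomeomorph M E4 → M → ℝ := fun χ q => mvfderiv (𝓡 4) (fun z => χ z 3) q (kb q)
  have hne : ∀ χ, IsFoliatedChart H leaves χ → ∀ y : E3, pt e y ∈ χ.source →
      a χ (pt e y) ≠ 0 ∧ b χ (pt e y) ≠ 0 := fun χ hχ y hy => by
    have hy' : pt e (radial y : E3) = pt e y := pt_coe e _
    have := mvfderiv_coord_ne_zero hS hN hχ heH hH (radial y) (by rwa [hy'])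
    rwa [hy'] at this
  -- `Real.log` is the logarithm of the absolute value, so the sign of the ratio, which tells
  -- spacelike from timelike `H`, plays no role.
  let μ : M → ℝ := fun q => (1 / 2) * (Real.log (a (X q) q / b (X q) q))
  -- The chart chosen for `μ` may jump from point to point. Since the ratio is independent of it,
  -- near a point `μ` is given by one smooth formula in a single chart.
  have hμ : ∀ χ, IsFoliatedChart H leaves χ → ∀ y : E3, pt e y ∈ χ.source →
      μ (pt e y) = (1 / 2) * (Real.log (a χ (pt e y)) - Real.log (b χ (pt e y))) := by
    intro χ hχ y hy
    have hy' : pt e (radial y : E3) = pt e y := pt_coe e _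
    have hyH : pt e y ∈ H := heH (mem_range_self _)
    have := mvfderiv_coord_div_eq hS hN (hXf _ hyH) heH hH hχ (radial y)
      (by rw [hy']; exact hXs _ hyH) (by rwa [hy'])
    rw [hy'] at this
    rw [← Real.log_div (hne χ hχ y hy).1 (hne χ hχ y hy).2]
    exact congrArg (fun t => (1 / 2) * Real.log t) this
  have hsm : ∀ χ, IsFoliatedChart H leaves χ → ∀ y : E3, pt e y ∈ χ.source →
      ContMDiffAt (𝓡 4) 𝓘(ℝ, ℝ) ∞ (a χ) (pt e y) ∧ ContMDiffAt (𝓡 4) 𝓘(ℝ, ℝ) ∞ (b χ) (pt e y) := by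
    intro χ hχ y hy
    have hh : ContMDiffOn (𝓡 4) 𝓘(ℝ, ℝ) ∞ (fun z => χ z 3) (W ∩ χ.source) := fun z hz =>
      (contMDiffAt_maximalAtlas_coord hχ.mem_atlas hz.2 3).contMDiffWithinAt
    have hV : IsOpen (W ∩ χ.source) := hW.inter χ.open_source
    have hm : W ∩ χ.source ∈ 𝓝 (pt e y) := hV.mem_nhds ⟨heW (mem_range_self _), hy⟩
    exact ⟨(contMDiffOn_mvfderiv_apply hV hh (hk.mono inter_subset_left)).contMDiffAt hm,
      (contMDiffOn_mvfderiv_apply hV hh (hkb.mono inter_subset_left)).contMDiffAt hm⟩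
  have hev : ∀ χ, IsFoliatedChart H leaves χ → ∀ y : E3, y ≠ 0 → pt e y ∈ χ.source →
      (fun z => μ (pt e z)) =ᶠ[𝓝 y]
        fun z => (1 / 2) * (Real.log (a χ (pt e z)) - Real.log (b χ (pt e z))) := by
    intro χ hχ y hy0 hy
    filter_upwards [eventually_pt_mem he hy0 χ.open_source hy] with z hz using hμ χ hχ z hz
  refine ⟨μ, fun y hy0 => ?_, fun x u hu => ?_⟩
  · have hyH : pt e y ∈ H := heH (mem_range_self _)
    have hys := hXs _ hyH
    have hf := hXf _ hyH
    obtain ⟨ha, hb⟩ := hsm _ hf y hys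
    obtain ⟨ha0, hb0⟩ := hne _ hf y hys
    refine ContDiffAt.congr_of_eventuallyEq ?_ (hev _ hf y hy0 hys)
    exact contDiffAt_const.mul (((contDiffAt_comp_pt he hy0 ha).log ha0).sub
      ((contDiffAt_comp_pt he hy0 hb).log hb0))
  · have hx0 := sphere_ne_zero x
    have hyH : pt e x ∈ H := heH (mem_range_self _)
    have hys := hXs _ hyH
    have hf := hXf _ hyH
    set χ := X (pt e x)
    obtain ⟨ha, hb⟩ := hsm _ hf x hys
    obtain ⟨ha0, hb0⟩ := hne _ hf x hys
    obtain ⟨ρ, h1, h2⟩ := exists_mvfderiv_mvfderiv_coord hH hU hHU hφ hK hrot hS hN heH hf x hys hu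
    -- Half the difference of the logarithmic derivatives of `a` and `b` cancels `ρ` and leaves ω(φ)
    -- + F.
    rw [← hu, ← fderiv_comp_pt he hx0 (ha.mdifferentiableAt (by simp))] at h1
    rw [← hu, ← fderiv_comp_pt he hx0 (hb.mdifferentiableAt (by simp))] at h2
    have ha' := ((contDiffAt_comp_pt he hx0 ha).differentiableAt (by simp)).hasFDerivAt
    have hb' := ((contDiffAt_comp_pt he hx0 hb).differentiableAt (by simp)).hasFDerivAt
    have hd := ((ha'.log ha0).sub (hb'.log hb0)).const_mul (1 / 2)
    rw [(hev _ hf x hx0 hys).fderiv_eq, show fderiv ℝ (fun z => (1 / 2) *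
      (Real.log (a χ (pt e z)) - Real.log (b χ (pt e z)))) (x : E3) = _ from hd.fderiv]
    simp only [smul_apply, sub_apply, smul_eq_mul]
    change _ - (1 / 2) * ((a χ (pt e x))⁻¹ * fderiv ℝ (fun z => a χ (pt e z)) x u -
      (b χ (pt e x))⁻¹ * fderiv ℝ (fun z => b χ (pt e z)) x u) = _
    have h1' : fderiv ℝ (fun z => a χ (pt e z)) x u = a χ (pt e x) * _ := h1
    have h2' : fderiv ℝ (fun z => b χ (pt e z)) x u = b χ (pt e x) * _ := h2
    rw [h1', h2', inv_mul_cancel_left₀ ha0, inv_mul_cancel_left₀ hb0]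
    ring

end

/-! ### Integration by parts on the sphere and the function Y_ℓ(ζ) -/

section

theorem fderiv_smul_point_of_invariant {m : E3 → ℝ} (hm : ∀ y ≠ 0, ContDiffAt ℝ ∞ m y)
    (hom : ∀ y ≠ 0, ∀ c : ℝ, 0 < c → m (c • y) = m y) {y : E3} (hy : y ≠ 0) {c : ℝ}
    (hc : 0 < c) (u : E3) : fderiv ℝ m (c • y) u = c⁻¹ * fderiv ℝ m y u := by
  have h1 : HasFDerivAt (fun z => m (c • z)) ((fderiv ℝ m (c • y)).comp
      (c • ContinuousLinearMap.id ℝ E3)) y :=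
    ((hm _ (smul_ne_zero hc.ne' hy)).differentiableAt (by simp)).hasFDerivAt.comp y
      ((hasFDerivAt_id y).const_smul c)
  have h2 : HasFDerivAt (fun z => m (c • z)) (fderiv ℝ m y) y := by
    refine ((hm y hy).differentiableAt (by simp)).hasFDerivAt.congr_of_eventuallyEq ?_
    filter_upwards [isOpen_ne.mem_nhds hy] with z hz using hom z hz c hc
  have h3 := congrArg (fun L : E3 →L[ℝ] ℝ => L u) (h1.unique h2)
  simp only [ContinuousLinearMap.comp_apply, smul_apply, ContinuousLinearMap.id_apply,
    map_smul, smul_eq_mul] at h3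
  rw [← h3, inv_mul_cancel_left₀ hc.ne']

theorem contDiffAt_fderiv_apply {m : E3 → ℝ} {y : E3} (hm : ContDiffAt ℝ ∞ m y) (u : E3) :
    ContDiffAt ℝ ∞ (fun z => fderiv ℝ m z u) y :=
  (hm.fderiv_right (m := ∞) (by simp)).clm_apply contDiffAt_const

theorem continuous_density {B : E3 → E3 → E3 → ℝ}
    (hB : ∀ i j, ∀ y ≠ 0, ContinuousAt (fun z => B z (e3 i) (e3 j)) y) :
    Continuous (fun x : S2 => density (B x) x) := by
  have h : ∀ i j, Continuous fun x : S2 => B x (e3 i) (e3 j) := fun i j =>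
    continuous_iff_continuousAt.2 fun x => ContinuousAt.comp (f := fun x : S2 => (x : E3))
      (hB i j x (ne_zero_of_mem_unit_sphere x)) continuous_subtype_val.continuousAt
  have hx : ∀ i, Continuous fun x : S2 => (x : E3) i := fun i => by fun_prop
  exact (((hx 0).mul (h 1 2)).add ((hx 1).mul (h 2 0))).add ((hx 2).mul (h 0 1))

theorem integrable_toSphere_of_continuous {f : S2 → ℝ} (hf : Continuous f) :
    Integrable f (volume : Measure E3).toSphere :=
  hf.integrable_of_hasCompactSupport (HasCompactSupport.of_compactSpace f)

section IntegrationByParts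

variable {α : E3 → E3 → ℝ} {m Y : E3 → ℝ}
  (hα : ∀ i, ∀ y ≠ 0, ContDiffAt ℝ ∞ (fun z => α z (e3 i)) y)
  (hm : ∀ y ≠ 0, ContDiffAt ℝ ∞ m y) (hY : ∀ y ≠ 0, ContDiffAt ℝ ∞ Y y)
include hα

theorem continuousAt_extD (i j : Fin 3) {y : E3} (hy : y ≠ 0) :
    ContinuousAt (fun z => extD α z (e3 i) (e3 j)) y :=
  ((contDiffAt_fderiv_apply (hα j y hy) (e3 i)).sub
    (contDiffAt_fderiv_apply (hα i y hy) (e3 j))).continuousAt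

include hm hY

/-- This is d(Y (α - dm)) = Y dα + dY ∧ (α - dm) in components; the Hessian of `m` drops out by
symmetry. -/
theorem extD_mul_sub_fderiv (i j : Fin 3) {y : E3} (hy : y ≠ 0) :
    extD (fun z u => Y z * (α z u - fderiv ℝ m z u)) y (e3 i) (e3 j) =
      extD α y (e3 i) (e3 j) * Y y +
      (fderiv ℝ Y y (e3 i) * (α y (e3 j) - fderiv ℝ m y (e3 j)) -
        fderiv ℝ Y y (e3 j) * (α y (e3 i) - fderiv ℝ m y (e3 i))) := by
  have hYd := ((hY y hy).differentiableAt (by simp)).hasFDerivAt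
  have hd : ∀ i j, fderiv ℝ (fun z => Y z * (α z (e3 j) - fderiv ℝ m z (e3 j))) y (e3 i) =
      Y y * (fderiv ℝ (fun z => α z (e3 j)) y (e3 i) - fderiv ℝ (fderiv ℝ m) y (e3 i) (e3 j)) +
        (α y (e3 j) - fderiv ℝ m y (e3 j)) * fderiv ℝ Y y (e3 i) := by
    intro i j
    have h1 := ((hα j y hy).differentiableAt (by simp)).hasFDerivAt
    have h2 : HasFDerivAt (fderiv ℝ m) (fderiv ℝ (fderiv ℝ m) y) y :=
      (((hm y hy).fderiv_right (m := ∞) (by simp)).differentiableAt (by simp)).hasFDerivAt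
    have h3 : HasFDerivAt (fun z => fderiv ℝ m z (e3 j)) _ y :=
      h2.clm_apply (hasFDerivAt_const (e3 j) y)
    have h4 : HasFDerivAt (fun z => Y z * (α z (e3 j) - fderiv ℝ m z (e3 j))) _ y :=
      hYd.mul (h1.sub h3)
    rw [h4.fderiv]
    simp
  have hsymm : fderiv ℝ (fderiv ℝ m) y (e3 i) (e3 j) = fderiv ℝ (fderiv ℝ m) y (e3 j) (e3 i) :=
    (hm y hy).isSymmSndFDerivAt (by simp; norm_cast) (e3 i) (e3 j)
  simp only [extD]
  rw [hd, hd, hsymm]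
  ring

variable (homα : ∀ i, ∀ y ≠ 0, ∀ c : ℝ, 0 < c → α (c • y) (e3 i) = c⁻¹ * α y (e3 i))
  (homm : ∀ y ≠ 0, ∀ c : ℝ, 0 < c → m (c • y) = m y)
  (homY : ∀ y ≠ 0, ∀ c : ℝ, 0 < c → Y (c • y) = Y y)

theorem continuous_density_wedge : Continuous (fun x : S2 => density (fun u v =>
    fderiv ℝ Y x u * (α x v - fderiv ℝ m x v) - fderiv ℝ Y x v * (α x u - fderiv ℝ m x u)) x) := by
  refine continuous_density (B := fun z u v => fderiv ℝ Y z u * (α z v - fderiv ℝ m z v)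
    - fderiv ℝ Y z v * (α z u - fderiv ℝ m z u)) fun i j y hy => ?_
  have h1 := fun i => contDiffAt_fderiv_apply (hY y hy) (e3 i)
  have h2 := fun i => (hα i y hy).sub (contDiffAt_fderiv_apply (hm y hy) (e3 i))
  exact (((h1 i).mul (h2 j)).sub ((h1 j).mul (h2 i))).continuousAt

theorem continuous_density_extD_mul : Continuous (fun x : S2 => density (extD α x) x * Y x) :=
  (continuous_density fun i j _ hy => continuousAt_extD hα i j hy).mul
    (continuous_iff_continuousAt.2 fun x => ContinuousAt.comp (f := fun x : S2 => (x : E3))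
      (hY x (ne_zero_of_mem_unit_sphere x)).continuousAt continuous_subtype_val.continuousAt)

include homα homm homY

/-- Integration by parts on the sphere: `∮ Y dα = -∮ dY ∧ (α - dm)`. -/
theorem integral_density_extD_mul :
    ∫ x : S2, density (extD α x) x * Y x ∂(volume : Measure E3).toSphere =
      -∫ x : S2, density (fun u v => fderiv ℝ Y x u * (α x v - fderiv ℝ m x v)
        - fderiv ℝ Y x v * (α x u - fderiv ℝ m x u)) x ∂(volume : Measure E3).toSphere := by
  -- Stokes applied to Y (α - dm), which has degree -1 because `Y` and `m` are constant along rays.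
  have h := integral_density_extD_eq_zero (α := fun z u => Y z * (α z u - fderiv ℝ m z u))
    (fun i y hy => ((hY y hy).mul ((hα i y hy).sub
      (contDiffAt_fderiv_apply (hm y hy) (e3 i)))).of_le (by norm_cast))
    (fun i y hy c hc => by
      simp only [homY y hy c hc, homα i y hy c hc, fderiv_smul_point_of_invariant hm homm hy hc]
      ring)
  rw [eq_neg_iff_add_eq_zero, ← integral_add
    (integrable_toSphere_of_continuous (continuous_density_extD_mul hα hm hY))
    (integrable_toSphere_of_continuous (continuous_density_wedge hα hm hY)), ← h]
  refine integral_congr_ae (Eventually.of_forall fun x => ?_)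
  have hx := ne_zero_of_mem_unit_sphere x
  simp only [density]
  simp only [extD_mul_sub_fderiv hα hm hY _ _ hx]
  ring

end IntegrationByParts

/-- A nowhere zero continuous function on the sphere has constant sign. -/
theorem exists_abs_eq_mul {D : S2 → ℝ} (hD : Continuous D) (h0 : ∀ x, D x ≠ 0) :
    ∃ s : ℝ, ∀ x, |D x| = s * D x := by
  have : PreconnectedSpace S2 := isPreconnected_iff_preconnectedSpace.1
    (isPreconnected_sphere (by
      rw [← Module.finrank_eq_rank, finrank_euclideanSpace_fin]; norm_num) 0 1)
  by_cases hpos : ∀ x, 0 < D x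
  · exact ⟨1, fun x => by rw [abs_of_pos (hpos x), one_mul]⟩
  · push Not at hpos
    obtain ⟨a, ha⟩ := hpos
    refine ⟨-1, fun x => ?_⟩
    have hx : D x ≤ 0 := by
      by_contra! hx
      obtain ⟨c, hc⟩ := mem_range_of_exists_le_of_exists_ge hD ⟨a, ha⟩ ⟨x, hx.le⟩
      exact h0 c hc
    rw [abs_of_nonpos hx]; ring

variable {M : Type*} [TopologicalSpace M] [ChartedSpace E4 M] [IsManifold (𝓡 4) ∞ M]
  {st : Spacetime M} {e : S2 → M} {k kb φ : VField M} {H U : Set M} {leaves : Set (Set M)}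

theorem contDiff_sphHarm (l : ℕ) : ContDiff ℝ ∞ (sphHarm l) :=
  contDiff_const.mul ((legendreP l).contDiff_aeval ∞)

theorem isZeta_zeta_or (st : Spacetime M) (e : S2 → M) (k kb φ : VField M) :
    IsZeta st e k kb φ (zeta st e k kb φ) ∨ zeta st e k kb φ = 0 := by
  unfold zeta
  split_ifs with h
  · exact Or.inl h.choose_spec
  · exact Or.inr rfl

theorem contDiffAt_zeta_radial (st : Spacetime M) (e : S2 → M) (k kb φ : VField M) {y : E3}
    (hy : y ≠ 0) : ContDiffAt ℝ ∞ (fun z => zeta st e k kb φ (radial z)) y := by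
  rcases isZeta_zeta_or st e k kb φ with h | h
  · exact ((h.smooth.contMDiffAt).comp y (contMDiffAt_radial hy)).contDiffAt
  · rw [h]; exact contDiffAt_const

theorem contDiffAt_harmonicOn (st : Spacetime M) (e : S2 → M) (k kb φ : VField M) (l : ℕ) {y : E3}
    (hy : y ≠ 0) : ContDiffAt ℝ ∞ (harmonicOn st e k kb φ l) y :=
  (contDiff_sphHarm l).contDiffAt.comp y (contDiffAt_zeta_radial st e k kb φ hy)

/-- The chain rule and the defining equation of ζ; the factor `c` may vary with the point, as the
later identity is pointwise. -/
theorem exists_fderiv_harmonicOn (st : Spacetime M) (e : S2 → M) (k kb φ : VField M) (l : ℕ)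
    (x : S2) : ∃ c : ℝ, ∀ u, fderiv ℝ (harmonicOn st e k kb φ l) x u =
      c * areaForm st k kb (pt e x) (φ (pt e x)) (push e x u) := by
  have hx := sphere_ne_zero x
  have hζ := ((contDiffAt_zeta_radial st e k kb φ hx).differentiableAt (by simp)).hasFDerivAt
  have hd := ((contDiff_sphHarm l).differentiable (by simp)
    (zeta st e k kb φ (radial x))).hasDerivAt
  have h : HasFDerivAt (harmonicOn st e k kb φ l) _ (x : E3) := hd.comp_hasFDerivAt (x : E3) hζ
  rcases isZeta_zeta_or st e k kb φ with hz | hz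
  · refine ⟨deriv (sphHarm l) (zeta st e k kb φ (radial x)) * (areaRadius st e ^ 2)⁻¹,
      fun u => ?_⟩
    rw [h.fderiv, smul_apply, hz.deriv, smul_eq_mul, mul_assoc]
  -- If `zeta` takes its default value 0, then `Y` is constant and `c = 0` works.
  · refine ⟨0, fun u => ?_⟩
    rw [h.fderiv, hz]
    simp

end

/-! ### The multipole formula and its consequences -/

section

variable {M : Type*} [TopologicalSpace M] [ChartedSpace E4 M] [IsManifold (𝓡 4) ∞ M]
  {st : Spacetime M} {e : S2 → M} {k kb φ : VField M} {H U : Set M} {leaves : Set (Set M)}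

theorem continuous_density_areaForm (hS : IsSpacelikeSphere st e) (hN : IsNullNormalPair st e k kb) :
    Continuous (fun x : S2 =>
      density (fun u v => areaForm st k kb (pt e x) (push e x u) (push e x v)) x) := by
  obtain ⟨W, hW, heW, hk, hkb⟩ := hN.smooth
  exact continuous_density
    (B := fun y u v => areaForm st k kb (pt e y) (push e y u) (push e y v)) fun i j y hy =>
    (contDiffAt_areaForm st hS.embedding.contMDiff hW heW hk hkb hy _ _).continuousAt

/-- The rotational 1-form at a point as a linear form. -/
noncomputable def rotFormLin (st : Spacetime M) (e : S2 → M) (k kb : VField M) (y : E3) :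
    E3 →ₗ[ℝ] ℝ :=
  -((st.g (pt e y) (kb (pt e y))).toLinearMap ∘ₗ st.nablaLin k (pt e y) ∘ₗ (push e y).toLinearMap)

theorem integrable_twistIntegrand_and_spinMultipole_eq (hH : IsDHS st H leaves) (hU : IsOpen U)
    (hHU : H ⊆ U) (hφ : SmoothFieldOn φ U) (hK : st.IsKillingOn φ U)
    (hrot : IsRotational H leaves φ) (hS : IsSpacelikeSphere st e)
    (hN : IsNullNormalPair st e k kb) (hL : range e ∈ leaves) (l : ℕ) :
    SurfIntegrable st e (twistIntegrand st e k kb φ l) ∧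
      spinMultipole st e k kb φ l = (1 / 4) * surfInt st e (twistIntegrand st e k kb φ l) := by
  have he := hS.embedding.contMDiff
  have heH := hH.subset_of_mem hL
  obtain ⟨W, hW, heW, hk, hkb⟩ := hN.smooth
  obtain ⟨μ, hμ, hid⟩ := exists_potential_rotForm hH hU hHU hφ hK hrot hS hN heH
  -- The area density is the absolute value of the density of ε. The parametrization may reverse
  -- orientation, but by connectedness with one sign `s` for the whole sphere, and `s` enters both
  -- integrals alike.
  obtain ⟨s, hs⟩ := exists_abs_eq_mul (continuous_density_areaForm hS hN)
    (density_areaForm_ne_zero hS hN)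
  set Y := harmonicOn st e k kb φ l
  have hY : ∀ y : E3, y ≠ 0 → ContDiffAt ℝ ∞ Y y := fun y hy =>
    contDiffAt_harmonicOn st e k kb φ l hy
  have hα : ∀ i, ∀ y : E3, y ≠ 0 → ContDiffAt ℝ ∞ (fun z => rotForm st e k kb z (e3 i)) y :=
    fun i y hy => contDiffAt_rotForm st he hW heW hk hkb hy _
  have hparts := integral_density_extD_mul hα hμ hY
    (fun i y hy c hc => rotForm_smul_point st he k kb hy hc _)
    (fun y _ c hc => by rw [pt_smul e hc])
    (fun y _ c hc => by simp only [Y, harmonicOn, radial_smul hc])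
  have hcont := continuous_density_wedge hα hμ hY
  -- The right side is continuous, so this identity also yields integrability across the zeros of
  -- `φ`.
  have htw : ∀ x : S2, twistIntegrand st e k kb φ l x * areaDensity st e x =
      (-2 * s) * density (fun u v => fderiv ℝ Y x u * (rotForm st e k kb x v -
          fderiv ℝ (fun z => μ (pt e z)) x v) - fderiv ℝ Y x v * (rotForm st e k kb x u -
          fderiv ℝ (fun z => μ (pt e z)) x u)) x := by
    intro x
    obtain ⟨c, hc⟩ := exists_fderiv_harmonicOn st e k kb φ l x
    have h := twistDeriv_mul_density hS hN x
      (hK _ (hHU (heH (mem_range_self _)))) (hrot.tangential e hS.embedding hL x) hc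
      (rotFormLin st e k kb x - (fderiv ℝ (fun z => μ (pt e z)) x).toLinearMap)
      (fun u hu => hid x u hu)
    rw [areaDensity_eq_abs hS hN x, hs x, mul_left_comm]
    refine (congrArg (s * ·) h).trans ?_
    rw [mul_comm (-2) s, mul_assoc]
    rfl
  -- The density of ε cancels between the quotient `curlRot` and the area element, leaving dω.
  have hsp : ∀ x : S2, 2 * curlRot st e k kb x * Y x * areaDensity st e x =
      (2 * s) * (density (extD (rotForm st e k kb) x) x * Y x) := by
    intro x
    have h0 := density_areaForm_ne_zero hS hN x
    rw [areaDensity_eq_abs hS hN x, hs x, curlRot]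
    field_simp
  constructor
  · unfold SurfIntegrable
    simp only [htw]
    exact (integrable_toSphere_of_continuous hcont).const_mul _
  · unfold spinMultipole surfInt
    simp only [htw]
    rw [integral_congr_ae (Eventually.of_forall hsp), integral_const_mul, integral_const_mul, hparts]
    ring

/-- Orthogonality evaluated on `φ, k, kb` loses two terms because `φ` is orthogonal to the null
normals. The third is 𝔫 times the antisymmetrized `∇φ`, which by Killing's equation is 2 F. So F = 0
wherever `φ ≠ 0`; at zeros of `φ` the factor `1 / 0` is 0. -/
theorem twistIntegrand_eq_zero_of_hypersurfaceOrthogonal (hS : IsSpacelikeSphere st e)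
    (hN : IsNullNormalPair st e k kb) (x : S2)
    (hK : ∀ v w, st.g (pt e x) (st.nabla φ (pt e x) v) w
      + st.g (pt e x) v (st.nabla φ (pt e x) w) = 0)
    (hφ : ∃ u, push e x u = φ (pt e x)) (ho : st.HypersurfaceOrthogonalAt φ (pt e x)) (l : ℕ) :
    twistIntegrand st e k kb φ l x = 0 := by
  by_cases h0 : φ (pt e x) = 0
  · rw [twistIntegrand, Spacetime.normSq, h0]
    simp
  obtain ⟨c, hc⟩ := exists_fderiv_harmonicOn st e k kb φ l x
  rw [twistIntegrand, inv_normSq_mul_twistDeriv hS hN x hK hφ hc h0]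
  obtain ⟨u₁, u₂, r, -, -, hF, hr⟩ := exists_sphereFrame hS hN x hφ
  have hr0 : r ≠ 0 := by rintro rfl; exact h0 (by rw [hr, zero_smul])
  have h := ho (φ (pt e x)) (k (pt e x)) (kb (pt e x))
  have hk := hK (k (pt e x)) (kb (pt e x))
  set p := pt e (x : E3)
  have h1 : st.g p (φ p) (k p) = 0 := by rw [hr, map_smul, smul_apply, st.g_symm, hF.ka, smul_zero]
  have h2 : st.g p (φ p) (kb p) = 0 := by
    rw [hr, map_smul, smul_apply, st.g_symm, hF.kba, smul_zero]
  have h3 : st.g p (φ p) (φ p) = r ^ 2 := by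
    rw [hr, map_smul, map_smul, smul_apply, hF.aa]
    simp only [smul_eq_mul]
    ring
  rw [h1, h2, h3, zero_mul, zero_mul, add_zero, add_zero, mul_eq_zero] at h
  have h4 := h.resolve_left (pow_ne_zero 2 hr0)
  rw [st.g_symm p (k p)] at hk
  have h5 : st.g p (st.nabla φ p (k p)) (kb p) = 0 := by linarith
  rw [h5, mul_zero]

theorem surfInt_eq_zero {f : E3 → ℝ} (hf : ∀ x : S2, f x = 0) : surfInt st e f = 0 := by
  simp [surfInt, hf]

end

theorem mainTheorem2 {M : Type*} [TopologicalSpace M] [T2Space M] [SecondCountableTopology M]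
    [ChartedSpace E4 M] [IsManifold (𝓡 4) ∞ M] (st : Spacetime M)
    (H : Set M) (leaves : Set (Set M)) (hH : IsDHS st H leaves)
    (U : Set M) (hU : IsOpen U) (hHU : H ⊆ U)
    (φ : VField M) (hφ : SmoothFieldOn φ U) (hK : st.IsKillingOn φ U)
    (hrot : IsRotational H leaves φ) :
    (∀ (e : S2 → M) (k kb : VField M), IsMTS st e k kb → range e ∈ leaves → ∀ l : ℕ,
      SurfIntegrable st e (twistIntegrand st e k kb φ l) ∧
      spinMultipole st e k kb φ l = (1 / 4) * surfInt st e (twistIntegrand st e k kb φ l)) ∧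
    (∀ (e : S2 → M) (k kb : VField M), IsMTS st e k kb → range e ∈ leaves →
      (∀ p ∈ range e, ∀ v, st.twist φ p v = 0) → ∀ l : ℕ, spinMultipole st e k kb φ l = 0) ∧
    ((∀ p ∈ H, st.HypersurfaceOrthogonalAt φ p) →
      ∀ (e : S2 → M) (k kb : VField M), IsMTS st e k kb → range e ∈ leaves →
        ∀ l : ℕ, spinMultipole st e k kb φ l = 0) := by
  have main := fun (e : S2 → M) (k kb : VField M) (h : IsMTS st e k kb) (hL : range e ∈ leaves) =>
    integrable_twistIntegrand_and_spinMultipole_eq hH hU hHU hφ hK hrot h.sphere h.normals hL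
  refine ⟨main, fun e k kb h hL ht l => ?_, fun ho e k kb h hL l => ?_⟩
  · rw [(main e k kb h hL l).2, surfInt_eq_zero fun x => ?_, mul_zero]
    have hx := ht (pt e x) (mem_range_self _)
    simp [twistIntegrand, twistDeriv, hx]
  · have heH := hH.subset_of_mem hL
    rw [(main e k kb h hL l).2, surfInt_eq_zero fun x => ?_, mul_zero]
    have hp : pt e (x : E3) ∈ H := heH (mem_range_self _)
    exact twistIntegrand_eq_zero_of_hypersurfaceOrthogonal h.sphere h.normals x
      (hK _ (hHU hp)) (hrot.tangential e h.sphere.embedding hL x) (ho _ hp) l
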